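/- Let $K$ be a number field of degree $n_K$ over $\mathbb{Q}$ and with absolute discriminant $d_K$ (the absolute value of its discriminant). Let $\zeta_K$ be its Dedekind zeta function, given by $\zeta_K(s)=\sum_{\mathfrak a\ne 0} N(\mathfrak a)^{-s}$ (sum over the non-zero integral ideals of $K$) for $\Re(s)>1$ and by meromorphic continuation to $\mathbb{C}$, holomorphic except for a simple pole at $s=1$; let $\zeta=\zeta_{\mathbb{Q}}$ be the Riemann zeta function. For $x\in\mathbb{R}$ let $[x]$ be the integer closest to $x$; when two integers are equally close to $x$, let $[x]$ be the one closer to $0$. This meromorphic continuation exists, and for every complex number $s=\sigma+it$ with $\sigma<0$, $$|\zeta_K(s)|\le\Big(\frac{d_K}{(2\pi)^{n_K}}\Big)^{\frac12-\sigma}\,\big|1+s-[\sigma]\big|^{\,n_K\left(\frac12+[\sigma]-\sigma\right)}\,\Big(\prod_{j=1}^{-[\sigma]}|s+j-1|^{n_K}\Big)\,\zeta(1-\sigma)^{n_K},$$ where an empty product equals $1$. -/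

import Mathlib

/-- The integer closest to `x`; when two integers are equally close, the one closer to `0`. -/
noncomputable def nearestInt (x : ℝ) : ℤ :=
  if 0 ≤ x then ⌈x - 1 / 2⌉ else ⌊x + 1 / 2⌋

/-- No integer is closer to `x` than `nearestInt x`. -/
theorem nearestInt_le (x : ℝ) (m : ℤ) : |x - nearestInt x| ≤ |x - m| := by
  have key : ∀ k : ℤ, |x - k| ≤ 1 / 2 → |x - k| ≤ |x - m| := by
    intro k hk
    rcases eq_or_ne k m with rfl | h
    · exact le_rfl
    · have h1 : (1 : ℝ) ≤ |(m : ℝ) - k| := by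
        have : (1 : ℤ) ≤ |m - k| := Int.one_le_abs (sub_ne_zero.2 h.symm)
        exact_mod_cast this
      have h2 : |(m : ℝ) - k| ≤ |x - k| + |x - m| := by
        have := abs_sub (x - k) (x - m)
        have e : (m : ℝ) - k = (x - k) - (x - m) := by ring
        rw [e]; exact this
      linarith
  apply key
  unfold nearestInt
  split_ifs
  · have h1 := Int.le_ceil (x - 1 / 2)
    have h2 := Int.ceil_lt_add_one (x - 1 / 2)
    rw [abs_le]; constructor <;> linarith
  · have h1 := Int.floor_le (x + 1 / 2)
    have h2 := Int.lt_floor_add_one (x + 1 / 2)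
    rw [abs_le]; constructor <;> linarith

/-- Among the integers closest to `x`, `nearestInt x` is the one closest to `0`. -/
theorem abs_nearestInt_le (x : ℝ) (m : ℤ) (hm : |x - m| = |x - nearestInt x|) :
    |nearestInt x| ≤ |m| := by
  unfold nearestInt at *
  split_ifs at * with h
  · have h1 := Int.le_ceil (x - 1 / 2)
    have h2 := Int.ceil_lt_add_one (x - 1 / 2)
    have h0 : 0 ≤ ⌈x - 1 / 2⌉ := by
      have : (-1 : ℤ) < ⌈x - 1 / 2⌉ := Int.lt_ceil.2 (by push_cast; linarith)
      omega
    have h3 : |x - m| ≤ 1 / 2 := by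
      rw [hm, abs_le]; constructor <;> linarith
    rw [abs_le] at h3
    have : ⌈x - 1 / 2⌉ ≤ m := Int.ceil_le.2 (by linarith)
    rw [abs_of_nonneg h0]; exact this.trans (le_abs_self m)
  · have h1 := Int.floor_le (x + 1 / 2)
    have h2 := Int.lt_floor_add_one (x + 1 / 2)
    have h0 : ⌊x + 1 / 2⌋ ≤ 0 := by
      have : ⌊x + 1 / 2⌋ < 1 := Int.floor_lt.2 (by push_cast; linarith)
      omega
    have h3 : |x - m| ≤ 1 / 2 := by
      rw [hm, abs_le]; constructor <;> linarith
    rw [abs_le] at h3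
    have : m ≤ ⌊x + 1 / 2⌋ := Int.le_floor.2 (by linarith)
    rw [abs_of_nonpos h0]; exact (neg_le_neg this).trans (neg_le_abs m)

/-- `Z` is the Dedekind zeta function of `K` on the whole plane: it agrees with the series
`∑ N(𝔞)⁻ˢ` (Mathlib's `NumberField.dedekindZeta`) for `Re s > 1`, it is holomorphic on `ℂ ∖ {1}`,
and it has a simple pole at `1`. By the identity theorem it is unique on `ℂ ∖ {1}`. -/
structure IsDedekindZeta (K : Type*) [Field K] [NumberField K] (Z : ℂ → ℂ) : Prop where
  eq_series : ∀ s : ℂ, 1 < s.re → Z s = NumberField.dedekindZeta K s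
  holomorphic : DifferentiableOn ℂ Z {1}ᶜ
  simple_pole : meromorphicOrderAt Z 1 = -1

/-- Two functions as in `IsDedekindZeta` agree away from `1`. -/
theorem IsDedekindZeta.unique {K : Type*} [Field K] [NumberField K] {Z W : ℂ → ℂ}
    (hZ : IsDedekindZeta K Z) (hW : IsDedekindZeta K W) : Set.EqOn Z W {1}ᶜ := by
  have hc : IsPreconnected ({1}ᶜ : Set ℂ) :=
    (isConnected_compl_singleton_of_one_lt_rank (by simp) 1).isPreconnected
  have ho : IsOpen ({1}ᶜ : Set ℂ) := isOpen_compl_singleton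
  refine (hZ.holomorphic.analyticOnNhd ho).eqOn_of_preconnected_of_eventuallyEq
    (hW.holomorphic.analyticOnNhd ho) hc (z₀ := 2) (by simp) ?_
  have : {s : ℂ | 1 < s.re} ∈ nhds (2 : ℂ) :=
    (isOpen_lt continuous_const Complex.continuous_re).mem_nhds (by simp)
  filter_upwards [this] with s hs
  rw [hZ.eq_series s hs, hW.eq_series s hs]

/-! For Re s < 0 the functional equation writes ζ_K(s) as |d_K|^(1/2 - s) times a quotient of
archimedean Gamma factors times ζ_K(1 - s), where 1 - s lies in the region of absolute convergence.
The first factor is explicit; the other two are bounded separately, and the continuation itself has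
to be constructed.

Zeta factor. At most n primes lie above each rational prime, so they can be numbered by n indices.
Grouping the prime factors of an ideal by index splits its norm into n natural numbers that
determine the ideal (`normPart_injective`); hence the ideal sum at a real point σ' > 1 is at most
ζ(σ')^n (`sum_absNorm_rpow_le`).

Gamma factor. A real place contributes E(s) = Γ_ℝ(1-s)/Γ_ℝ(s); by the duplication formula a complex
place contributes E(s)·O(s) with O(s) = Γ_ℝ(2-s)/Γ_ℝ(1+s). So n factors in all have to be bounded by
the same quantity. Both E and O have modulus 1 on Re w = 1/2 and |1+w|/(2π) on Re w = -1/2, and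
Phragmén–Lindelöf interpolates without loss (`norm_le_rpow_of_strip`). A step of 1 to the left
exchanges E and O and costs one linear factor, which produces the product over j
(`norm_gammaQuot_sub_natCast_le`).

Continuation and functional equation. This is Hecke's method. Poisson summation transforms the theta
series of a fractional ideal into that of its trace dual (`idealTheta_eq`). Its mean over a
fundamental domain of the unit lattice in logarithmic space has as Mellin transform, after unfolding
over units and removing the constant term, the completed partial zeta function of an ideal class
(`mellin_thetaMean_sub`). The transformation law makes these means a `WeakFEPair`. Summation over
classes gives the entire function (s-1)ζ_K(s) (`dedekindEntire`), and passage to the dual only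
permutes the classes. The pole at 1 is genuine by the class number formula, and uniqueness transfers
the bound to every continuation. -/

/-! ### Phragmén–Lindelöf interpolation in a strip. -/

open Complex in
/-- A Phragmén–Lindelöf bound on the strip `-1/2 ≤ Re w ≤ 1/2` with the sharp convex majorant. -/
theorem norm_le_rpow_of_strip {h : ℂ → ℂ} (hd : DiffContOnCl ℂ h (re ⁻¹' Set.Ioo (-(1 / 2)) (1 / 2)))
    {C : ℝ} (hC : ∀ w : ℂ, -(1 / 2) < w.re → w.re < 1 / 2 → ‖h w‖ ≤ C * Real.exp (2 * |w.im|))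
    (hr : ∀ w : ℂ, w.re = 1 / 2 → ‖h w‖ ≤ 1)
    (hl : ∀ w : ℂ, w.re = -(1 / 2) → ‖h w‖ ≤ ‖1 + w‖ / (2 * Real.pi))
    {w : ℂ} (hw₁ : -(1 / 2) ≤ w.re) (hw₂ : w.re ≤ 1 / 2) :
    ‖h w‖ ≤ (‖1 + w‖ / (2 * Real.pi)) ^ (1 / 2 - w.re) := by
  have hsq : ∀ z : ℂ, ‖1 + z‖ ^ 2 = (1 + z.re) ^ 2 + z.im ^ 2 := fun z => by
    rw [← normSq_eq_norm_sq, normSq_apply]; simp; ring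
  set c := ‖1 + w‖ with hc
  have hc0 : 0 < c := by
    rw [hc, norm_pos_iff]
    intro h0
    have := congrArg re h0
    simp at this
    linarith
  have hc2 := hsq w
  rw [← hc] at hc2
  -- With b = 1/2 - Re z and y = Im z, the cubic below has real part b y² - b³/3 + 7b/12, a harmonic
  -- polynomial equal to 0 on Re z = 1/2 and to |1+z|² on Re z = -1/2. On the left line Re L is
  -- therefore log(c/2π) + (|1+z|²/c² - 1)/2, the majorant of log(|1+z|/2π) coming from the tangent
  -- of log, with contact at |1+z| = c; this explains the -1/2.
  set l := Real.log (c / (2 * Real.pi)) - 1 / 2 with hl_def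
  let L : ℂ → ℂ := fun z => (1 / 2 - z) * (l : ℂ) +
    (-(1 / 2 - z) ^ 3 / 3 + 7 / 12 * (1 / 2 - z)) * ((1 / (2 * c ^ 2) : ℝ) : ℂ)
  have hLre : ∀ z : ℂ, (L z).re = (1 / 2 - z.re) * l + ((1 / 2 - z.re) * z.im ^ 2 -
      (1 / 2 - z.re) ^ 3 / 3 + 7 / 12 * (1 / 2 - z.re)) * (1 / (2 * c ^ 2)) := fun z => by
    have e1 : ((-(1 / 2 - z) ^ 3 / 3 + 7 / 12 * (1 / 2 - z)) : ℂ) =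
      (((-((1 / 2 - z.re) ^ 3 - 3 * (1 / 2 - z.re) * z.im ^ 2) / 3 + 7 / 12 * (1 / 2 - z.re) : ℝ)) : ℂ)
      + ((((3 * (1 / 2 - z.re) ^ 2 * z.im - z.im ^ 3) / 3 - 7 / 12 * z.im : ℝ)) : ℂ) * I := by
      conv_lhs => rw [← re_add_im z]
      push_cast
      have : I ^ 3 = - I := by rw [pow_succ, I_sq]; ring
      ring_nf
      rw [this, I_sq]; ring
    simp only [L]
    rw [e1, add_re, re_mul_ofReal, re_mul_ofReal, add_re, ofReal_re, mul_I_re, ofReal_im]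
    simp only [sub_re, one_re, div_ofNat_re]
    ring
  have hLd : Differentiable ℂ L := by fun_prop
  have hic : 0 < 1 / (2 * c ^ 2) := by positivity
  have key : ‖(fun z => h z * exp (-(L z))) w‖ ≤ 1 := by
    -- The strip has width 1, so growth exp(B·exp(c|y|)) is admissible for every c < π; c = 1 and B
    -- = 2 suffice.
    refine PhragmenLindelof.vertical_strip (f := fun z => h z * exp (-(L z))) (a := -(1 / 2)) (b := 1 / 2)
      (hd.smul (hLd.neg.cexp.diffContOnCl)) ⟨1, ?_, 2, ?_⟩ ?_ ?_ hw₁ hw₂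
    · have := Real.pi_gt_three
      norm_num; linarith
    · refine Asymptotics.IsBigO.of_bound (|C| * Real.exp (|l| + 1 / (2 * c ^ 2))) ?_
      refine Filter.eventually_inf_principal.2 (Filter.Eventually.of_forall fun z hz => ?_)
      obtain ⟨hz1, hz2⟩ := hz
      rw [norm_mul, norm_exp, neg_re, hLre, Real.norm_of_nonneg (Real.exp_pos _).le]
      have h1 := (hC z hz1 hz2).trans (mul_le_mul_of_nonneg_right (le_abs_self C) (Real.exp_pos _).le)
      have h2 : Real.exp (2 * |z.im|) ≤ Real.exp (2 * Real.exp (1 * |z.im|)) := by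
        apply Real.exp_le_exp.2
        have := Real.add_one_le_exp (1 * |z.im|)
        linarith
      -- The quadratic term b y² is nonnegative, so Re L is bounded below on the strip and the
      -- factor exp(-L) is bounded.
      have h3 : -((1 / 2 - z.re) * l + ((1 / 2 - z.re) * z.im ^ 2 -
          (1 / 2 - z.re) ^ 3 / 3 + 7 / 12 * (1 / 2 - z.re)) * (1 / (2 * c ^ 2)))
          ≤ |l| + 1 / (2 * c ^ 2) := by
        have hb0 : 0 ≤ 1 / 2 - z.re := by linarith
        have hb1 : 1 / 2 - z.re ≤ 1 := by linarith
        generalize 1 / 2 - z.re = b at hb0 hb1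
        have i1 : -(b * l) ≤ |l| := by
          have := neg_abs_le l
          have := abs_nonneg l
          nlinarith
        have i2 : b ^ 3 ≤ 1 := pow_le_one₀ hb0 hb1
        have i3 : 0 ≤ b * z.im ^ 2 := by positivity
        have i4 : -(b * z.im ^ 2 - b ^ 3 / 3 + 7 / 12 * b) * (1 / (2 * c ^ 2)) ≤ 1 * (1 / (2 * c ^ 2)) :=
          mul_le_mul_of_nonneg_right (by linarith) hic.le
        linarith
      calc _ ≤ (|C| * Real.exp (2 * |z.im|)) * Real.exp (|l| + 1 / (2 * c ^ 2)) :=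
            mul_le_mul h1 (Real.exp_le_exp.2 h3) (Real.exp_pos _).le (by positivity)
        _ = |C| * Real.exp (|l| + 1 / (2 * c ^ 2)) * Real.exp (2 * |z.im|) := by ring
        _ ≤ _ := mul_le_mul_of_nonneg_left h2 (by positivity)
    · intro z hz
      have hz2 := hsq z
      rw [norm_mul, norm_exp, neg_re, hLre, Real.exp_neg, ← div_eq_mul_inv,
        div_le_one (Real.exp_pos _)]
      refine (hl z hz).trans ?_
      have hzp : 0 < ‖1 + z‖ := by
        have : 0 < ‖1 + z‖ ^ 2 := by rw [hz2, hz]; positivity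
        exact (norm_nonneg _).lt_of_ne fun h => by rw [← h] at this; norm_num at this
      have hx : 0 < ‖1 + z‖ / (2 * Real.pi) := by positivity
      rw [← Real.log_le_iff_le_exp hx]
      have e : ‖1 + z‖ / (2 * Real.pi) = c / (2 * Real.pi) * (‖1 + z‖ / c) := by field_simp
      have e2 : Real.log (‖1 + z‖ / c) = 1 / 2 * Real.log (‖1 + z‖ ^ 2 / c ^ 2) := by
        rw [← div_pow, Real.log_pow]; push_cast; ring
      have e3 := Real.log_le_sub_one_of_pos (x := ‖1 + z‖ ^ 2 / c ^ 2) (by positivity)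
      rw [e, Real.log_mul (by positivity) (by positivity), e2, hl_def, hz]
      rw [hz2, hz] at e3 ⊢
      have e4 : ((1 + -(1 / 2)) ^ 2 + z.im ^ 2) / c ^ 2 = (1 / 4 + z.im ^ 2) * (1 / (2 * c ^ 2)) * 2 := by
        field_simp; ring
      rw [e4] at e3 ⊢
      linarith
    · intro z hz
      rw [norm_mul, norm_exp, neg_re, hLre, hz]
      simpa using hr z hz
  rw [norm_mul, norm_exp, neg_re, Real.exp_neg, ← div_eq_mul_inv, div_le_one (Real.exp_pos _)] at key
  refine key.trans ?_
  rw [Real.rpow_def_of_pos (by positivity), hLre]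
  apply Real.exp_le_exp.2
  have hb0 : 0 ≤ 1 / 2 - w.re := by linarith
  have hb1 : 1 / 2 - w.re ≤ 1 := by linarith
  have hwre : w.re = 1 / 2 - (1 / 2 - w.re) := by ring
  rw [hl_def]
  rw [hwre] at hc2
  generalize 1 / 2 - w.re = b at *
  -- Since c² = (3/2 - b)² + (Im w)², b c² exceeds the polynomial by b(1-b)(5-4b)/3, which is
  -- nonnegative for 0 ≤ b ≤ 1.
  have : (b * w.im ^ 2 - b ^ 3 / 3 + 7 / 12 * b) * (1 / (2 * c ^ 2)) ≤ b * (1 / 2) := by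
    rw [mul_one_div, div_le_iff₀ (by positivity), hc2]
    nlinarith [mul_nonneg hb0 (mul_nonneg (sub_nonneg.2 hb1) (by linarith : (0:ℝ) ≤ 5 - 4 * b))]
  linarith

/-! ### Quotients of Gamma factors. -/

open Complex in
theorem norm_Gamma_le_Gamma_re {s : ℂ} (hs : 0 < s.re) : ‖Gamma s‖ ≤ Real.Gamma s.re := by
  rw [Gamma_eq_integral hs, Real.Gamma_eq_integral hs, GammaIntegral]
  refine (MeasureTheory.norm_integral_le_integral_norm _).trans_eq ?_
  refine MeasureTheory.setIntegral_congr_fun measurableSet_Ioi fun x hx => ?_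
  simp only [norm_mul, norm_real, Real.norm_of_nonneg (Real.exp_pos _).le,
    norm_cpow_eq_rpow_re_of_pos hx, sub_re, one_re]

open Complex in
theorem norm_cos_le_exp (z : ℂ) : ‖cos z‖ ≤ Real.exp |z.im| := by
  rw [cos, norm_div, norm_ofNat, div_le_iff₀ two_pos]
  refine (norm_add_le _ _).trans ?_
  rw [norm_exp, norm_exp]
  have h1 : (z * I).re ≤ |z.im| := by simpa using neg_le_abs z.im
  have h2 : (-z * I).re ≤ |z.im| := by simpa using le_abs_self z.im
  linarith [Real.exp_le_exp.2 h1, Real.exp_le_exp.2 h2]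

open Complex in
theorem norm_sin_le_exp (z : ℂ) : ‖sin z‖ ≤ Real.exp |z.im| := by
  rw [← cos_sub_pi_div_two]
  refine (norm_cos_le_exp _).trans_eq ?_
  have : ((Real.pi : ℂ) / 2).im = 0 := by
    rw [div_ofNat_im, ofReal_im, zero_div]
  rw [sub_im, this, sub_zero]

open Complex in
theorem norm_Gammaℝ_eq {s t : ℂ} (h : t = (starRingEnd ℂ) s) : ‖Gammaℝ t‖ = ‖Gammaℝ s‖ := by
  have hre : (-t / 2).re = (-s / 2).re := by rw [h]; simp
  rw [Gammaℝ_def, Gammaℝ_def, norm_mul, norm_mul, norm_cpow_eq_rpow_re_of_pos Real.pi_pos,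
    norm_cpow_eq_rpow_re_of_pos Real.pi_pos, hre]
  congr 1
  rw [show t / 2 = (starRingEnd ℂ) (s / 2) by rw [h, map_div₀, map_ofNat], Gamma_conj, norm_conj]

/-- The quotient of Gamma factors at a real place, in entire form. -/
noncomputable def evenGammaQuot (s : ℂ) : ℂ :=
  Complex.Gammaℂ (1 - s) * Complex.cos (Real.pi * (1 - s) / 2)

/-- The companion of `evenGammaQuot` with a shift of the argument by one. -/
noncomputable def oddGammaQuot (s : ℂ) : ℂ :=
  Complex.Gammaℂ (1 - s) * Complex.sin (Real.pi * (1 - s) / 2)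

-- The reflection formula at 1 - s, whose real part is positive. At the poles of `Gammaℝ s` the
-- cosine vanishes, in agreement with the totalized inverse.
open Complex in
theorem evenGammaQuot_eq {s : ℂ} (hs : s.re < 1) : evenGammaQuot s = Gammaℝ (1 - s) * (Gammaℝ s)⁻¹ := by
  have h := Gammaℝ_div_Gammaℝ_one_sub (s := 1 - s) fun n hn => by
    have := congrArg re hn
    simp at this
    have : (0 : ℝ) ≤ n := n.cast_nonneg
    linarith
  rw [evenGammaQuot, ← h, sub_sub_cancel, div_eq_mul_inv]

open Complex in
theorem oddGammaQuot_eq {s : ℂ} (hs : s.re < 1) :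
    oddGammaQuot s = Gammaℝ (2 - s) * (Gammaℝ (1 + s))⁻¹ := by
  have h := inv_Gammaℝ_two_sub (s := 1 - s) fun n hn => by
    have := congrArg re hn
    simp at this
    have : (0 : ℝ) ≤ n := n.cast_nonneg
    linarith
  have h2 : Gammaℝ (2 - s) ≠ 0 := Gammaℝ_ne_zero_of_re_pos (by simp; linarith)
  rw [show (2 : ℂ) - (1 - s) = 1 + s by ring, show 1 - s + 1 = 2 - s by ring] at h
  rw [h, oddGammaQuot]
  field_simp

-- The duplication formula, applied to numerator and denominator: a complex place behaves like one
-- even and one odd real factor, so bounding these two quotients handles all places.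
open Complex in
theorem evenGammaQuot_mul_oddGammaQuot {s : ℂ} (hs : s.re < 1) :
    evenGammaQuot s * oddGammaQuot s = Gammaℂ (1 - s) * (Gammaℂ s)⁻¹ := by
  rw [evenGammaQuot_eq hs, oddGammaQuot_eq hs, ← Gammaℝ_mul_Gammaℝ_add_one,
    ← Gammaℝ_mul_Gammaℝ_add_one s, mul_inv, show 1 - s + 1 = 2 - s by ring, add_comm s 1]
  ring

-- The real part of 1 - w stays in the compact interval [1/2, 3/2], where |Γ| is at most Γ of the
-- real part. This supplies the a priori growth needed for Phragmén–Lindelöf.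
open Complex in
theorem norm_Gammaℂ_one_sub_le : ∃ C : ℝ, 0 ≤ C ∧ ∀ w : ℂ, -(1 / 2) < w.re → w.re < 1 / 2 →
    ‖Gammaℂ (1 - w)‖ ≤ C := by
  have hc : ContinuousOn Real.Gamma (Set.Icc (1 / 2) (3 / 2)) := fun x hx =>
    (Real.differentiableAt_Gamma fun m => by
      have := hx.1
      have : (0 : ℝ) ≤ m := m.cast_nonneg
      linarith).continuousAt.continuousWithinAt
  obtain ⟨C, hC⟩ := isCompact_Icc.exists_bound_of_continuousOn hc
  refine ⟨2 * 1 * max C 0, by positivity, fun w h1 h2 => ?_⟩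
  rw [Gammaℂ_def, norm_mul, norm_mul]
  have hre : (1 - w).re = 1 - w.re := by simp
  refine mul_le_mul (mul_le_mul (by simp) ?_ (norm_nonneg _) zero_le_two) ?_ (norm_nonneg _)
    (by norm_num)
  · have : (2 * Real.pi : ℂ) = ((2 * Real.pi : ℝ) : ℂ) := by push_cast; rfl
    rw [this, norm_cpow_eq_rpow_re_of_pos (by positivity)]
    refine Real.rpow_le_one_of_one_le_of_nonpos (by linarith [Real.pi_gt_three]) ?_
    simp; linarith
  · refine (norm_Gamma_le_Gamma_re (by rw [hre]; linarith)).trans ?_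
    exact (Real.le_norm_self _).trans ((hC _ (by rw [hre]; constructor <;> linarith)).trans
      (le_max_left _ _))

open Complex in
theorem differentiableOn_Gammaℂ_one_sub : ∀ w : ℂ, w.re < 1 →
    DifferentiableAt ℂ (fun w => Gammaℂ (1 - w)) w := fun w hw => by
  have h : Gammaℂ (1 - w) ≠ 0 := by
    rw [Gammaℂ_def]
    refine mul_ne_zero (mul_ne_zero two_ne_zero ?_) (Gamma_ne_zero_of_re_pos (by simpa using hw))
    simp [cpow_eq_zero_iff, Real.pi_ne_zero]
  have := ((differentiable_Gammaℂ_inv (1 - w)).inv (inv_ne_zero h)).comp w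
    ((differentiableAt_const (1 : ℂ)).sub differentiableAt_id)
  simpa [Function.comp_def] using this

open Complex in
theorem diffContOnCl_strip {f : ℂ → ℂ} (hf : ∀ w : ℂ, w.re < 1 → DifferentiableAt ℂ f w) :
    DiffContOnCl ℂ f (re ⁻¹' Set.Ioo (-(1 / 2)) (1 / 2)) := by
  refine DifferentiableOn.diffContOnCl fun w hw => (hf w ?_).differentiableWithinAt
  have : closure (re ⁻¹' Set.Ioo (-(1 / 2)) (1 / 2)) ⊆ re ⁻¹' Set.Icc (-(1 / 2)) (1 / 2) :=
    closure_minimal (Set.preimage_mono Set.Ioo_subset_Icc_self) (isClosed_Icc.preimage continuous_re)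
  have := (this hw).2
  linarith

theorem abs_im_pi_mul_one_sub_div_two (w : ℂ) :
    |(Real.pi * (1 - w) / 2 : ℂ).im| ≤ 2 * |w.im| := by
  have : (Real.pi * (1 - w) / 2 : ℂ).im = -(Real.pi / 2 * w.im) := by
    rw [Complex.div_ofNat_im, Complex.im_ofReal_mul]; simp; ring
  rw [this, abs_neg, abs_mul, abs_of_pos (by positivity)]
  exact mul_le_mul_of_nonneg_right (by linarith [Real.pi_lt_four]) (abs_nonneg _)

open Complex in
theorem norm_one_add_eq_norm {w : ℂ} (hw : w.re = -(1 / 2)) : ‖1 + w‖ = ‖w‖ := by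
  rw [← norm_neg w, ← norm_conj (-w)]
  congr 1
  apply Complex.ext <;> simp [hw]
  norm_num

-- On Re w = 1/2 one has 1 - w = conj w, so the quotient has modulus 1. On Re w = -1/2 one has 1 - w
-- = conj(w + 2), and Γ_ℝ(w+2) = Γ_ℝ(w)·w/(2π) leaves |w|/(2π).
open Complex in
theorem norm_evenGammaQuot_le {w : ℂ} (hw₁ : -(1 / 2) ≤ w.re) (hw₂ : w.re ≤ 1 / 2) :
    ‖evenGammaQuot w‖ ≤ (‖1 + w‖ / (2 * Real.pi)) ^ (1 / 2 - w.re) := by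
  obtain ⟨C, hC0, hC⟩ := norm_Gammaℂ_one_sub_le
  refine norm_le_rpow_of_strip (C := C) (diffContOnCl_strip fun w hw => ?_) (fun w h1 h2 => ?_)
    (fun w hw => ?_) (fun w hw => ?_) hw₁ hw₂
  · exact (differentiableOn_Gammaℂ_one_sub w hw).mul (by fun_prop)
  · rw [evenGammaQuot, norm_mul]
    exact mul_le_mul (hC w h1 h2) ((norm_cos_le_exp _).trans
      (Real.exp_le_exp.2 (abs_im_pi_mul_one_sub_div_two w))) (norm_nonneg _) hC0
  · have h0 : Gammaℝ w ≠ 0 := Gammaℝ_ne_zero_of_re_pos (by rw [hw]; norm_num)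
    rw [evenGammaQuot_eq (by rw [hw]; norm_num), norm_mul, norm_inv,
      norm_Gammaℝ_eq (s := w) (by apply Complex.ext <;> simp [hw]; norm_num)]
    exact (mul_inv_cancel₀ (norm_ne_zero_iff.2 h0)).le
  · have h0 : w ≠ 0 := by rintro rfl; norm_num at hw
    have h2 : Gammaℝ (w + 2) ≠ 0 := Gammaℝ_ne_zero_of_re_pos (by simp [hw]; norm_num)
    have e := Gammaℝ_add_two h0
    have e' : (Gammaℝ w)⁻¹ = w / (2 * Real.pi) * (Gammaℝ (w + 2))⁻¹ := by
      have h3 : Gammaℝ w ≠ 0 := by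
        intro h3; rw [h3] at e; simp at e; exact h2 e
      have : (Real.pi : ℂ) ≠ 0 := ofReal_ne_zero.2 Real.pi_ne_zero
      rw [e]; field_simp
    rw [evenGammaQuot_eq (by rw [hw]; norm_num), e', norm_mul, norm_mul, norm_inv,
      norm_Gammaℝ_eq (s := w + 2) (t := 1 - w) (by apply Complex.ext <;> simp [hw]; norm_num),
      norm_one_add_eq_norm hw, mul_left_comm, mul_inv_cancel₀ (norm_ne_zero_iff.2 h2), mul_one,
      norm_div, norm_mul, norm_real, norm_ofNat, Real.norm_of_nonneg Real.pi_pos.le]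

-- The edges work as for the even quotient: 2 - w = conj(1 + w) on the right, while on the left 2 -
-- w = -w + 2, the recurrence applies to -w, and -w = conj(1 + w).
open Complex in
theorem norm_oddGammaQuot_le {w : ℂ} (hw₁ : -(1 / 2) ≤ w.re) (hw₂ : w.re ≤ 1 / 2) :
    ‖oddGammaQuot w‖ ≤ (‖1 + w‖ / (2 * Real.pi)) ^ (1 / 2 - w.re) := by
  obtain ⟨C, hC0, hC⟩ := norm_Gammaℂ_one_sub_le
  refine norm_le_rpow_of_strip (C := C) (diffContOnCl_strip fun w hw => ?_) (fun w h1 h2 => ?_)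
    (fun w hw => ?_) (fun w hw => ?_) hw₁ hw₂
  · exact (differentiableOn_Gammaℂ_one_sub w hw).mul (by fun_prop)
  · rw [oddGammaQuot, norm_mul]
    exact mul_le_mul (hC w h1 h2) ((norm_sin_le_exp _).trans
      (Real.exp_le_exp.2 (abs_im_pi_mul_one_sub_div_two w))) (norm_nonneg _) hC0
  · have h0 : Gammaℝ (1 + w) ≠ 0 := Gammaℝ_ne_zero_of_re_pos (by simp [hw]; norm_num)
    rw [oddGammaQuot_eq (by rw [hw]; norm_num), norm_mul, norm_inv,
      norm_Gammaℝ_eq (s := 1 + w) (by apply Complex.ext <;> simp [hw]; norm_num)]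
    exact (mul_inv_cancel₀ (norm_ne_zero_iff.2 h0)).le
  · have h0 : -w ≠ 0 := by rw [neg_ne_zero]; rintro rfl; norm_num at hw
    have h1 : Gammaℝ (1 + w) ≠ 0 := Gammaℝ_ne_zero_of_re_pos (by simp [hw]; norm_num)
    have e := Gammaℝ_add_two h0
    rw [oddGammaQuot_eq (by rw [hw]; norm_num), show 2 - w = -w + 2 by ring, e, norm_mul, norm_inv,
      norm_div, norm_div, norm_mul, norm_real, norm_ofNat, Real.norm_of_nonneg Real.pi_pos.le,
      norm_Gammaℝ_eq (s := 1 + w) (t := -w) (by apply Complex.ext <;> simp [hw]; norm_num),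
      norm_one_add_eq_norm hw, norm_neg]
    have := norm_ne_zero_iff.2 h1
    field_simp
    exact le_rfl

-- Replacing s by s - 1 multiplies Γ_ℂ(1-s) by (1-s)/(2π) and moves the trigonometric argument by
-- π/2, so the even and odd quotients exchange roles up to sign. Hence the two bounds are proved in
-- one induction.
open Complex in
theorem norm_gammaQuot_sub_natCast_le {w : ℂ} (hw : w.re < 1) {R : ℝ}
    (h₀ : ‖evenGammaQuot w‖ ≤ R) (h₁ : ‖oddGammaQuot w‖ ≤ R) (k : ℕ) :
    ‖evenGammaQuot (w - k)‖ ≤ R * ∏ j ∈ Finset.range k, ‖w - k + j‖ / (2 * Real.pi) ∧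
    ‖oddGammaQuot (w - k)‖ ≤ R * ∏ j ∈ Finset.range k, ‖w - k + j‖ / (2 * Real.pi) := by
  induction k with
  | zero => simp [h₀, h₁]
  | succ k ih =>
    set s := w - k with hs
    have hsre : s.re < 1 := by
      have : (0 : ℝ) ≤ k := k.cast_nonneg
      rw [hs]; simp; linarith
    have e0 : w - ((k + 1 : ℕ) : ℂ) = s - 1 := by rw [hs]; push_cast; ring
    have e1 : ∏ j ∈ Finset.range (k + 1), ‖w - ((k + 1 : ℕ) : ℂ) + j‖ / (2 * Real.pi) =
        (∏ j ∈ Finset.range k, ‖s + j‖ / (2 * Real.pi)) * (‖1 - s‖ / (2 * Real.pi)) := by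
      rw [Finset.prod_range_succ', e0, norm_sub_rev 1 s]
      simp
    have hne : (1 - s) ≠ 0 := fun h => by
      have := congrArg re h
      simp at this; linarith
    have e2 : Gammaℂ (1 - (s - 1)) = Gammaℂ (1 - s) * (1 - s) / 2 / Real.pi := by
      rw [← Gammaℂ_add_one hne]; ring_nf
    have e3 : ‖Gammaℂ (1 - (s - 1))‖ = ‖Gammaℂ (1 - s)‖ * (‖1 - s‖ / (2 * Real.pi)) := by
      rw [e2, norm_div, norm_div, norm_mul, norm_real, norm_ofNat,
        Real.norm_of_nonneg Real.pi_pos.le]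
      field_simp
    have e4 : Real.pi * (1 - (s - 1)) / 2 = (Real.pi * (1 - s) / 2 : ℂ) + Real.pi / 2 := by ring
    have hnn : 0 ≤ ‖1 - s‖ / (2 * Real.pi) := by positivity
    rw [e1, e0, ← mul_assoc]
    constructor
    · rw [evenGammaQuot, norm_mul, e3, e4, cos_add_pi_div_two, norm_neg, mul_right_comm, ← norm_mul]
      exact mul_le_mul_of_nonneg_right ih.2 hnn
    · rw [oddGammaQuot, norm_mul, e3, e4, sin_add_pi_div_two, mul_right_comm, ← norm_mul]
      exact mul_le_mul_of_nonneg_right ih.1 hnn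

/-- The bound for the quotients of Gamma factors in the left half plane. -/
theorem norm_gammaQuot_le {s : ℂ} (hs : s.re < 0) {R : ℝ}
    (hR : R = (2 * Real.pi)⁻¹ ^ (1 / 2 - s.re) *
      ‖1 + s - (nearestInt s.re : ℂ)‖ ^ (1 / 2 + (nearestInt s.re : ℝ) - s.re) *
        ∏ j ∈ Finset.Icc 1 (-nearestInt s.re), ‖s + (j : ℂ) - 1‖) :
    ‖evenGammaQuot s‖ ≤ R ∧ ‖oddGammaQuot s‖ ≤ R := by
  have hn : nearestInt s.re = ⌊s.re + 1 / 2⌋ := by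
    rw [nearestInt, if_neg (not_le.2 hs)]
  have hle := Int.floor_le (s.re + 1 / 2)
  have hlt := Int.lt_floor_add_one (s.re + 1 / 2)
  have h0 : ⌊s.re + 1 / 2⌋ ≤ 0 := by
    have : ⌊s.re + 1 / 2⌋ < 1 := Int.floor_lt.2 (by push_cast; linarith)
    omega
  rw [hn] at hR
  obtain ⟨k, hk⟩ := Int.eq_ofNat_of_zero_le (neg_nonneg.2 h0)
  have hk' : ⌊s.re + 1 / 2⌋ = -(k : ℤ) := by omega
  rw [hk'] at hle hlt hR
  push_cast at hle hlt
  set w := s + k with hw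
  have hwre : w.re = s.re + k := by simp [hw]
  have hw1 : -(1 / 2) ≤ w.re := by rw [hwre]; linarith
  have hw2 : w.re ≤ 1 / 2 := by rw [hwre]; linarith
  have hsw : s = w - k := by rw [hw]; ring
  have main := norm_gammaQuot_sub_natCast_le (by linarith) (norm_evenGammaQuot_le hw1 hw2)
    (norm_oddGammaQuot_le hw1 hw2) k
  rw [← hsw] at main
  suffices hRe : R = (‖1 + w‖ / (2 * Real.pi)) ^ (1 / 2 - w.re) *
      ∏ j ∈ Finset.range k, ‖s + j‖ / (2 * Real.pi) by rw [hRe]; exact main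
  have e1 : ∏ j ∈ Finset.Icc 1 (-(-(k : ℤ))), ‖s + (j : ℂ) - 1‖ = ∏ j ∈ Finset.range k, ‖s + j‖ := by
    symm
    refine Finset.prod_bij (fun j _ => (j : ℤ) + 1) ?_ ?_ ?_ ?_
    · intro j hj; simp at hj ⊢; omega
    · intro a _ b _ h; simpa using h
    · intro b hb
      simp at hb
      refine ⟨(b - 1).toNat, by simp; omega, by omega⟩
    · intro j _; push_cast; ring_nf
  rw [hR, e1, Finset.prod_div_distrib, Finset.prod_const, Finset.card_range,
    Real.div_rpow (norm_nonneg _) (by positivity), hwre,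
    show 1 / 2 + ((-(k : ℤ) : ℤ) : ℝ) - s.re = 1 / 2 - (s.re + k) by push_cast; ring,
    show 1 + s - ((-(k : ℤ) : ℤ) : ℂ) = 1 + w by rw [hw]; push_cast; ring]
  have e2 : (2 * Real.pi)⁻¹ ^ (1 / 2 - s.re) =
      ((2 * Real.pi) ^ (1 / 2 - (s.re + k)))⁻¹ * ((2 * Real.pi) ^ k)⁻¹ := by
    rw [Real.inv_rpow (by positivity), ← mul_inv, ← Real.rpow_add_natCast (by positivity)]
    congr 2; ring
  rw [e2]
  field_simp


/-! ### Comparison of the ideal sum with the n-th power of ζ. -/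

open Ideal NumberField nonZeroDivisors UniqueFactorizationMonoid in
/-- The primes above each rational prime can be numbered by `Fin [K : ℚ]`. -/
theorem exists_primeIndex (K : Type*) [Field K] [NumberField K] :
    ∃ idx : Ideal (𝓞 K) → Fin (Module.finrank ℚ K), ∀ P Q : Ideal (𝓞 K), P.IsPrime → Q.IsPrime →
      P ≠ ⊥ → P.under ℤ = Q.under ℤ → idx P = idx Q → P = Q := by
  classical
  have hn : 0 < Module.finrank ℚ K := Module.finrank_pos
  have key : ∀ q : Ideal ℤ, ∃ g : Ideal (𝓞 K) → Fin (Module.finrank ℚ K),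
      q.IsMaximal → q ≠ ⊥ → Set.InjOn g (q.primesOver (𝓞 K)) := by
    intro q
    by_cases hq : q.IsMaximal ∧ q ≠ ⊥
    · obtain ⟨h1, h2⟩ := hq
      have hc := card_primesOverFinset_le_finrank (𝓞 K) ℚ K h2
      let e := (IsDedekindDomain.primesOverFinset q (𝓞 K)).equivFin
      -- The bound on the number of primes above q lets an enumeration of them embed in `Fin n`;
      -- ideals not above q get the irrelevant value 0.
      refine ⟨fun P => if h : P ∈ IsDedekindDomain.primesOverFinset q (𝓞 K) then
        Fin.castLE hc (e ⟨P, h⟩) else ⟨0, hn⟩, fun _ _ => ?_⟩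
      rw [← IsDedekindDomain.coe_primesOverFinset h2]
      intro P hP Q hQ h
      have hP' : P ∈ IsDedekindDomain.primesOverFinset q (𝓞 K) := hP
      have hQ' : Q ∈ IsDedekindDomain.primesOverFinset q (𝓞 K) := hQ
      simp only [dif_pos hP', dif_pos hQ'] at h
      have := e.injective (Fin.castLE_injective hc h)
      exact congrArg Subtype.val this
    · exact ⟨fun _ => ⟨0, hn⟩, fun h1 h2 => absurd ⟨h1, h2⟩ hq⟩
  choose g hg using key
  refine ⟨fun P => g (P.under ℤ) P, fun P Q hP hQ hP0 hu h => ?_⟩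
  have hne : P.under ℤ ≠ ⊥ := mt Ideal.eq_bot_of_comap_eq_bot hP0
  have hmax : (P.under ℤ).IsMaximal := (Ideal.IsPrime.under ℤ P).isMaximal hne
  refine hg _ hmax hne (show P ∈ _ from ⟨hP, ⟨rfl⟩⟩) (show Q ∈ _ from ⟨hQ, ⟨hu⟩⟩) ?_
  simpa only [← hu] using h

open Ideal NumberField in
theorem factorization_absNorm_prime {K : Type*} [Field K] [NumberField K] {P : Ideal (𝓞 K)}
    (hP : P.IsPrime) (hP0 : P ≠ ⊥) :
    ∃ f : ℕ, 0 < f ∧ absNorm P = absNorm (P.under ℤ) ^ f ∧ (absNorm (P.under ℤ)).Prime := by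
  have : NeZero P := ⟨hP0⟩
  have hp := Nat.absNorm_under_prime P
  have : P.LiesOver (span {(absNorm (P.under ℤ) : ℤ)}) := inferInstance
  refine ⟨_, ?_, absNorm_eq_pow_inertiaDeg' P hp, hp⟩
  rw [Nat.pos_iff_ne_zero]
  intro h
  have h1 := absNorm_eq_pow_inertiaDeg' P hp
  rw [h, pow_zero, absNorm_eq_one_iff] at h1
  exact hP.ne_top h1

open Ideal NumberField UniqueFactorizationMonoid in
/-- The part of the norm of an ideal coming from the primes of a given index. -/
noncomputable def normPart {K : Type*} [Field K] [NumberField K] {n : ℕ}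
    (idx : Ideal (𝓞 K) → Fin n) (a : Ideal (𝓞 K)) (i : Fin n) : ℕ :=
  (((normalizedFactors a).filter (fun P => idx P = i)).map absNorm).prod

open Ideal NumberField UniqueFactorizationMonoid in
theorem prod_normPart {K : Type*} [Field K] [NumberField K] {n : ℕ}
    (idx : Ideal (𝓞 K) → Fin n) {a : Ideal (𝓞 K)} (ha : a ≠ 0) :
    ∏ i, normPart idx a i = absNorm a := by
  classical
  have key : ∀ s : Multiset (Ideal (𝓞 K)),
      ∏ i, ((s.filter (fun P => idx P = i)).map absNorm).prod = (s.map absNorm).prod := by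
    intro s
    induction s using Multiset.induction_on with
    | empty => simp
    | cons P s ih =>
      rw [Multiset.map_cons, Multiset.prod_cons, ← ih]
      have : ∀ i, (((P ::ₘ s).filter (fun P => idx P = i)).map absNorm).prod =
          (if idx P = i then absNorm P else 1) * ((s.filter (fun P => idx P = i)).map absNorm).prod := by
        intro i
        split_ifs with h
        · rw [Multiset.filter_cons_of_pos (p := fun P => idx P = i) _ h]; simp
        · rw [Multiset.filter_cons_of_neg (p := fun P => idx P = i) _ h]; simp
      simp_rw [this, Finset.prod_mul_distrib]
      simp
  simp only [normPart]
  rw [key, ← map_multiset_prod, Ideal.prod_normalizedFactors_eq_self ha]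

-- For a rational prime p and an index i, at most one prime P above p has index i. The p-adic
-- valuation of the i-th part is thus f times the multiplicity of P, where N(P) = p^f and f > 0, so
-- all multiplicities can be recovered.
open Ideal NumberField UniqueFactorizationMonoid in
theorem normPart_injective {K : Type*} [Field K] [NumberField K] {n : ℕ}
    {idx : Ideal (𝓞 K) → Fin n} (hidx : ∀ P Q : Ideal (𝓞 K), P.IsPrime → Q.IsPrime →
      P ≠ ⊥ → P.under ℤ = Q.under ℤ → idx P = idx Q → P = Q) {a b : Ideal (𝓞 K)}
    (ha : a ≠ 0) (hb : b ≠ 0) (h : normPart idx a = normPart idx b) : a = b := by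
  classical
  have hprime : ∀ c : Ideal (𝓞 K), ∀ Q ∈ normalizedFactors c, Q.IsPrime ∧ Q ≠ ⊥ := fun c Q hQ =>
    ⟨isPrime_of_prime (prime_of_normalized_factor Q hQ), (prime_of_normalized_factor Q hQ).ne_zero⟩
  have key : ∀ P : Ideal (𝓞 K), P.IsPrime → P ≠ ⊥ → ∃ p f : ℕ, 0 < f ∧
      ∀ c : Ideal (𝓞 K), (normPart idx c (idx P)).factorization p =
        (normalizedFactors c).count P * f := by
    intro P hP hP0
    obtain ⟨f, hf, hPf, hp⟩ := factorization_absNorm_prime hP hP0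
    refine ⟨absNorm (P.under ℤ), f, hf, fun c => ?_⟩
    have aux : ∀ s : Multiset (Ideal (𝓞 K)), (∀ Q ∈ s, Q.IsPrime ∧ Q ≠ ⊥) →
        ((s.filter (fun Q => idx Q = idx P)).map absNorm).prod ≠ 0 ∧
        (((s.filter (fun Q => idx Q = idx P)).map absNorm).prod).factorization
          (absNorm (P.under ℤ)) = s.count P * f := by
      intro s
      induction s using Multiset.induction_on with
      | empty => simp
      | cons Q s ih =>
        intro hs
        obtain ⟨hQ, hQ0⟩ := hs Q (Multiset.mem_cons_self _ _)
        obtain ⟨ih0, ih⟩ := ih fun R hR => hs R (Multiset.mem_cons_of_mem hR)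
        by_cases hQP : idx Q = idx P
        · have hN0 : absNorm Q ≠ 0 := by rwa [Ne, absNorm_eq_zero_iff]
          rw [Multiset.filter_cons_of_pos (p := fun Q => idx Q = idx P) _ hQP, Multiset.map_cons, Multiset.prod_cons,
            Nat.factorization_mul hN0 ih0]
          refine ⟨mul_ne_zero hN0 ih0, ?_⟩
          rw [Finsupp.add_apply, ih]
          by_cases hE : Q = P
          · rw [hE, Multiset.count_cons_self, hPf, hp.factorization_pow, Finsupp.single_eq_same]
            ring
          · rw [Multiset.count_cons_of_ne (Ne.symm hE)]
            obtain ⟨f', -, hQf, hq⟩ := factorization_absNorm_prime hQ hQ0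
            have hne : absNorm (Q.under ℤ) ≠ absNorm (P.under ℤ) := by
              intro he
              refine hE (hidx Q P hQ hP hQ0 ?_ hQP)
              rw [← Int.ideal_span_absNorm_eq_self (under ℤ Q),
                ← Int.ideal_span_absNorm_eq_self (under ℤ P), he]
            rw [hQf, hq.factorization_pow, Finsupp.single_eq_of_ne hne.symm, zero_add]
        · rw [Multiset.filter_cons_of_neg (p := fun Q => idx Q = idx P) _ hQP, Multiset.count_cons_of_ne]
          · exact ⟨ih0, ih⟩
          · rintro rfl; exact hQP rfl
    exact (aux _ (hprime c)).2
  have hnf : normalizedFactors a = normalizedFactors b := by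
    ext P
    by_cases hP : P.IsPrime ∧ P ≠ ⊥
    · obtain ⟨p, f, hf, hc⟩ := key P hP.1 hP.2
      have h1 := hc a
      rw [h, hc b] at h1
      exact (Nat.eq_of_mul_eq_mul_right hf h1).symm
    · rw [Multiset.count_eq_zero_of_notMem fun h => hP (hprime a P h),
        Multiset.count_eq_zero_of_notMem fun h => hP (hprime b P h)]
  rw [← Ideal.prod_normalizedFactors_eq_self ha, hnf, Ideal.prod_normalizedFactors_eq_self hb]

-- An ideal is encoded injectively by an n-tuple of natural numbers whose product is its norm.
-- Enlarging the sum to all tuples makes it factor into an n-th power, without Euler products.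
open Ideal NumberField nonZeroDivisors in
theorem sum_absNorm_rpow_le (K : Type*) [Field K] [NumberField K] {σ : ℝ} (hσ : 1 < σ)
    (S : Finset (Ideal (𝓞 K))⁰) :
    ∑ a ∈ S, (absNorm (a : Ideal (𝓞 K)) : ℝ) ^ (-σ) ≤
      (∑' m : ℕ, (m : ℝ) ^ (-σ)) ^ Module.finrank ℚ K := by
  classical
  obtain ⟨idx, hidx⟩ := exists_primeIndex K
  have hsum : Summable fun m : ℕ => (m : ℝ) ^ (-σ) := Real.summable_nat_rpow.2 (by linarith)
  have h0 : ∀ a : (Ideal (𝓞 K))⁰, (a : Ideal (𝓞 K)) ≠ 0 := fun a => nonZeroDivisors.coe_ne_zero a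
  have e1 : ∀ a : (Ideal (𝓞 K))⁰, (absNorm (a : Ideal (𝓞 K)) : ℝ) ^ (-σ) =
      ∏ i, (normPart idx a i : ℝ) ^ (-σ) := fun a => by
    rw [← prod_normPart idx (h0 a), Nat.cast_prod,
      Real.finsetProd_rpow _ _ fun i _ => Nat.cast_nonneg _]
  -- All parts of all ideals in S, so that the encoded tuples lie in the finite box T^n.
  let T : Finset ℕ := Finset.univ.biUnion fun i => S.image fun a : (Ideal (𝓞 K))⁰ => normPart idx (a : Ideal (𝓞 K)) i
  calc ∑ a ∈ S, (absNorm (a : Ideal (𝓞 K)) : ℝ) ^ (-σ)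
      = ∑ v ∈ S.image (fun a : (Ideal (𝓞 K))⁰ => normPart idx a), ∏ i, (v i : ℝ) ^ (-σ) := by
        rw [Finset.sum_image]
        · exact Finset.sum_congr rfl fun a _ => e1 a
        · intro a _ b _ h
          exact Subtype.ext (normPart_injective hidx (h0 a) (h0 b) h)
    _ ≤ ∑ v ∈ Fintype.piFinset fun _ => T, ∏ i, (v i : ℝ) ^ (-σ) := by
        refine Finset.sum_le_sum_of_subset_of_nonneg ?_ fun v _ _ =>
          Finset.prod_nonneg fun i _ => Real.rpow_nonneg (Nat.cast_nonneg _) _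
        intro v hv
        obtain ⟨a, ha, rfl⟩ := Finset.mem_image.1 hv
        exact Fintype.mem_piFinset.2 fun i =>
          Finset.mem_biUnion.2 ⟨i, Finset.mem_univ _, Finset.mem_image_of_mem _ ha⟩
    _ = (∑ m ∈ T, (m : ℝ) ^ (-σ)) ^ Module.finrank ℚ K := by
        rw [← Finset.prod_univ_sum (fun _ => T) fun _ m => (m : ℝ) ^ (-σ)]; simp
    _ ≤ _ := pow_le_pow_left₀ (Finset.sum_nonneg fun m _ => Real.rpow_nonneg (Nat.cast_nonneg _) _)
        (hsum.sum_le_tsum _ fun m _ => Real.rpow_nonneg (Nat.cast_nonneg _) _) _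

open Ideal NumberField nonZeroDivisors in
theorem summable_absNorm_rpow (K : Type*) [Field K] [NumberField K] {σ : ℝ} (hσ : 1 < σ) :
    Summable fun a : (Ideal (𝓞 K))⁰ => (absNorm (a : Ideal (𝓞 K)) : ℝ) ^ (-σ) :=
  summable_of_sum_le (fun _ => Real.rpow_nonneg (Nat.cast_nonneg _) _) (sum_absNorm_rpow_le K hσ)

theorem riemannZeta_re_eq_tsum {σ : ℝ} (hσ : 1 < σ) :
    (riemannZeta σ).re = ∑' m : ℕ, (m : ℝ) ^ (-σ) := by
  rw [zeta_eq_tsum_one_div_nat_cpow (by simpa using hσ)]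
  have : ∀ m : ℕ, (1 / (m : ℂ) ^ (σ : ℂ)) = (((m : ℝ) ^ (-σ) : ℝ) : ℂ) := fun m => by
    rw [Real.rpow_neg (Nat.cast_nonneg _), one_div, Complex.ofReal_inv,
      Complex.ofReal_cpow (Nat.cast_nonneg _), Complex.ofReal_natCast]
  simp_rw [this]
  rw [← Complex.ofReal_tsum, Complex.ofReal_re]

open Ideal NumberField nonZeroDivisors in
/-- The Dedekind zeta function as a sum over non-zero ideals. -/
theorem hasSum_dedekindZeta (K : Type*) [Field K] [NumberField K] {s : ℂ} (hs : 1 < s.re) :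
    HasSum (fun a : (Ideal (𝓞 K))⁰ => (absNorm (a : Ideal (𝓞 K)) : ℂ) ^ (-s)) (dedekindZeta K s) := by
  have hpos : ∀ a : (Ideal (𝓞 K))⁰, 0 < absNorm (a : Ideal (𝓞 K)) := fun a =>
    absNorm_pos_of_nonZeroDivisors a
  have hsum : Summable fun a : (Ideal (𝓞 K))⁰ => (absNorm (a : Ideal (𝓞 K)) : ℂ) ^ (-s) := by
    refine Summable.of_norm ((summable_absNorm_rpow K hs).congr fun a => ?_)
    rw [Complex.norm_natCast_cpow_of_pos (hpos a), Complex.neg_re]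
  let N : (Ideal (𝓞 K))⁰ → ℕ := fun a => absNorm (a : Ideal (𝓞 K))
  have h1 := (Equiv.sigmaFiberEquiv N).hasSum_iff.2 hsum.hasSum
  have hfib : ∀ n, HasSum (fun a : {a // N a = n} =>
      (((fun a : (Ideal (𝓞 K))⁰ => (absNorm (a : Ideal (𝓞 K)) : ℂ) ^ (-s)) ∘
        Equiv.sigmaFiberEquiv N) ⟨n, a⟩))
      (LSeries.term (fun n => (Nat.card {I : Ideal (𝓞 K) // absNorm I = n} : ℂ)) s n) := by
    intro n
    have hN : ∀ a : {a // N a = n}, absNorm ((a : (Ideal (𝓞 K))⁰) : Ideal (𝓞 K)) = n := fun a => a.2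
    -- A non-zero ideal has positive norm, so the fibre over 0 is empty, matching the L-series
    -- convention that the term at 0 is 0.
    rcases eq_or_ne n 0 with rfl | hn
    · have : IsEmpty {a // N a = 0} := ⟨fun a => (hpos a.1).ne' a.2⟩
      rw [LSeries.term_zero]
      exact hasSum_empty
    · let e : {a // N a = n} ≃ {I : Ideal (𝓞 K) // absNorm I = n} :=
        { toFun := fun a => ⟨a.1, a.2⟩
          invFun := fun I => ⟨⟨I.1, mem_nonZeroDivisors_of_ne_zero fun h => hn (by
            rw [← I.2, h]; simp)⟩, I.2⟩
          left_inv := fun a => rfl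
          right_inv := fun I => rfl }
      have : Finite {I : Ideal (𝓞 K) // absNorm I = n} := finite_setOfPred_absNorm_eq n
      have : Finite {a // N a = n} := Finite.of_equiv _ e.symm
      have := Fintype.ofFinite {a // N a = n}
      rw [LSeries.term_of_ne_zero hn, ← Nat.card_congr e, Nat.card_eq_fintype_card]
      convert! hasSum_fintype _
      simp only [Function.comp, Equiv.sigmaFiberEquiv_apply, hN]
      rw [Finset.sum_const, Finset.card_univ, nsmul_eq_mul, Complex.cpow_neg, div_eq_mul_inv]
  have h2 := (h1.sigma hfib).tsum_eq
  rw [dedekindZeta, LSeries, h2]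
  exact hsum.hasSum


/-! ### Poisson summation and Gaussian theta series. -/

/-- A product of summable families of non-negative reals, indexed by functions, is summable. -/
theorem summable_pi_prod {ι κ : Type*} [Fintype ι] {g : κ → ℝ} (hg : Summable g) (h0 : ∀ k, 0 ≤ g k) :
    Summable fun m : ι → κ => ∏ i, g (m i) := by
  classical
  refine summable_of_sum_le (c := (∑' k, g k) ^ Fintype.card ι)
    (fun m => Finset.prod_nonneg fun i _ => h0 _) fun S => ?_
  let T : Finset κ := Finset.univ.biUnion fun i : ι => S.image fun m => m i
  calc ∑ m ∈ S, ∏ i, g (m i) ≤ ∑ m ∈ Fintype.piFinset fun _ => T, ∏ i, g (m i) := by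
        refine Finset.sum_le_sum_of_subset_of_nonneg (fun m hm => ?_) fun v _ _ =>
          Finset.prod_nonneg fun i _ => h0 _
        exact Fintype.mem_piFinset.2 fun i =>
          Finset.mem_biUnion.2 ⟨i, Finset.mem_univ _, Finset.mem_image.2 ⟨m, hm, rfl⟩⟩
    _ = (∑ k ∈ T, g k) ^ Fintype.card ι := by
        rw [← Finset.prod_univ_sum (fun _ => T) fun _ k => g k]; simp
    _ ≤ _ := pow_le_pow_left₀ (Finset.sum_nonneg fun m _ => h0 _)
        (hg.sum_le_tsum _ fun m _ => h0 _) _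

theorem summable_exp_neg_mul_sq {c : ℝ} (hc : 0 < c) :
    Summable fun m : ℤ => Real.exp (-c * (m : ℝ) ^ 2) := by
  have h := summable_pow_mul_jacobiTheta₂_term_bound 0 (T := c / Real.pi) (by positivity) 0
  refine h.congr fun m => ?_
  simp
  field_simp

theorem summable_exp_neg_mul_sum_sq {ι : Type*} [Fintype ι] {c : ℝ} (hc : 0 < c) :
    Summable fun m : ι → ℤ => Real.exp (-c * ∑ i, (m i : ℝ) ^ 2) := by
  refine (summable_pi_prod (summable_exp_neg_mul_sq hc) fun k => (Real.exp_pos _).le).congr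
    fun m => ?_
  rw [← Real.exp_sum, Finset.mul_sum]

open MeasureTheory UnitAddTorus in
/-- The Poisson summation formula on `ℝ^ι`. -/
theorem tsum_int_eq_tsum_integral_mFourier {ι : Type*} [Fintype ι] {f : (ι → ℝ) → ℂ}
    (hf : Continuous f) (hfi : Integrable f)
    (hb : ∀ R : ℝ, ∃ u : (ι → ℤ) → ℝ, Summable u ∧ ∀ m x, (∀ i, |x i| ≤ R) →
      ‖f (x + fun i => (m i : ℝ))‖ ≤ u m)
    (hs : Summable fun n : ι → ℤ =>
      ∫ x : ι → ℝ, mFourier (-n) (fun i => (x i : UnitAddCircle)) * f x) :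
    ∑' m : ι → ℤ, f (fun i => (m i : ℝ)) =
      ∑' n : ι → ℤ, ∫ x : ι → ℝ, mFourier (-n) (fun i => (x i : UnitAddCircle)) * f x := by
  set c : (ι → ℤ) → ι → ℝ := fun m i => (m i : ℝ) with hc
  set q : (ι → ℝ) → UnitAddTorus ι := fun x i => (x i : UnitAddCircle) with hq
  have hqc : ∀ x m, q (x + c m) = q x := fun x m => by
    funext i
    simp only [hq, hc, Pi.add_apply, AddCircle.coe_add]
    rw [add_eq_left]
    exact AddCircle.coe_eq_zero_iff (p := (1 : ℝ)) |>.2 ⟨m i, by simp⟩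
  have hqq : IsOpenQuotientMap q :=
    IsOpenQuotientMap.piMap (f := fun (_ : ι) (x : ℝ) => (x : UnitAddCircle)) fun _ =>
      QuotientAddGroup.isOpenQuotientMap_mk
  have hqcont : Continuous q := hqq.continuous
  -- The periodization of f; it is continuous by local uniform convergence and descends to a
  -- function G on the torus.
  let F : (ι → ℝ) → ℂ := fun x => ∑' m, f (x + c m)
  have hF : Continuous F := by
    refine continuous_iff_continuousAt.2 fun x => ?_
    obtain ⟨u, hu, hub⟩ := hb (‖x‖ + 1)
    have : ContinuousOn F (Metric.ball 0 (‖x‖ + 1)) := by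
      refine continuousOn_tsum (fun m => by fun_prop) hu fun m y hy => hub m y fun i => ?_
      rw [mem_ball_zero_iff] at hy
      exact (norm_le_pi_norm y i).trans hy.le
    exact this.continuousAt (Metric.isOpen_ball.mem_nhds (by simp))
  have hFp : ∀ x n, F (x + c n) = F x := fun x n => by
    have : ∀ m, f (x + c n + c m) = f (x + c (Equiv.addLeft n m)) := fun m => by
      congr 1
      funext i
      simp [hc, add_assoc]
    simp only [F, this]
    exact (Equiv.addLeft n).tsum_eq fun m => f (x + c m)
  have hfac : Function.FactorsThrough F q := by
    intro x y hxy
    have : ∀ i, ∃ n : ℤ, x i = y i + n := fun i => by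
      have h1 := congrFun hxy i
      have h2 : ((x i - y i : ℝ) : UnitAddCircle) = 0 := by
        rw [AddCircle.coe_sub, sub_eq_zero]; exact h1
      obtain ⟨n, hn⟩ := (AddCircle.coe_eq_zero_iff (p := (1 : ℝ))).1 h2
      refine ⟨n, ?_⟩
      rw [zsmul_eq_mul, mul_one] at hn
      linarith
    choose n hn using this
    rw [show x = y + c n from funext hn, hFp]
  have hqq' : Topology.IsQuotientMap (⟨q, hqcont⟩ : C(ι → ℝ, UnitAddTorus ι)) := hqq.isQuotientMap
  let G : C(UnitAddTorus ι, ℂ) := hqq'.lift ⟨F, hF⟩ hfac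
  have hG : ∀ x, G (q x) = F x := fun x =>
    congrArg (fun g : C(ι → ℝ, ℂ) => g x) (hqq'.lift_comp ⟨F, hF⟩ hfac)
  let cube : (ι → ℤ) → Set (ι → ℝ) := fun m => {x | ∀ i, x i ∈ Set.Ioc (m i : ℝ) (m i + 1)}
  have hcube : ∀ m, cube m = Set.univ.pi fun i => Set.Ioc (m i : ℝ) (m i + 1) := fun m => by
    ext x; simp [cube]
  have hcm : ∀ m, MeasurableSet (cube m) := fun m => by
    rw [hcube]; exact MeasurableSet.univ_pi fun i => measurableSet_Ioc
  have hcu : ⋃ m, cube m = Set.univ := by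
    refine Set.eq_univ_of_forall fun x => Set.mem_iUnion.2 ⟨fun i => ⌈x i⌉ - 1, fun i => ?_⟩
    have h1 := Int.le_ceil (x i)
    have h2 := Int.ceil_lt_add_one (x i)
    constructor <;> push_cast <;> linarith
  have hcd : Pairwise (Function.onFun Disjoint cube) := by
    intro m n hmn
    refine Set.disjoint_left.2 fun x hx hy => hmn (funext fun i => ?_)
    obtain ⟨h1, h2⟩ := hx i
    obtain ⟨h3, h4⟩ := hy i
    have a1 : m i < n i + 1 := by exact_mod_cast h1.trans_le h4
    have a2 : n i < m i + 1 := by exact_mod_cast h3.trans_le h2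
    omega
  have hvol : volume (cube 0) < ⊤ := by
    rw [hcube, volume_pi_pi]
    exact ENNReal.prod_lt_top fun i _ => by simp
  -- Unfolding: the integral over the unit cube of the sum of translates is the integral over ℝ^ι,
  -- since the characters are periodic and the half-open cubes tile the space.
  have hcoef : ∀ n, mFourierCoeff G n = ∫ x : ι → ℝ, mFourier (-n) (q x) * f x := by
    intro n
    have hint : Integrable fun x => mFourier (-n) (q x) * f x := by
      refine hfi.bdd_mul (c := 1) (by fun_prop) (Filter.Eventually.of_forall fun x => ?_)
      exact ((mFourier (-n)).norm_coe_le_norm _).trans mFourier_norm.le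
    have e1 : mFourierCoeff G n = ∫ x in cube 0, ∑' m, mFourier (-n) (q x) * f (x + c m) := by
      rw [mFourierCoeff_eq_integral G n 0]
      have : {x : ι → ℝ | ∀ i, x i ∈ Set.Ioc ((0 : ι → ℝ) i) ((0 : ι → ℝ) i + 1)} = cube 0 := by
        ext x; simp [cube]
      rw [this]
      refine integral_congr_ae (Filter.Eventually.of_forall fun x => ?_)
      change mFourier (-n) (q x) • G (q x) = _
      rw [hG, smul_eq_mul, ← tsum_mul_left]
    have e2 : ∀ m, ∫ x in cube 0, mFourier (-n) (q x) * f (x + c m) =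
        ∫ x in cube m, mFourier (-n) (q x) * f x := fun m => by
      have := (measurePreserving_add_right volume (c m)).setIntegral_preimage_emb
        (measurableEmbedding_addRight (c m)) (fun x => mFourier (-n) (q x) * f x) (cube m)
      rw [← this]
      have hpre : (fun x => x + c m) ⁻¹' cube m = cube 0 := by
        ext x
        simp only [cube, hc, Set.mem_preimage, Set.mem_ofPred_eq, Pi.add_apply, Set.mem_Ioc,
          Pi.zero_apply, Int.cast_zero]
        refine forall_congr' fun i => ?_
        constructor <;> rintro ⟨h1, h2⟩ <;> constructor <;> linarith
      rw [hpre]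
      simp only [hqc]
    obtain ⟨u, hu, hub⟩ := hb 1
    have hbd : ∀ m, ∀ x ∈ cube 0, ‖mFourier (-n) (q x) * f (x + c m)‖ ≤ u m := by
      intro m x hx
      rw [norm_mul]
      have h1 : ‖mFourier (-n) (q x)‖ ≤ 1 :=
        ((mFourier (-n)).norm_coe_le_norm _).trans mFourier_norm.le
      have h2 : ‖f (x + c m)‖ ≤ u m := hub m x fun i => by
        have := hx i
        simp at this
        rw [abs_of_pos this.1]; exact this.2
      calc _ ≤ 1 * ‖f (x + c m)‖ := mul_le_mul_of_nonneg_right h1 (norm_nonneg _)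
        _ ≤ _ := by rwa [one_mul]
    have hm : ∀ m, Continuous fun x => mFourier (-n) (q x) * f (x + c m) := fun m => by fun_prop
    have hio : ∀ m, IntegrableOn (fun x => mFourier (-n) (q x) * f (x + c m)) (cube 0) := fun m =>
      Measure.integrableOn_of_bounded hvol.ne (hm m).aestronglyMeasurable
        ((ae_restrict_iff' (hcm 0)).2 (Filter.Eventually.of_forall fun x hx => hbd m x hx))
    have hsi : Summable fun m => ∫ x in cube 0, ‖mFourier (-n) (q x) * f (x + c m)‖ := by
      refine Summable.of_nonneg_of_le (fun m => integral_nonneg fun x => norm_nonneg _) (fun m => ?_)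
        (hu.mul_right (volume.real (cube 0)))
      have := norm_setIntegral_le_of_norm_le_const (f := fun x => ‖mFourier (-n) (q x) * f (x + c m)‖)
        hvol (C := u m) fun x hx => by simpa using hbd m x hx
      exact (Real.le_norm_self _).trans this
    rw [e1, ← (hasSum_integral_of_summable_integral_norm hio hsi).tsum_eq]
    simp_rw [e2]
    have := hasSum_integral_iUnion hcm hcd (f := fun x => mFourier (-n) (q x) * f x)
      (μ := volume) hint.integrableOn
    rw [this.tsum_eq, hcu, setIntegral_univ]
  have hsum : Summable (mFourierCoeff G) := hs.congr fun n => (hcoef n).symm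
  -- Evaluation of the absolutely convergent Fourier series of G at the origin, where every
  -- character equals 1.
  have h0 := (hasSum_mFourier_series_apply_of_summable hsum (q 0)).tsum_eq
  have hq0 : ∀ n, mFourier n (q 0) = 1 := fun n => by
    simp [mFourier, hq]
  simp only [hq0, smul_eq_mul, mul_one, hcoef, hG] at h0
  rw [h0]
  simp [F, hc]

-- The substitution y = Bx moves the frequency n to the inverse transpose of B applied to n and
-- splits the integral into one-dimensional Gaussians, each its own Fourier transform.
open MeasureTheory Matrix UnitAddTorus in
theorem integral_mFourier_mul_gaussian {ι : Type*} [Fintype ι] [DecidableEq ι] {B : Matrix ι ι ℝ}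
    (hB : B.det ≠ 0) (n : ι → ℤ) :
    ∫ x : ι → ℝ, mFourier (-n) (fun i => (x i : UnitAddCircle)) *
        Complex.exp (-(Real.pi * ∑ i, ((B *ᵥ x) i : ℂ) ^ 2)) =
      |B.det|⁻¹ * Complex.exp (-(Real.pi * ∑ i, (((B⁻¹)ᵀ *ᵥ fun i => (n i : ℝ)) i : ℂ) ^ 2)) := by
  set v : ι → ℝ := (B⁻¹)ᵀ *ᵥ fun i => (n i : ℝ) with hv
  let g : (ι → ℝ) → ℂ := fun y => ∏ i, (Complex.exp (Complex.I * ((-2 * Real.pi * v i : ℝ) : ℂ) * y i) *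
    Complex.exp (-(Real.pi : ℂ) * (y i : ℂ) ^ 2))
  have hu : IsUnit B.det := isUnit_iff_ne_zero.2 hB
  have e1 : ∀ x : ι → ℝ, mFourier (-n) (fun i => (x i : UnitAddCircle)) *
        Complex.exp (-(Real.pi * ∑ i, ((B *ᵥ x) i : ℂ) ^ 2)) = g (Matrix.toLin' B x) := by
    intro x
    simp only [g, Finset.prod_mul_distrib, ← Complex.exp_sum, mFourier, ContinuousMap.coe_mk,
      fourier_coe_apply, toLin'_apply, Pi.neg_apply]
    congr 2
    · have : ∑ i, v i * (B *ᵥ x) i = ∑ i, (n i : ℝ) * x i := by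
        change v ⬝ᵥ (B *ᵥ x) = (fun i => (n i : ℝ)) ⬝ᵥ x
        rw [hv, mulVec_transpose, ← dotProduct_mulVec, mulVec_mulVec, nonsing_inv_mul _ hu,
          one_mulVec]
      have e : ∑ i, Complex.I * ((-2 * Real.pi * v i : ℝ) : ℂ) * ((B *ᵥ x) i : ℂ) =
          -(2 * Real.pi * Complex.I) * ((∑ i, v i * (B *ᵥ x) i : ℝ) : ℂ) := by
        push_cast
        rw [Finset.mul_sum]
        exact Finset.sum_congr rfl fun i _ => by ring
      rw [e, this]
      push_cast
      rw [Finset.mul_sum]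
      exact Finset.sum_congr rfl fun i _ => by ring
    · rw [Finset.mul_sum, ← Finset.sum_neg_distrib]
      exact Finset.sum_congr rfl fun i _ => by ring
  have hmap := Real.map_matrix_volume_pi_eq_smul_volume_pi hB
  have hgc : Continuous g := by fun_prop
  have e2 : ∫ x, g (Matrix.toLin' B x) = |B.det|⁻¹ * ∫ y, g y := by
    have hm : AEMeasurable (Matrix.toLin' B) (volume : Measure (ι → ℝ)) :=
      (LinearMap.continuous_of_finiteDimensional _).measurable.aemeasurable
    rw [← integral_map hm hgc.aestronglyMeasurable, hmap, integral_smul_measure,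
      ENNReal.toReal_ofReal (abs_nonneg _), abs_inv, Complex.real_smul]
  simp_rw [e1]
  rw [e2]
  congr 1
  simp only [g]
  rw [integral_fintype_prod_volume_eq_prod (fun i (y : ℝ) =>
    Complex.exp (Complex.I * ((-2 * Real.pi * v i : ℝ) : ℂ) * y) *
      Complex.exp (-(Real.pi : ℂ) * (y : ℂ) ^ 2)), Finset.mul_sum, ← Finset.sum_neg_distrib,
    Complex.exp_sum]
  refine Finset.prod_congr rfl fun i _ => ?_
  have hpi : (Real.pi : ℂ) ≠ 0 := Complex.ofReal_ne_zero.2 Real.pi_ne_zero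
  rw [fourierIntegral_gaussian (by simpa using Real.pi_pos), div_self hpi, Complex.one_cpow, one_mul]
  congr 1
  push_cast
  field_simp
  ring

-- Apply Cauchy–Schwarz to each row of x = B⁻¹(Bx); C is the squared Frobenius norm of B⁻¹, and C +
-- 1 ensures a positive denominator.
open Matrix in
theorem exists_le_sum_mulVec_sq {ι : Type*} [Fintype ι] [DecidableEq ι] {B : Matrix ι ι ℝ}
    (hB : B.det ≠ 0) : ∃ c > 0, ∀ x : ι → ℝ, c * ∑ i, x i ^ 2 ≤ ∑ i, ((B *ᵥ x) i) ^ 2 := by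
  set C : ℝ := ∑ i, ∑ j, (B⁻¹ i j) ^ 2 with hC
  have hC0 : 0 ≤ C := Finset.sum_nonneg fun i _ => Finset.sum_nonneg fun j _ => sq_nonneg _
  refine ⟨(C + 1)⁻¹, by positivity, fun x => ?_⟩
  rw [inv_mul_le_iff₀ (by positivity)]
  set y := B *ᵥ x with hy
  have hx : x = B⁻¹ *ᵥ y := by
    rw [hy, mulVec_mulVec, nonsing_inv_mul _ (isUnit_iff_ne_zero.2 hB), one_mulVec]
  have hy0 : 0 ≤ ∑ j, y j ^ 2 := Finset.sum_nonneg fun j _ => sq_nonneg _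
  calc ∑ i, x i ^ 2 ≤ ∑ i, (∑ j, B⁻¹ i j ^ 2) * ∑ j, y j ^ 2 := by
        refine Finset.sum_le_sum fun i _ => ?_
        rw [hx]
        exact Finset.sum_mul_sq_le_sq_mul_sq _ _ _
    _ = C * ∑ j, y j ^ 2 := by rw [hC, Finset.sum_mul]
    _ ≤ (C + 1) * ∑ j, y j ^ 2 := mul_le_mul_of_nonneg_right (by linarith) hy0

open Matrix in
theorem summable_exp_neg_sum_mulVec_sq {ι : Type*} [Fintype ι] [DecidableEq ι] {B : Matrix ι ι ℝ}
    (hB : B.det ≠ 0) :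
    Summable fun m : ι → ℤ => Real.exp (-(Real.pi * ∑ i, ((B *ᵥ fun i => (m i : ℝ)) i) ^ 2)) := by
  obtain ⟨c, hc, h⟩ := exists_le_sum_mulVec_sq hB
  refine Summable.of_nonneg_of_le (fun m => (Real.exp_pos _).le) (fun m => ?_)
    (summable_exp_neg_mul_sum_sq (ι := ι) (mul_pos Real.pi_pos hc))
  apply Real.exp_le_exp.2
  have := mul_le_mul_of_nonneg_left (h fun i => (m i : ℝ)) Real.pi_pos.le
  linarith

open Matrix MeasureTheory in
/-- The transformation formula for the theta series of a positive definite quadratic form. -/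
theorem tsum_exp_neg_sum_mulVec_sq {ι : Type*} [Fintype ι] [DecidableEq ι] {B : Matrix ι ι ℝ}
    (hB : B.det ≠ 0) :
    ∑' m : ι → ℤ, Real.exp (-(Real.pi * ∑ i, ((B *ᵥ fun i => (m i : ℝ)) i) ^ 2)) =
      |B.det|⁻¹ * ∑' m : ι → ℤ,
        Real.exp (-(Real.pi * ∑ i, (((B⁻¹)ᵀ *ᵥ fun i => (m i : ℝ)) i) ^ 2)) := by
  have hB' : ((B⁻¹)ᵀ).det ≠ 0 := by
    rw [det_transpose, det_nonsing_inv, Ring.inverse_eq_inv']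
    exact inv_ne_zero hB
  let f : (ι → ℝ) → ℂ := fun x => Complex.exp (-(Real.pi * ∑ i, ((B *ᵥ x) i : ℂ) ^ 2))
  have hf : Continuous f := by
    have : Continuous fun x : ι → ℝ => B *ᵥ x := by fun_prop
    have h2 : ∀ i, Continuous fun x : ι → ℝ => ((B *ᵥ x) i : ℂ) := fun i =>
      Complex.continuous_ofReal.comp ((continuous_apply i).comp this)
    fun_prop
  have hfr : ∀ x, f x = ((Real.exp (-(Real.pi * ∑ i, ((B *ᵥ x) i) ^ 2)) : ℝ) : ℂ) := fun x => by
    simp only [f]; push_cast; rfl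
  obtain ⟨c, hc, h⟩ := exists_le_sum_mulVec_sq hB
  have hfn : ∀ x, ‖f x‖ ≤ ∏ i, Real.exp (-(Real.pi * c) * x i ^ 2) := fun x => by
    rw [hfr, Complex.norm_real, Real.norm_of_nonneg (Real.exp_pos _).le, ← Real.exp_sum,
      ← Finset.mul_sum]
    apply Real.exp_le_exp.2
    have := mul_le_mul_of_nonneg_left (h x) Real.pi_pos.le
    linarith
  have hfi : Integrable f := by
    refine Integrable.mono' (g := fun x : ι → ℝ => ∏ i, Real.exp (-(Real.pi * c) * x i ^ 2)) ?_
      hf.aestronglyMeasurable (Filter.Eventually.of_forall hfn)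
    exact Integrable.fintype_prod (f := fun (_ : ι) (x : ℝ) => Real.exp (-(Real.pi * c) * x ^ 2))
      fun _ => integrable_exp_neg_mul_sq (by positivity)
  have key := tsum_int_eq_tsum_integral_mFourier hf hfi (fun R => ?_) ?_
  · simp only [f, integral_mFourier_mul_gaussian hB] at key
    rw [tsum_mul_left] at key
    rw [Complex.ofReal_inv] at key
    apply Complex.ofReal_injective
    push_cast
    exact key
  · refine ⟨fun m => ∏ i, (Real.exp (Real.pi * c * R ^ 2) *
      Real.exp (-(Real.pi * c / 2) * (m i : ℝ) ^ 2)), ?_, fun m x hx => ?_⟩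
    · exact summable_pi_prod (g := fun k : ℤ => Real.exp (Real.pi * c * R ^ 2) *
        Real.exp (-(Real.pi * c / 2) * (k : ℝ) ^ 2))
        ((summable_exp_neg_mul_sq (by positivity)).mul_left _) fun k => by positivity
    · refine (hfn _).trans (Finset.prod_le_prod (fun i _ => (Real.exp_pos _).le) fun i _ => ?_)
      rw [← Real.exp_add]
      apply Real.exp_le_exp.2
      have h1 : x i ^ 2 ≤ R ^ 2 := sq_le_sq' (abs_le.1 (hx i)).1 (abs_le.1 (hx i)).2
      -- Follows from (x+m)² - m²/2 + x² = (2x+m)²/2 ≥ 0. Halving the Gaussian exponent buys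
      -- uniformity for |x| ≤ R.
      have h2 : (m i : ℝ) ^ 2 / 2 - R ^ 2 ≤ (x i + m i) ^ 2 := by
        nlinarith [sq_nonneg (2 * x i + m i)]
      have := mul_le_mul_of_nonneg_left h2 (mul_pos Real.pi_pos hc).le
      simp only [Pi.add_apply]
      linarith
  · simp only [f, integral_mFourier_mul_gaussian hB]
    refine Summable.mul_left _ ?_
    have := Complex.ofRealCLM.summable (summable_exp_neg_sum_mulVec_sq hB')
    refine this.congr fun m => ?_
    simp


/-! ### Real coordinates for the quadratic forms and the trace form. -/

open NumberField NumberField.InfinitePlace in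
/-- The quadratic form `∑_w mult w * Y_w * |α|_w²` on a number field. -/
noncomputable def placeForm {K : Type*} [Field K] [NumberField K] (Y : InfinitePlace K → ℝ) (α : K) :
    ℝ :=
  ∑ w : InfinitePlace K, (mult w : ℝ) * Y w * w α ^ 2

open NumberField NumberField.InfinitePlace in
/-- The trace as a sum of real parts over the infinite places. -/
theorem trace_eq_sum_mult_mul_re {K : Type*} [Field K] [NumberField K] (α : K) :
    (Algebra.trace ℚ K α : ℝ) = ∑ w : InfinitePlace K, (mult w : ℝ) * (w.embedding α).re := by
  classical
  have h := trace_eq_sum_embeddings (K := ℚ) (L := K) (E := ℂ) (x := α)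
  have h1 : (Algebra.trace ℚ K α : ℝ) = ∑ φ : K →+* ℂ, (φ α).re := by
    have := congrArg Complex.re h
    rw [Complex.re_sum, eq_ratCast, Complex.ratCast_re] at this
    rw [this]
    exact (Fintype.sum_equiv (RingHom.equivRatAlgHom K ℂ) (fun φ : K →+* ℂ => (φ α).re)
      (fun σ : K →ₐ[ℚ] ℂ => (σ α).re) fun φ => by rw [RingHom.equivRatAlgHom_apply]; rfl).symm
  rw [h1, ← Finset.sum_fiberwise Finset.univ fun φ : K →+* ℂ => InfinitePlace.mk φ]
  refine Finset.sum_congr rfl fun w _ => ?_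
  rw [← card_filter_mk_eq w, ← nsmul_eq_mul, ← Finset.sum_const]
  refine Finset.sum_congr rfl fun φ hφ => ?_
  rw [Finset.mem_filter] at hφ
  have : InfinitePlace.mk φ = InfinitePlace.mk w.embedding := by rw [hφ.2, mk_embedding]
  rcases mk_eq_iff.1 this with h | h
  · rw [h]
  · rw [← h, ComplexEmbedding.conjugate_coe_eq, Complex.conj_re]

open NumberField NumberField.InfinitePlace NumberField.mixedEmbedding in
/-- Real coordinates on a number field in which `placeForm` is a sum of squares. -/
noncomputable def placeCoord {K : Type*} [Field K] [NumberField K] (Y : InfinitePlace K → ℝ) (α : K) :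
    index K → ℝ
  | .inl w => √(Y w.1) * (w.1.embedding α).re
  | .inr (w, 0) => √(Y w.1) * (√2 * (w.1.embedding α).re)
  | .inr (w, 1) => √(Y w.1) * (√2 * (w.1.embedding α).im)

open NumberField NumberField.mixedEmbedding in
/-- The signs relating `placeCoord` to the trace form. -/
def placeSign {K : Type*} [Field K] [NumberField K] : index K → ℝ
  | .inl _ => 1
  | .inr (_, 0) => 1
  | .inr (_, 1) => -1

open NumberField NumberField.InfinitePlace NumberField.mixedEmbedding in
/-- The scaling factors in `placeCoord`. -/
noncomputable def placeScale {K : Type*} [Field K] [NumberField K] (Y : InfinitePlace K → ℝ) :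
    index K → ℝ
  | .inl w => √(Y w.1)
  | .inr (w, _) => √(Y w.1)

section PlaceCoord

open NumberField NumberField.InfinitePlace NumberField.mixedEmbedding Module
open scoped Classical

variable {K : Type*} [Field K] [NumberField K]

theorem sum_eq_sum_real_add_sum_complex (f : InfinitePlace K → ℝ) :
    ∑ w, f w = (∑ w : {w // IsReal w}, f w.1) + ∑ w : {w // IsComplex w}, f w.1 := by
  -- The product version, read in the multiplicative copy of ℝ, is the sum version.
  have := prod_eq_prod_mul_prod fun w => Multiplicative.ofAdd (f w)
  exact this

theorem sum_index (f : index K → ℝ) :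
    ∑ j, f j = (∑ w, f (.inl w)) + ∑ w, (f (.inr (w, 0)) + f (.inr (w, 1))) := by
  rw [Fintype.sum_sum_type, Fintype.sum_prod_type]
  simp

theorem sum_placeCoord_sq {Y : InfinitePlace K → ℝ} (hY : ∀ w, 0 < Y w) (α : K) :
    ∑ j, placeCoord Y α j ^ 2 = placeForm Y α := by
  rw [placeForm, sum_eq_sum_real_add_sum_complex, sum_index]
  congr 1
  · refine Finset.sum_congr rfl fun w _ => ?_
    rw [mult_isReal, placeCoord, mul_pow, Real.sq_sqrt (hY _).le, ← norm_embedding_eq]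
    have : (w.1.embedding α).im = 0 := by
      have := (embedding_of_isReal_apply w.2 α)
      rw [← this, Complex.ofReal_im]
    rw [← Complex.normSq_eq_norm_sq, Complex.normSq_apply, this]
    push_cast; ring
  · refine Finset.sum_congr rfl fun w _ => ?_
    rw [mult_isComplex, placeCoord, placeCoord, mul_pow, mul_pow, mul_pow, mul_pow,
      Real.sq_sqrt (hY _).le, Real.sq_sqrt zero_le_two, ← norm_embedding_eq,
      ← Complex.normSq_eq_norm_sq, Complex.normSq_apply]
    push_cast; ring

/-- The scalings √Y and √(Y⁻¹) cancel, so the pairing does not depend on Y. Consequently the dual of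
the scaled lattice comes from the trace dual with Y inverted; the signs account for Re(ab) = Re a Re
b - Im a Im b. -/
theorem sum_placeSign_mul {Y : InfinitePlace K → ℝ} (hY : ∀ w, 0 < Y w) (α β : K) :
    ∑ j, placeSign j * placeCoord Y α j * placeCoord (fun w => (Y w)⁻¹) β j =
      Algebra.trace ℚ K (α * β) := by
  rw [trace_eq_sum_mult_mul_re, sum_eq_sum_real_add_sum_complex, sum_index]
  have hs : ∀ w, √(Y w) * √(Y w)⁻¹ = 1 := fun w => by
    rw [← Real.sqrt_mul (hY w).le, mul_inv_cancel₀ (hY w).ne', Real.sqrt_one]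
  congr 1
  · refine Finset.sum_congr rfl fun w _ => ?_
    have h0 : ∀ γ, (w.1.embedding γ).im = 0 := fun γ => by
      rw [← embedding_of_isReal_apply w.2 γ, Complex.ofReal_im]
    rw [mult_isReal, placeCoord, placeCoord, placeSign, map_mul, Complex.mul_re, h0, h0]
    linear_combination (w.1.embedding α).re * (w.1.embedding β).re * hs w.1
  · refine Finset.sum_congr rfl fun w _ => ?_
    rw [mult_isComplex, placeCoord, placeCoord, placeCoord, placeCoord, placeSign, placeSign,
      map_mul, Complex.mul_re]
    have h2 : √(2 : ℝ) * √2 = 2 := Real.mul_self_sqrt zero_le_two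
    push_cast
    linear_combination ((w.1.embedding α).re * (w.1.embedding β).re -
      (w.1.embedding α).im * (w.1.embedding β).im) * (√(2 : ℝ) * √2 * hs w.1 + h2)

theorem placeCoord_eq_scale_mul (Y : InfinitePlace K → ℝ) (α : K) (j : index K) :
    placeCoord Y α j = placeScale Y j * placeCoord (fun _ => 1) α j := by
  rcases j with w | ⟨w, j⟩
  · simp [placeCoord, placeScale]
  · fin_cases j <;> simp [placeCoord, placeScale]

theorem prod_placeScale {Y : InfinitePlace K → ℝ} (hY : ∀ w, 0 < Y w) :
    ∏ j, placeScale Y j = √(∏ w, Y w ^ mult w) := by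
  symm
  rw [Real.sqrt_eq_iff_mul_self_eq (Finset.prod_nonneg fun w _ => pow_nonneg (hY w).le _)
    (Finset.prod_nonneg fun j _ => by rcases j with w | ⟨w, j⟩ <;> exact Real.sqrt_nonneg _),
    prod_eq_prod_mul_prod, Fintype.prod_sum_type, Fintype.prod_prod_type]
  simp only [Fin.prod_univ_two, placeScale, mult_isReal, mult_isComplex, pow_one,
    Finset.prod_mul_distrib]
  have h1 : (∏ w : {w : InfinitePlace K // IsReal w}, √(Y w.1)) *
      (∏ w : {w : InfinitePlace K // IsReal w}, √(Y w.1)) =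
      ∏ w : {w : InfinitePlace K // IsReal w}, Y w.1 := by
    rw [← Finset.prod_mul_distrib]
    exact Finset.prod_congr rfl fun w _ => Real.mul_self_sqrt (hY _).le
  have h2 : (∏ w : {w : InfinitePlace K // IsComplex w}, √(Y w.1)) *
      (∏ w : {w : InfinitePlace K // IsComplex w}, √(Y w.1)) =
      ∏ w : {w : InfinitePlace K // IsComplex w}, Y w.1 := by
    rw [← Finset.prod_mul_distrib]
    exact Finset.prod_congr rfl fun w _ => Real.mul_self_sqrt (hY _).le
  rw [h2, mul_mul_mul_comm, h1, Finset.prod_pow]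
  ring

theorem placeCoord_sum {ι : Type*} [Fintype ι] (Y : InfinitePlace K → ℝ) (b : ι → K) (m : ι → ℤ)
    (j : index K) :
    placeCoord Y (∑ i, (m i : K) * b i) j = ∑ i, placeCoord Y (b i) j * m i := by
  have hr : ∀ w : InfinitePlace K, (w.embedding (∑ i, (m i : K) * b i)).re =
      ∑ i, (w.embedding (b i)).re * m i := fun w => by
    rw [map_sum, Complex.re_sum]
    refine Finset.sum_congr rfl fun i _ => ?_
    rw [map_mul, map_intCast, mul_comm, ← Complex.ofReal_intCast, Complex.re_mul_ofReal]
  have hi : ∀ w : InfinitePlace K, (w.embedding (∑ i, (m i : K) * b i)).im =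
      ∑ i, (w.embedding (b i)).im * m i := fun w => by
    rw [map_sum, Complex.im_sum]
    refine Finset.sum_congr rfl fun i _ => ?_
    rw [map_mul, map_intCast, mul_comm, ← Complex.ofReal_intCast, Complex.im_mul_ofReal]
  rcases j with w | ⟨w, j⟩
  · simp only [placeCoord, hr, Finset.mul_sum, mul_assoc]
  · fin_cases j
    · simp only [placeCoord, hr, Finset.mul_sum, mul_assoc]
    · simp only [placeCoord, hi, Finset.mul_sum, mul_assoc]

end PlaceCoord

/-! ### Matrices of ideal lattices and their determinants. -/

section PlaceMatrix

open NumberField NumberField.InfinitePlace NumberField.mixedEmbedding Module Matrix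

variable {K : Type*} [Field K] [NumberField K] {ι : Type*} [Fintype ι]

/-- The matrix of the coordinates `placeCoord` of a family of elements. -/
noncomputable def placeMatrix (e : ι ≃ index K) (Y : InfinitePlace K → ℝ) (b : ι → K) :
    Matrix ι ι ℝ :=
  Matrix.of fun i j => placeCoord Y (b j) (e i)

theorem placeMatrix_mulVec (e : ι ≃ index K) (Y : InfinitePlace K → ℝ) (b : ι → K) (m : ι → ℤ) (i : ι) :
    (placeMatrix e Y b *ᵥ fun i => (m i : ℝ)) i = placeCoord Y (∑ i, (m i : K) * b i) (e i) := by
  rw [placeCoord_sum]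
  rfl

theorem sum_placeMatrix_mulVec_sq (e : ι ≃ index K) {Y : InfinitePlace K → ℝ} (hY : ∀ w, 0 < Y w)
    (b : ι → K) (m : ι → ℤ) :
    ∑ i, ((placeMatrix e Y b *ᵥ fun i => (m i : ℝ)) i) ^ 2 = placeForm Y (∑ i, (m i : K) * b i) := by
  classical
  simp only [placeMatrix_mulVec]
  rw [← sum_placeCoord_sq hY, ← e.sum_comp]

variable [DecidableEq ι]

/-- Matrix form of `sum_placeSign_mul`. It is used with b' = b to find the determinant and with b'
the trace-dual basis to find the inverse. -/
theorem placeMatrix_transpose_mul (e : ι ≃ index K) {Y : InfinitePlace K → ℝ} (hY : ∀ w, 0 < Y w)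
    (b b' : ι → K) :
    (placeMatrix e Y b)ᵀ * (diagonal (fun i => placeSign (e i)) *
      placeMatrix e (fun w => (Y w)⁻¹) b') =
      Matrix.of fun i j => (Algebra.trace ℚ K (b i * b' j) : ℝ) := by
  classical
  ext i j
  rw [of_apply, ← sum_placeSign_mul hY, ← e.sum_comp, mul_apply]
  refine Finset.sum_congr rfl fun k _ => ?_
  rw [diagonal_mul, transpose_apply, placeMatrix, placeMatrix, of_apply, of_apply]
  ring

theorem abs_det_diagonal_placeSign (e : ι ≃ index K) :
    |(diagonal (fun i => (placeSign (e i) : ℝ))).det| = 1 := by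
  rw [det_diagonal, Finset.abs_prod]
  refine Finset.prod_eq_one fun i _ => ?_
  rcases e i with w | ⟨w, j⟩
  · simp [placeSign]
  · fin_cases j <;> simp [placeSign]

/-- For Y = 1 and b' = b, `placeMatrix_transpose_mul` shows that the squared determinant is the
discriminant up to sign; general Y only rescales the rows. -/
theorem abs_det_placeMatrix (e : ι ≃ index K) {Y : InfinitePlace K → ℝ} (hY : ∀ w, 0 < Y w)
    (b : ι → K) :
    |(placeMatrix e Y b).det| = √|(Algebra.discr ℚ b : ℝ)| * √(∏ w, Y w ^ mult w) := by
  classical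
  have h1 : |(placeMatrix e (fun _ => 1) b).det| = √|(Algebra.discr ℚ b : ℝ)| := by
    have h := placeMatrix_transpose_mul e (Y := fun _ : InfinitePlace K => (1 : ℝ))
      (fun _ => one_pos) b b
    have h' : (Matrix.of fun i j => (Algebra.trace ℚ K (b i * b j) : ℝ)) =
        (Rat.castHom ℝ).mapMatrix (Algebra.traceMatrix ℚ b) := by
      ext i j
      simp [Algebra.traceMatrix_apply, Algebra.traceForm_apply]
    have h2 := congrArg (fun M => |M.det|) h
    simp only [h', det_mul, abs_mul, abs_det_diagonal_placeSign, one_mul, det_transpose, inv_one,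
      ← RingHom.map_det] at h2
    rw [Algebra.discr_def, ← Rat.coe_castHom, ← h2, Real.sqrt_mul_self (abs_nonneg _)]
  have h2 : placeMatrix e Y b = diagonal (fun i => placeScale Y (e i)) *
      placeMatrix e (fun _ => 1) b := by
    ext i j
    rw [diagonal_mul, placeMatrix, of_apply, placeCoord_eq_scale_mul]
    rfl
  rw [h2, det_mul, det_diagonal, abs_mul, h1, e.prod_comp (placeScale Y), prod_placeScale hY,
    abs_of_nonneg (Real.sqrt_nonneg _), mul_comm]

end PlaceMatrix


/-! ### Theta series of fractional ideals. -/

section IdealTheta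

open NumberField NumberField.InfinitePlace NumberField.mixedEmbedding Module Matrix nonZeroDivisors

variable {K : Type*} [Field K] [NumberField K]

/-- The theta series of a fractional ideal. -/
noncomputable def idealTheta (I : FractionalIdeal (𝓞 K)⁰ K) (Y : InfinitePlace K → ℝ) : ℝ :=
  ∑' α : {α : K // α ∈ I}, Real.exp (-(Real.pi * placeForm Y (α : K)))

/-- Coordinates on a fractional ideal with respect to a basis. -/
theorem exists_equiv_of_span (I : FractionalIdeal (𝓞 K)⁰ K) {ι : Type*} [Fintype ι] (b : Basis ι ℚ K)
    (hb : ∀ x, x ∈ I ↔ x ∈ Submodule.span ℤ (Set.range b)) :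
    ∃ f : (ι → ℤ) ≃ {α : K // α ∈ I}, ∀ m, (f m : K) = ∑ i, (m i : K) * b i := by
  let b' := b.restrictScalars ℤ
  let f1 := b'.equivFun.symm.toEquiv
  let f2 : Submodule.span ℤ (Set.range b) ≃ {α : K // α ∈ I} := Equiv.subtypeEquivRight fun x => (hb x).symm
  refine ⟨f1.trans f2, fun m => ?_⟩
  change ((b'.equivFun.symm m : Submodule.span ℤ (Set.range b)) : K) = _
  rw [Basis.equivFun_symm_apply, Submodule.coe_sum]
  refine Finset.sum_congr rfl fun i _ => ?_
  rw [Submodule.coe_smul, Basis.restrictScalars_apply, zsmul_eq_mul]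

theorem exists_equiv_index {ι : Type*} [Fintype ι] (b : Basis ι ℚ K) : Nonempty (ι ≃ index K) := by
  classical
  refine ⟨Fintype.equivOfCardEq ?_⟩
  rw [← finrank_eq_card_basis b, Fintype.card_congr (indexEquiv K), Embeddings.card]

theorem det_placeMatrix_ne_zero {ι : Type*} [Fintype ι] [DecidableEq ι] (e : ι ≃ index K)
    {Y : InfinitePlace K → ℝ} (hY : ∀ w, 0 < Y w) (b : Basis ι ℚ K) : (placeMatrix e Y b).det ≠ 0 := by
  rw [← abs_pos, abs_det_placeMatrix e hY]
  have h1 : (Algebra.discr ℚ b : ℝ) ≠ 0 := by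
    exact_mod_cast Algebra.discr_not_zero_of_basis ℚ b
  have h2 : 0 < ∏ w, Y w ^ mult w := Finset.prod_pos fun w _ => pow_pos (hY w) _
  positivity

theorem summable_idealTheta (I : (FractionalIdeal (𝓞 K)⁰ K)ˣ) {Y : InfinitePlace K → ℝ}
    (hY : ∀ w, 0 < Y w) :
    Summable fun α : {α : K // α ∈ (I : FractionalIdeal (𝓞 K)⁰ K)} => Real.exp (-(Real.pi * placeForm Y (α : K))) := by
  classical
  let b := basisOfFractionalIdeal K I
  obtain ⟨f, hf⟩ := exists_equiv_of_span (I : FractionalIdeal (𝓞 K)⁰ K) b fun x =>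
    (mem_span_basisOfFractionalIdeal K).symm
  obtain ⟨e⟩ := exists_equiv_index b
  rw [← f.summable_iff]
  refine (summable_exp_neg_sum_mulVec_sq (det_placeMatrix_ne_zero e hY b)).congr fun m => ?_
  rw [sum_placeMatrix_mulVec_sq e hY, Function.comp, hf]

/-- The change of basis from an integral basis of K has determinant N(I) in absolute value, and the
discriminant scales by its square. -/
theorem abs_discr_basisOfFractionalIdeal (I : (FractionalIdeal (𝓞 K)⁰ K)ˣ) :
    |(Algebra.discr ℚ (basisOfFractionalIdeal K I) : ℝ)| =
      (FractionalIdeal.absNorm (I : FractionalIdeal (𝓞 K)⁰ K) : ℝ) ^ 2 * |(discr K : ℝ)| := by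
  classical
  let b := basisOfFractionalIdeal K I
  have hcard : Fintype.card (Free.ChooseBasisIndex ℤ (𝓞 K)) =
      Fintype.card (Free.ChooseBasisIndex ℤ (I : FractionalIdeal (𝓞 K)⁰ K)) := by
    rw [← finrank_eq_card_basis b, ← finrank_eq_card_basis (integralBasis K)]
  let e := Fintype.equivOfCardEq hcard
  have h1 := det_basisOfFractionalIdeal_eq_absNorm K I e
  have h2 : Algebra.discr ℚ (b.reindex e.symm) = (integralBasis K).det (b.reindex e.symm) ^ 2 *
      Algebra.discr ℚ (integralBasis K) := by
    rw [Basis.det_apply, ← Algebra.discr_of_matrix_vecMul]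
    congr 1
    funext i
    rw [Matrix.vecMul_eq_sum, Finset.sum_apply]
    conv_lhs => rw [← (integralBasis K).sum_repr (b.reindex e.symm i)]
    refine Finset.sum_congr rfl fun j _ => ?_
    rw [Pi.smul_apply, Matrix.map_apply, Basis.toMatrix_apply, smul_eq_mul, mul_comm,
      Algebra.smul_def]
  have h3 : Algebra.discr ℚ (b.reindex e.symm) = Algebra.discr ℚ b := by
    rw [Basis.coe_reindex]
    exact Algebra.discr_reindex ℚ b e.symm
  rw [← h3, h2, ← coe_discr, ← h1]
  push_cast
  rw [abs_mul, abs_pow]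

/-- The transformation formula for the theta series of a fractional ideal. -/
theorem idealTheta_eq (I : (FractionalIdeal (𝓞 K)⁰ K)ˣ) {Y : InfinitePlace K → ℝ}
    (hY : ∀ w, 0 < Y w) :
    idealTheta (I : FractionalIdeal (𝓞 K)⁰ K) Y =
      ((FractionalIdeal.absNorm (I : FractionalIdeal (𝓞 K)⁰ K) : ℝ) * √|(discr K : ℝ)| *
        √(∏ w, Y w ^ mult w))⁻¹ *
      idealTheta (FractionalIdeal.dual ℤ ℚ (I : FractionalIdeal (𝓞 K)⁰ K)) (fun w => (Y w)⁻¹) := by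
  classical
  let b := basisOfFractionalIdeal K I
  have hbI : ∀ x, x ∈ (I : FractionalIdeal (𝓞 K)⁰ K) ↔ x ∈ Submodule.span ℤ (Set.range b) :=
    fun x => (mem_span_basisOfFractionalIdeal K).symm
  have hI0 : (I : FractionalIdeal (𝓞 K)⁰ K) ≠ 0 := I.ne_zero
  have hnd := traceForm_nondegenerate ℚ K
  let b' := LinearMap.BilinForm.dualBasis (Algebra.traceForm ℚ K) hnd b
  have hbI' : ∀ x, x ∈ FractionalIdeal.dual ℤ ℚ (I : FractionalIdeal (𝓞 K)⁰ K) ↔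
      x ∈ Submodule.span ℤ (Set.range b') := fun x => by
    rw [← LinearMap.BilinForm.dualSubmodule_span_of_basis, LinearMap.BilinForm.mem_dualSubmodule,
      FractionalIdeal.mem_dual hI0]
    refine forall_congr' fun a => ?_
    rw [hbI a, Submodule.mem_one]
    rfl
  obtain ⟨f, hf⟩ := exists_equiv_of_span _ b hbI
  obtain ⟨f', hf'⟩ := exists_equiv_of_span _ b' hbI'
  obtain ⟨e⟩ := exists_equiv_index b
  have hY' : ∀ w, 0 < (Y w)⁻¹ := fun w => inv_pos.2 (hY w)
  -- For the trace-dual basis the matrix of traces is the identity, which identifies the inverse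
  -- transpose as the matrix of the dual lattice up to row signs; the signs disappear on squaring.
  have hinv : ((placeMatrix e Y b)⁻¹)ᵀ =
      diagonal (fun i => placeSign (e i)) * placeMatrix e (fun w => (Y w)⁻¹) b' := by
    rw [transpose_nonsing_inv]
    refine inv_eq_right_inv ?_
    rw [placeMatrix_transpose_mul e hY]
    ext i j
    have := LinearMap.BilinForm.apply_dualBasis_right (B := Algebra.traceForm ℚ K) hnd
      (Algebra.traceForm_isSymm ℚ) b i j
    rw [Algebra.traceForm_apply] at this
    rw [of_apply, this, one_apply]
    split_ifs <;> simp
  have hsq : ∀ m : _ → ℤ, ∑ i, ((((placeMatrix e Y b)⁻¹)ᵀ *ᵥ fun i => (m i : ℝ)) i) ^ 2 =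
      placeForm (fun w => (Y w)⁻¹) (f' m : K) := fun m => by
    rw [hf', ← sum_placeMatrix_mulVec_sq e hY', hinv]
    refine Finset.sum_congr rfl fun i _ => ?_
    rw [← mulVec_mulVec, mulVec_diagonal, mul_pow]
    have : (placeSign (e i) : ℝ) ^ 2 = 1 := by
      rcases e i with w | ⟨w, j⟩
      · simp [placeSign]
      · fin_cases j <;> simp [placeSign]
    rw [this, one_mul]
  have key := tsum_exp_neg_sum_mulVec_sq (det_placeMatrix_ne_zero e hY b)
  simp only [hsq, sum_placeMatrix_mulVec_sq e hY, ← hf] at key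
  rw [abs_det_placeMatrix e hY, abs_discr_basisOfFractionalIdeal, Real.sqrt_mul (sq_nonneg _),
    Real.sqrt_sq (by exact_mod_cast FractionalIdeal.absNorm_nonneg _)] at key
  rw [idealTheta, idealTheta, ← f.tsum_eq, ← f'.tsum_eq]
  exact key

end IdealTheta


/-! ### The unit lattice in logarithmic space. -/

section LogScale

open scoped Classical
open NumberField NumberField.InfinitePlace NumberField.Units NumberField.Units.dirichletUnitTheorem
  MeasureTheory

variable {K : Type*} [Field K] [NumberField K]

/-- The coordinates `2 x_w / mult w`, extended to `w₀` so that the weighted sum vanishes. -/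
noncomputable def logScale : logSpace K →ₗ[ℝ] (InfinitePlace K → ℝ) where
  toFun x w := if h : w = w₀ then -(2 * ∑ v, x v) / mult w else 2 * x ⟨w, h⟩ / mult w
  map_add' x y := by
    funext w
    simp only [Pi.add_apply]
    split_ifs
    · rw [Finset.sum_add_distrib]; ring
    · ring
  map_smul' c x := by
    funext w
    simp only [Pi.smul_apply, smul_eq_mul, RingHom.id_apply]
    split_ifs
    · rw [← Finset.mul_sum]; ring
    · ring

theorem logScale_apply (x : logSpace K) (w : InfinitePlace K) : logScale x w =
    if h : w = w₀ then -(2 * ∑ v, x v) / mult w else 2 * x ⟨w, h⟩ / mult w := rfl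

theorem sum_mult_mul_logScale (x : logSpace K) : ∑ w, (mult w : ℝ) * logScale x w = 0 := by
  have hm : ∀ w : InfinitePlace K, (mult w : ℝ) ≠ 0 := fun w => mult_coe_ne_zero
  rw [Fintype.sum_eq_add_sum_subtype_ne _ w₀, logScale_apply, dif_pos rfl]
  have : ∀ w : {w : InfinitePlace K // w ≠ w₀}, (mult w.1 : ℝ) * logScale x w.1 = 2 * x w :=
    fun w => by
      have := hm w.1
      rw [logScale_apply, dif_neg w.2]
      field_simp
  simp_rw [this]
  have := hm (w₀ : InfinitePlace K)
  rw [← Finset.mul_sum]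
  field_simp
  ring

/-- The components of the logarithmic embedding are mult w · log w(u), so the normalization 2/mult w
yields log w(u)². Translation by u then rescales Y exactly as multiplication of α by u does. -/
theorem logScale_logEmbedding (u : (𝓞 K)ˣ) (w : InfinitePlace K) :
    logScale (logEmbedding K (Additive.ofMul u)) w = 2 * Real.log (w (u : K)) := by
  have hm : ∀ w : InfinitePlace K, (mult w : ℝ) ≠ 0 := fun w => mult_coe_ne_zero
  rw [logScale_apply]
  have := hm w
  split_ifs with h
  · rw [sum_logEmbedding_component, h]
    rw [h] at this
    field_simp
  · rw [logEmbedding_component]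
    field_simp

theorem logScale_injective : Function.Injective (logScale (K := K)) := by
  intro x y h
  funext w
  have := congrFun h w.1
  have hm : (mult w.1 : ℝ) ≠ 0 := mult_coe_ne_zero
  rw [logScale_apply, logScale_apply, dif_neg w.2, dif_neg w.2] at this
  field_simp at this
  exact this

theorem continuous_logScale : Continuous (logScale (K := K)) :=
  LinearMap.continuous_of_finiteDimensional _

/-- A bounded measurable exact fundamental domain for the lattice of units. -/
structure IsUnitDomain (F : Set (logSpace K)) : Prop where
  measurableSet : MeasurableSet F
  isBounded : Bornology.IsBounded F
  existsUnique : ∀ x, ∃! l : unitLattice K, (l : logSpace K) + x ∈ F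

theorem exists_isUnitDomain : ∃ F : Set (logSpace K), IsUnitDomain F := by
  let b := (basisUnitLattice K).ofZLatticeBasis ℝ (unitLattice K)
  have hspan : Submodule.span ℤ (Set.range b) = unitLattice K :=
    (basisUnitLattice K).ofZLatticeBasis_span ℝ (unitLattice K)
  refine ⟨ZSpan.fundamentalDomain b, ZSpan.fundamentalDomain_measurableSet b,
    ZSpan.fundamentalDomain_isBounded b, fun x => ?_⟩
  obtain ⟨v, hv, huniq⟩ := ZSpan.exist_unique_vadd_mem_fundamentalDomain b x
  refine ⟨⟨v, hspan ▸ v.2⟩, hv, fun l hl => ?_⟩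
  have := huniq ⟨l, hspan.symm ▸ l.2⟩ hl
  exact Subtype.ext (congrArg (fun v : Submodule.span ℤ (Set.range b) => (v : logSpace K)) this)

/-- Needed because the theta transformation inverts Y, which replaces x by -x in logarithmic space.
-/
theorem IsUnitDomain.neg {F : Set (logSpace K)} (hF : IsUnitDomain F) :
    IsUnitDomain (Neg.neg ⁻¹' F) := by
  refine ⟨measurable_neg hF.measurableSet, ?_, fun x => ?_⟩
  · rw [Set.neg_preimage]; exact hF.isBounded.neg
  · obtain ⟨l, hl, hu⟩ := hF.existsUnique (-x)
    refine ⟨-l, by simpa [add_comm] using hl, fun m hm => ?_⟩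
    rw [← hu (-m) (by simpa [add_comm] using hm), neg_neg]

theorem IsUnitDomain.volume_lt_top {F : Set (logSpace K)} (hF : IsUnitDomain F) : volume F < ⊤ :=
  hF.isBounded.measure_lt_top

/-- `exp ∘ logScale` is bounded below on bounded sets. -/
theorem IsUnitDomain.exists_le_exp_logScale {F : Set (logSpace K)} (hF : IsUnitDomain F) :
    ∃ δ > 0, ∀ x ∈ F, ∀ w, δ ≤ Real.exp (logScale x w) := by
  obtain ⟨R, hR⟩ := hF.isBounded.isCompact_closure.exists_bound_of_continuousOn
    (continuous_logScale (K := K)).continuousOn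
  refine ⟨Real.exp (-R), Real.exp_pos _, fun x hx w => Real.exp_le_exp.2 ?_⟩
  exact neg_le_of_abs_le ((norm_le_pi_norm (logScale x) w).trans (hR x (subset_closure hx)))

end LogScale

/-! ### Theta series averaged over a unit domain. -/

section ThetaMean

open scoped Classical
open NumberField NumberField.InfinitePlace NumberField.Units NumberField.Units.dirichletUnitTheorem
  MeasureTheory nonZeroDivisors Filter Topology Asymptotics

variable {K : Type*} [Field K] [NumberField K]

theorem placeForm_zero (Y : InfinitePlace K → ℝ) : placeForm Y (0 : K) = 0 := by
  simp [placeForm]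

theorem placeForm_mono {Y Z : InfinitePlace K → ℝ} (h : ∀ w, Y w ≤ Z w) (α : K) :
    placeForm Y α ≤ placeForm Z α :=
  Finset.sum_le_sum fun w _ => mul_le_mul_of_nonneg_right
    (mul_le_mul_of_nonneg_left (h w) (Nat.cast_nonneg _)) (sq_nonneg _)

theorem placeForm_smul (t : ℝ) (Y : InfinitePlace K → ℝ) (α : K) :
    placeForm (fun w => t * Y w) α = t * placeForm Y α := by
  rw [placeForm, placeForm, Finset.mul_sum]
  exact Finset.sum_congr rfl fun w _ => by ring

theorem continuous_placeForm (α : K) : Continuous fun Y : InfinitePlace K → ℝ => placeForm Y α := by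
  unfold placeForm
  fun_prop

/-- A non-zero element has a non-zero integral coordinate vector, of Euclidean length at least 1,
and the form is bounded below by a multiple of the squared length. -/
theorem exists_pos_le_placeForm (I : (FractionalIdeal (𝓞 K)⁰ K)ˣ) :
    ∃ q > 0, ∀ α ∈ (I : FractionalIdeal (𝓞 K)⁰ K), α ≠ 0 → q ≤ placeForm (fun _ => 1) α := by
  let b := basisOfFractionalIdeal K I
  obtain ⟨f, hf⟩ := exists_equiv_of_span (I : FractionalIdeal (𝓞 K)⁰ K) b fun x =>
    (mem_span_basisOfFractionalIdeal K).symm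
  obtain ⟨e⟩ := exists_equiv_index b
  obtain ⟨c, hc, h⟩ := exists_le_sum_mulVec_sq
    (det_placeMatrix_ne_zero e (Y := fun _ => 1) (fun _ => one_pos) b)
  refine ⟨c, hc, fun α hα h0 => ?_⟩
  obtain ⟨m, hm⟩ := f.surjective ⟨α, hα⟩
  have hm' : (∑ i, (m i : K) * b i) = α := by rw [← hf, hm]
  have h1 := h fun i => (m i : ℝ)
  rw [sum_placeMatrix_mulVec_sq e (fun _ => one_pos), hm'] at h1
  refine le_trans ?_ h1
  have hne : ∃ i, m i ≠ 0 := by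
    by_contra hcon
    push Not at hcon
    exact h0 (by rw [← hm']; simp [hcon])
  obtain ⟨i, hi⟩ := hne
  have : (1 : ℝ) ≤ ∑ i, (m i : ℝ) ^ 2 := by
    refine le_trans ?_ (Finset.single_le_sum (f := fun i => (m i : ℝ) ^ 2)
      (fun j _ => sq_nonneg _) (Finset.mem_univ i))
    have h2 : (1 : ℤ) ≤ m i ^ 2 := by
      have : 0 < m i ^ 2 := by positivity
      omega
    exact_mod_cast h2
  nlinarith

theorem continuousOn_idealTheta (I : (FractionalIdeal (𝓞 K)⁰ K)ˣ) {δ : ℝ} (hδ : 0 < δ) :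
    ContinuousOn (idealTheta (I : FractionalIdeal (𝓞 K)⁰ K)) {Y | ∀ w, δ ≤ Y w} := by
  refine continuousOn_tsum (fun α => ?_) (summable_idealTheta I (Y := fun _ => δ) fun _ => hδ)
    fun α Y hY => ?_
  · have := continuous_placeForm (α : K)
    fun_prop
  · rw [Real.norm_of_nonneg (Real.exp_pos _).le]
    apply Real.exp_le_exp.2
    have := mul_le_mul_of_nonneg_left (placeForm_mono hY (α : K)) Real.pi_pos.le
    linarith

theorem idealTheta_anti (I : (FractionalIdeal (𝓞 K)⁰ K)ˣ) {Y Z : InfinitePlace K → ℝ}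
    (hY : ∀ w, 0 < Y w) (h : ∀ w, Y w ≤ Z w) :
    idealTheta (I : FractionalIdeal (𝓞 K)⁰ K) Z ≤ idealTheta (I : FractionalIdeal (𝓞 K)⁰ K) Y := by
  refine Summable.tsum_le_tsum (fun α => Real.exp_le_exp.2 ?_)
    (summable_idealTheta I fun w => (hY w).trans_le (h w)) (summable_idealTheta I hY)
  have := mul_le_mul_of_nonneg_left (placeForm_mono h (α : K)) Real.pi_pos.le
  linarith

theorem idealTheta_nonneg (I : FractionalIdeal (𝓞 K)⁰ K) (Y : InfinitePlace K → ℝ) :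
    0 ≤ idealTheta I Y := tsum_nonneg fun _ => (Real.exp_pos _).le

/-- The theta series without its constant term. -/
noncomputable def idealTheta₀ (I : FractionalIdeal (𝓞 K)⁰ K) (Y : InfinitePlace K → ℝ) : ℝ :=
  ∑' α : {α : K // α ∈ I ∧ α ≠ 0}, Real.exp (-(Real.pi * placeForm Y (α : K)))

theorem summable_idealTheta₀ (I : (FractionalIdeal (𝓞 K)⁰ K)ˣ) {Y : InfinitePlace K → ℝ}
    (hY : ∀ w, 0 < Y w) :
    Summable fun α : {α : K // α ∈ (I : FractionalIdeal (𝓞 K)⁰ K) ∧ α ≠ 0} =>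
      Real.exp (-(Real.pi * placeForm Y (α : K))) := by
  let g : {α : K // α ∈ (I : FractionalIdeal (𝓞 K)⁰ K) ∧ α ≠ 0} →
    {α : K // α ∈ (I : FractionalIdeal (𝓞 K)⁰ K)} := fun α => ⟨α.1, α.2.1⟩
  have hg : Function.Injective g := fun a b h =>
    Subtype.ext (congrArg (fun x : {α : K // α ∈ (I : FractionalIdeal (𝓞 K)⁰ K)} => x.1) h)
  have := (summable_idealTheta I hY).comp_injective hg
  exact this.congr fun α => rfl

theorem idealTheta_eq_one_add (I : (FractionalIdeal (𝓞 K)⁰ K)ˣ) {Y : InfinitePlace K → ℝ}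
    (hY : ∀ w, 0 < Y w) : idealTheta (I : FractionalIdeal (𝓞 K)⁰ K) Y =
      1 + idealTheta₀ (I : FractionalIdeal (𝓞 K)⁰ K) Y := by
  let z : {α : K // α ∈ (I : FractionalIdeal (𝓞 K)⁰ K)} := ⟨0, FractionalIdeal.zero_mem _⟩
  rw [idealTheta, (summable_idealTheta I hY).tsum_eq_add_tsum_ite z, placeForm_zero, mul_zero,
    neg_zero, Real.exp_zero, idealTheta₀]
  congr 1
  let g : {α : K // α ∈ (I : FractionalIdeal (𝓞 K)⁰ K) ∧ α ≠ 0} →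
    {α : K // α ∈ (I : FractionalIdeal (𝓞 K)⁰ K)} := fun α => ⟨α.1, α.2.1⟩
  have hg : Function.Injective g := fun a b h =>
    Subtype.ext (congrArg (fun x : {α : K // α ∈ (I : FractionalIdeal (𝓞 K)⁰ K)} => x.1) h)
  rw [← hg.tsum_eq]
  · refine tsum_congr fun α => ?_
    rw [if_neg]
    intro h
    exact α.2.2 (congrArg (fun x : {α : K // α ∈ (I : FractionalIdeal (𝓞 K)⁰ K)} => x.1) h)
  · intro α hα
    refine ⟨⟨α.1, α.2, fun h => hα ?_⟩, rfl⟩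
    exact if_pos (Subtype.ext h)

theorem idealTheta₀_nonneg (I : FractionalIdeal (𝓞 K)⁰ K) (Y : InfinitePlace K → ℝ) :
    0 ≤ idealTheta₀ I Y := tsum_nonneg fun _ => (Real.exp_pos _).le

/-- Exponential decay of the theta series without its constant term. -/
theorem exists_idealTheta₀_le (I : (FractionalIdeal (𝓞 K)⁰ K)ˣ) {δ : ℝ} (hδ : 0 < δ) :
    ∃ C c : ℝ, 0 < c ∧ ∀ t : ℝ, 1 ≤ t → ∀ Y : InfinitePlace K → ℝ, (∀ w, δ ≤ Y w) →
      idealTheta₀ (I : FractionalIdeal (𝓞 K)⁰ K) (fun w => t * Y w) ≤ C * Real.exp (-c * t) := by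
  obtain ⟨q, hq, h⟩ := exists_pos_le_placeForm I
  refine ⟨Real.exp (Real.pi * (δ * q)) * idealTheta₀ (I : FractionalIdeal (𝓞 K)⁰ K) fun _ => δ,
    Real.pi * (δ * q), by positivity, fun t ht Y hY => ?_⟩
  rw [mul_right_comm, ← Real.exp_add, idealTheta₀, idealTheta₀, ← tsum_mul_left]
  refine Summable.tsum_le_tsum (fun α => ?_) (summable_idealTheta₀ I fun w => ?_)
    ((summable_idealTheta₀ I (Y := fun _ => δ) fun _ => hδ).mul_left _)
  · rw [← Real.exp_add]
    apply Real.exp_le_exp.2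
    have h1 : placeForm (fun _ => δ) (α : K) ≤ placeForm Y (α : K) := placeForm_mono hY _
    have h2 : placeForm (fun _ => δ) (α : K) = δ * placeForm (fun _ => 1) (α : K) := by
      rw [← placeForm_smul]; simp
    have h3 := mul_le_mul_of_nonneg_left (h α α.2.1 α.2.2) hδ.le
    rw [placeForm_smul]
    rw [← h2] at h3
    have h4 : t * placeForm (fun _ => δ) (α : K) ≤ t * placeForm Y (α : K) :=
      mul_le_mul_of_nonneg_left h1 (by linarith)
    -- Of the t copies of the form, t - 1 are estimated by the minimum δq to give the decay, and one
    -- is kept to sum over α.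
    have h5 : (t - 1) * (δ * q) ≤ (t - 1) * placeForm (fun _ => δ) (α : K) :=
      mul_le_mul_of_nonneg_left h3 (by linarith)
    have : 0 ≤ Real.pi * (t * placeForm Y (α : K) - (t - 1) * (δ * q) - placeForm (fun _ => δ) (α : K)) :=
      mul_nonneg Real.pi_pos.le (by linarith)
    linarith
  · exact mul_pos (by linarith) (hδ.trans_le (hY w))

/-- The mean of the theta series of `I` over a fundamental domain for the units. -/
noncomputable def thetaMean (I : FractionalIdeal (𝓞 K)⁰ K) (F : Set (logSpace K)) (t : ℝ) : ℝ :=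
  ∫ x in F, idealTheta I fun w => t * Real.exp (logScale x w)

theorem continuous_scaled (t : ℝ) :
    Continuous fun x : logSpace K => fun w => t * Real.exp (logScale x w) := by
  have := continuous_logScale (K := K)
  refine continuous_pi fun w => ?_
  have : Continuous fun x : logSpace K => logScale x w := (continuous_apply w).comp this
  fun_prop

theorem continuousOn_idealTheta_scaled (I : (FractionalIdeal (𝓞 K)⁰ K)ˣ) {F : Set (logSpace K)}
    (hF : IsUnitDomain F) {t : ℝ} (ht : 0 < t) :
    ContinuousOn (fun x : logSpace K => idealTheta (I : FractionalIdeal (𝓞 K)⁰ K)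
      fun w => t * Real.exp (logScale x w)) F := by
  obtain ⟨δ, hδ, h⟩ := hF.exists_le_exp_logScale
  exact (continuousOn_idealTheta I (mul_pos ht hδ)).comp (continuous_scaled t).continuousOn
    fun x hx w => mul_le_mul_of_nonneg_left (h x hx w) ht.le

theorem integrableOn_idealTheta_scaled (I : (FractionalIdeal (𝓞 K)⁰ K)ˣ) {F : Set (logSpace K)}
    (hF : IsUnitDomain F) {t : ℝ} (ht : 0 < t) :
    IntegrableOn (fun x : logSpace K => idealTheta (I : FractionalIdeal (𝓞 K)⁰ K)
      fun w => t * Real.exp (logScale x w)) F := by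
  obtain ⟨δ, hδ, h⟩ := hF.exists_le_exp_logScale
  refine IntegrableOn.of_bound hF.volume_lt_top
    ((continuousOn_idealTheta_scaled I hF ht).aestronglyMeasurable hF.measurableSet)
    (idealTheta (I : FractionalIdeal (𝓞 K)⁰ K) fun _ => t * δ) ?_
  refine (ae_restrict_iff' hF.measurableSet).2 (Eventually.of_forall fun x hx => ?_)
  rw [Real.norm_of_nonneg (idealTheta_nonneg _ _)]
  exact idealTheta_anti I (fun _ => mul_pos ht hδ) fun w => mul_le_mul_of_nonneg_left (h x hx w) ht.le

theorem thetaMean_sub (I : (FractionalIdeal (𝓞 K)⁰ K)ˣ) {F : Set (logSpace K)}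
    (hF : IsUnitDomain F) {t : ℝ} (ht : 0 < t) :
    thetaMean (I : FractionalIdeal (𝓞 K)⁰ K) F t - volume.real F =
      ∫ x in F, idealTheta₀ (I : FractionalIdeal (𝓞 K)⁰ K) fun w => t * Real.exp (logScale x w) := by
  have h1 : volume.real F = ∫ x in F, (1 : ℝ) := by simp
  have hc : IntegrableOn (fun _ : logSpace K => (1 : ℝ)) F := by
    exact integrableOn_const hF.volume_lt_top.ne
  rw [thetaMean, h1, ← integral_sub (integrableOn_idealTheta_scaled I hF ht) hc]
  refine integral_congr_ae (Eventually.of_forall fun x => ?_)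
  simp only
  rw [idealTheta_eq_one_add I fun w => mul_pos ht (Real.exp_pos _), add_sub_cancel_left]

theorem continuousOn_thetaMean (I : (FractionalIdeal (𝓞 K)⁰ K)ˣ) {F : Set (logSpace K)}
    (hF : IsUnitDomain F) :
    ContinuousOn (thetaMean (I : FractionalIdeal (𝓞 K)⁰ K) F) (Set.Ioi 0) := by
  obtain ⟨δ, hδ, h⟩ := hF.exists_le_exp_logScale
  intro t₀ (ht₀ : 0 < t₀)
  refine ContinuousAt.continuousWithinAt ?_
  have hev : ∀ᶠ t in 𝓝 t₀, t₀ / 2 < t := lt_mem_nhds (by linarith)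
  refine continuousAt_of_dominated (bound := fun _ => idealTheta (I : FractionalIdeal (𝓞 K)⁰ K)
    fun _ => t₀ / 2 * δ) ?_ ?_ ?_ ?_
  · filter_upwards [hev] with t ht
    exact (continuousOn_idealTheta_scaled I hF (by linarith)).aestronglyMeasurable hF.measurableSet
  · filter_upwards [hev] with t ht
    refine (ae_restrict_iff' hF.measurableSet).2 (Eventually.of_forall fun x hx => ?_)
    rw [Real.norm_of_nonneg (idealTheta_nonneg _ _)]
    exact idealTheta_anti I (fun _ => by positivity) fun w =>
      mul_le_mul ht.le (h x hx w) hδ.le (by linarith)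
  · exact integrableOn_const hF.volume_lt_top.ne
  · refine (ae_restrict_iff' hF.measurableSet).2 (Eventually.of_forall fun x hx => ?_)
    have hcont := continuousOn_idealTheta I (δ := t₀ / 2 * δ) (by positivity)
    have hc2 : Continuous fun t : ℝ => fun w => t * Real.exp (logScale x w) := by fun_prop
    have := hcont.comp (s := Set.Ioi (t₀ / 2)) hc2.continuousOn fun t ht w =>
      mul_le_mul (Set.mem_Ioi.1 ht).le (h x hx w) hδ.le (by have := Set.mem_Ioi.1 ht; linarith)
    exact this.continuousAt (Ioi_mem_nhds (by linarith))

theorem thetaMean_sub_isBigO (I : (FractionalIdeal (𝓞 K)⁰ K)ˣ) {F : Set (logSpace K)}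
    (hF : IsUnitDomain F) (r : ℝ) :
    (fun t => thetaMean (I : FractionalIdeal (𝓞 K)⁰ K) F t - volume.real F) =O[atTop] (· ^ r) := by
  obtain ⟨δ, hδ, h⟩ := hF.exists_le_exp_logScale
  obtain ⟨C, c, hc, hC⟩ := exists_idealTheta₀_le I hδ
  refine IsBigO.trans ?_ (isLittleO_exp_neg_mul_rpow_atTop hc r).isBigO
  refine IsBigO.of_bound (C * volume.real F) ?_
  filter_upwards [eventually_ge_atTop 1] with t ht
  rw [thetaMean_sub I hF (by linarith), Real.norm_of_nonneg (Real.exp_pos _).le]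
  refine (norm_setIntegral_le_of_norm_le_const hF.volume_lt_top (C := C * Real.exp (-c * t))
    fun x hx => ?_).trans_eq (by ring)
  rw [Real.norm_of_nonneg (idealTheta₀_nonneg _ _)]
  exact hC t ht _ (h x hx)

/-- The dual of an invertible fractional ideal with respect to the trace. -/
noncomputable def traceDual (I : (FractionalIdeal (𝓞 K)⁰ K)ˣ) : (FractionalIdeal (𝓞 K)⁰ K)ˣ :=
  Units.mk0 (FractionalIdeal.dual ℤ ℚ (I : FractionalIdeal (𝓞 K)⁰ K))
    (FractionalIdeal.dual_ne_zero ℤ ℚ I.ne_zero)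

/-- Since the weighted sum of `logScale x` vanishes, ∏ Y_w^(mult w) depends on t alone and equals
t^(-n); this gives the weight n/2. The inverted parameters are those of -x, hence the reflected
domain. -/
theorem thetaMean_inv (I : (FractionalIdeal (𝓞 K)⁰ K)ˣ) {F : Set (logSpace K)} {t : ℝ} (ht : 0 < t) :
    thetaMean (I : FractionalIdeal (𝓞 K)⁰ K) F (1 / t) =
      ((FractionalIdeal.absNorm (I : FractionalIdeal (𝓞 K)⁰ K) : ℝ) * √|(discr K : ℝ)|)⁻¹ *
        t ^ ((Module.finrank ℚ K : ℝ) / 2) *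
        thetaMean (traceDual I : FractionalIdeal (𝓞 K)⁰ K) (Neg.neg ⁻¹' F) t := by
  have key : ∀ x : logSpace K, idealTheta (I : FractionalIdeal (𝓞 K)⁰ K)
      (fun w => 1 / t * Real.exp (logScale x w)) =
      ((FractionalIdeal.absNorm (I : FractionalIdeal (𝓞 K)⁰ K) : ℝ) * √|(discr K : ℝ)|)⁻¹ *
        t ^ ((Module.finrank ℚ K : ℝ) / 2) * idealTheta (traceDual I : FractionalIdeal (𝓞 K)⁰ K)
          (fun w => t * Real.exp (logScale (-x) w)) := by
    intro x
    rw [idealTheta_eq I fun w => by positivity]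
    have h1 : ∏ w : InfinitePlace K, (1 / t * Real.exp (logScale x w)) ^ mult w =
        (t ^ Module.finrank ℚ K)⁻¹ := by
      simp_rw [mul_pow]
      rw [Finset.prod_mul_distrib, Finset.prod_pow_eq_pow_sum, sum_mult_eq, one_div, inv_pow]
      have : ∏ w : InfinitePlace K, Real.exp (logScale x w) ^ mult w = 1 := by
        simp_rw [← Real.exp_nat_mul]
        rw [← Real.exp_sum, sum_mult_mul_logScale, Real.exp_zero]
      rw [this, mul_one]
    have h2 : √((t ^ Module.finrank ℚ K)⁻¹) = (t ^ ((Module.finrank ℚ K : ℝ) / 2))⁻¹ := by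
      rw [Real.sqrt_inv, Real.sqrt_eq_rpow, ← Real.rpow_natCast, ← Real.rpow_mul ht.le]
      congr 2; ring
    rw [h1, h2, mul_inv, inv_inv]
    congr 2
    funext w
    rw [map_neg, Pi.neg_apply, Real.exp_neg, mul_inv, one_div, inv_inv]
  rw [thetaMean, thetaMean]
  simp_rw [key]
  rw [integral_const_mul]
  congr 1
  rw [← (Measure.measurePreserving_neg volume).setIntegral_preimage_emb
    (MeasurableEquiv.neg (logSpace K)).measurableEmbedding _ (Neg.neg ⁻¹' F)]
  congr 2
  ext x
  simp

/-- The pair of theta means attached to a fractional ideal and its dual. -/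
noncomputable def heckePair (I : (FractionalIdeal (𝓞 K)⁰ K)ˣ) (F : Set (logSpace K))
    (hF : IsUnitDomain F) : WeakFEPair ℂ where
  f t := (thetaMean (I : FractionalIdeal (𝓞 K)⁰ K) F t : ℂ)
  g t := (thetaMean (traceDual I : FractionalIdeal (𝓞 K)⁰ K) (Neg.neg ⁻¹' F) t : ℂ)
  k := (Module.finrank ℚ K : ℝ) / 2
  ε := (((FractionalIdeal.absNorm (I : FractionalIdeal (𝓞 K)⁰ K) : ℝ) * √|(discr K : ℝ)|)⁻¹ : ℝ)
  -- The term α = 0 of the theta series is 1, and its integral over F is the volume.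
  f₀ := (volume.real F : ℂ)
  g₀ := (volume.real (Neg.neg ⁻¹' F : Set (logSpace K)) : ℂ)
  hf_int := (Complex.continuous_ofReal.comp_continuousOn
    (continuousOn_thetaMean I hF)).locallyIntegrableOn measurableSet_Ioi
  hg_int := (Complex.continuous_ofReal.comp_continuousOn
    (continuousOn_thetaMean (traceDual I) hF.neg)).locallyIntegrableOn measurableSet_Ioi
  hk := by
    have : 0 < Module.finrank ℚ K := Module.finrank_pos
    positivity
  hε := by
    rw [Complex.ofReal_ne_zero]
    refine inv_ne_zero (mul_ne_zero ?_ ?_)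
    · exact_mod_cast fun h => I.ne_zero (FractionalIdeal.absNorm_eq_zero_iff.1 h)
    · have : (discr K : ℝ) ≠ 0 := by exact_mod_cast discr_ne_zero K
      positivity
  h_feq t ht := by
    rw [thetaMean_inv I ht]
    push_cast
    rw [smul_eq_mul]
  hf_top r := by
    have := thetaMean_sub_isBigO I hF r
    refine (isBigO_norm_left.1 ?_)
    refine (isBigO_norm_left.2 this).congr_left fun t => ?_
    rw [← Complex.ofReal_sub, Complex.norm_real]
  hg_top r := by
    have := thetaMean_sub_isBigO (traceDual I) hF.neg r
    refine (isBigO_norm_left.1 ?_)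
    refine (isBigO_norm_left.2 this).congr_left fun t => ?_
    rw [← Complex.ofReal_sub, Complex.norm_real]

end ThetaMean


/-! ### Mellin transforms in logarithmic coordinates and local integrals. -/

section MellinExp

open MeasureTheory

theorem mellinConvergent_iff_integrable_exp (f : ℝ → ℂ) (s : ℂ) :
    MellinConvergent f s ↔ Integrable fun τ : ℝ => Complex.exp (s * τ) * f (Real.exp τ) := by
  have h := integrableOn_image_iff_integrableOn_abs_deriv_smul MeasurableSet.univ
    (fun x _ => (Real.hasDerivAt_exp x).hasDerivWithinAt) Real.exp_injective.injOn
    (fun t : ℝ => (t : ℂ) ^ (s - 1) • f t)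
  rw [Set.image_univ, Real.range_exp, integrableOn_univ] at h
  rw [MellinConvergent, h]
  refine integrable_congr (Filter.Eventually.of_forall fun τ => ?_)
  simp only [abs_of_pos (Real.exp_pos τ), Complex.real_smul, smul_eq_mul]
  rw [← mul_assoc, Complex.ofReal_exp, Complex.cpow_def_of_ne_zero (Complex.exp_ne_zero _),
    ← Complex.ofReal_exp, ← Complex.ofReal_log (Real.exp_pos τ).le, Real.log_exp, Complex.ofReal_exp,
    ← Complex.exp_add]
  congr 2
  ring

/-- Substitution t = e^τ. The additive variable τ can then be combined linearly with the coordinates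
of logarithmic space. -/
theorem mellin_eq_integral_exp (f : ℝ → ℂ) (s : ℂ) :
    mellin f s = ∫ τ : ℝ, Complex.exp (s * τ) * f (Real.exp τ) := by
  have h := integral_image_eq_integral_abs_deriv_smul MeasurableSet.univ
    (fun x _ => (Real.hasDerivAt_exp x).hasDerivWithinAt) Real.exp_injective.injOn
    (fun t : ℝ => (t : ℂ) ^ (s - 1) • f t)
  rw [Set.image_univ, Real.range_exp, Measure.restrict_univ] at h
  rw [mellin, h]
  refine integral_congr_ae (Filter.Eventually.of_forall fun τ => ?_)
  simp only [abs_of_pos (Real.exp_pos τ), Complex.real_smul, smul_eq_mul]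
  rw [← mul_assoc, Complex.ofReal_exp, Complex.cpow_def_of_ne_zero (Complex.exp_ne_zero _),
    ← Complex.ofReal_exp, ← Complex.ofReal_log (Real.exp_pos τ).le, Real.log_exp, Complex.ofReal_exp,
    ← Complex.exp_add]
  congr 2
  ring

/-- The Gamma factor of a place of multiplicity `m`. -/
noncomputable def archFactor (m : ℕ) (s : ℂ) : ℂ :=
  ((Real.pi * m : ℝ) : ℂ) ^ (-(m * s / 2)) * Complex.Gamma (m * s / 2)

theorem archFactor_one (s : ℂ) : archFactor 1 s = Complex.Gammaℝ s := by
  rw [archFactor, Complex.Gammaℝ_def]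
  simp [neg_div]

theorem archFactor_two (s : ℂ) : archFactor 2 s = Complex.Gammaℂ s / 2 := by
  rw [archFactor, Complex.Gammaℂ_def]
  have : ((2 : ℕ) : ℂ) * s / 2 = s := by push_cast; ring
  rw [this]
  push_cast
  rw [mul_comm (Real.pi : ℂ) 2]
  ring

/-- The local kernel in logarithmic coordinates. -/
noncomputable def localKernel (m : ℕ) (s : ℂ) (a u : ℝ) : ℂ :=
  Complex.exp (m * s / 2 * u) * (Real.exp (-(Real.pi * (m * Real.exp u * a ^ 2))) : ℝ)

theorem integrable_localKernel {m : ℕ} (hm : 0 < m) {s : ℂ} (hs : 0 < s.re) {a : ℝ} (ha : 0 < a) :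
    Integrable (localKernel m s a) := by
  have hr : 0 < Real.pi * m * a ^ 2 := by positivity
  have hre : 0 < ((m : ℂ) * s / 2).re := by
    have : ((m : ℂ) * s / 2).re = m * s.re / 2 := by simp
    rw [this]; positivity
  have h := (mellinConvergent_iff_integrable_exp
    (fun t => Complex.exp (-((Real.pi * m * a ^ 2 : ℝ) * t))) ((m : ℂ) * s / 2)).1 ?_
  · refine h.congr (Filter.Eventually.of_forall fun u => ?_)
    simp only [localKernel, Complex.ofReal_exp]
    congr 2
    push_cast
    ring
  · have h1 : MellinConvergent (fun t : ℝ => Complex.exp (-t)) ((m : ℂ) * s / 2) := by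
      refine (Complex.GammaIntegral_convergent hre).congr_fun (fun x _ => ?_) measurableSet_Ioi
      simp only [smul_eq_mul, Complex.ofReal_exp]
      rw [mul_comm]
      push_cast
      rfl
    have h2 := (MellinConvergent.comp_mul_left hr).2 h1
    simpa using h2

/-- With t = e^u this is the Mellin transform of exp(-πm a² t) at ms/2, a Gamma integral; the scale
a² raised to -ms/2 becomes a^(-ms). -/
theorem integral_localKernel {m : ℕ} (hm : 0 < m) {s : ℂ} (hs : 0 < s.re) {a : ℝ} (ha : 0 < a) :
    ∫ u, localKernel m s a u = archFactor m s * (a : ℂ) ^ (-(m * s)) := by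
  have hr : 0 < Real.pi * m * a ^ 2 := by positivity
  have hre : 0 < ((m : ℂ) * s / 2).re := by
    have : ((m : ℂ) * s / 2).re = m * s.re / 2 := by simp
    rw [this]; positivity
  have h := mellin_eq_integral_exp
    (fun t => Complex.exp (-((Real.pi * m * a ^ 2 : ℝ) * t))) ((m : ℂ) * s / 2)
  have h1 := Complex.integral_cpow_mul_exp_neg_mul_Ioi hre hr
  rw [mellin] at h
  simp only [smul_eq_mul] at h
  rw [h1] at h
  have h2 : ∫ u, localKernel m s a u = ∫ τ : ℝ, Complex.exp ((m : ℂ) * s / 2 * τ) *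
      Complex.exp (-((Real.pi * m * a ^ 2 : ℝ) * (Real.exp τ : ℝ))) := by
    refine integral_congr_ae (Filter.Eventually.of_forall fun u => ?_)
    simp only [localKernel]
    rw [Complex.ofReal_exp]
    congr 2
    push_cast
    ring
  rw [h2, ← h, archFactor, one_div, Complex.inv_cpow _ _ (by
    rw [Complex.arg_ofReal_of_nonneg hr.le]; exact Real.pi_pos.ne), ← Complex.cpow_neg,
    Complex.ofReal_mul, Complex.mul_cpow_ofReal_nonneg (by positivity) (by positivity)]
  have : ((a ^ 2 : ℝ) : ℂ) ^ (-((m : ℂ) * s / 2)) = (a : ℂ) ^ (-(m * s)) := by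
    rw [Complex.cpow_def_of_ne_zero (by exact_mod_cast (pow_pos ha 2).ne'),
      Complex.cpow_def_of_ne_zero (by exact_mod_cast ha.ne'), ← Complex.ofReal_log (by positivity),
      Real.log_pow, ← Complex.ofReal_log ha.le]
    congr 1
    push_cast
    ring
  rw [this]
  ring

theorem integrable_tsum_of_summable_integral_norm {α ι : Type*} [MeasurableSpace α] {μ : Measure α}
    [Countable ι] {F : ι → α → ℂ} (hF : ∀ i, Integrable (F i) μ)
    (h : Summable fun i => ∫ a, ‖F i a‖ ∂μ) : Integrable (fun a => ∑' i, F i a) μ := by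
  refine ⟨AEStronglyMeasurable.tsum fun i => (hF i).1, ?_⟩
  have h1 : ∫⁻ a, ‖∑' i, F i a‖ₑ ∂μ ≤ ∫⁻ a, ∑' i, ‖F i a‖ₑ ∂μ :=
    lintegral_mono fun a => enorm_tsum_le_tsum_enorm
  refine h1.trans_lt ?_
  rw [lintegral_tsum fun i => (hF i).1.enorm]
  have : ∀ i, ∫⁻ a, ‖F i a‖ₑ ∂μ = ENNReal.ofReal (∫ a, ‖F i a‖ ∂μ) := fun i =>
    (ofReal_integral_norm_eq_lintegral_enorm (hF i)).symm
  simp_rw [this]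
  exact (h.tsum_ofReal_ne_top).lt_top

end MellinExp


/-! ### Passage from (τ, x) to independent coordinates at the places. -/

section LogPlace

open scoped Classical
open NumberField NumberField.InfinitePlace NumberField.Units NumberField.Units.dirichletUnitTheorem
  MeasureTheory

variable {K : Type*} [Field K] [NumberField K]

variable (K) in
/-- The linear coordinates `(τ, x) ↦ (τ + logScale x w)_w` on the logarithmic space of all places. -/
noncomputable def logPlaceLin : (ℝ × logSpace K) →ₗ[ℝ] (InfinitePlace K → ℝ) where
  toFun p w := p.1 + logScale p.2 w
  map_add' p q := by
    funext w
    simp only [Prod.fst_add, Prod.snd_add, map_add, Pi.add_apply]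
    ring
  map_smul' c p := by
    funext w
    simp only [Prod.smul_fst, Prod.smul_snd, map_smul, Pi.smul_apply, smul_eq_mul, RingHom.id_apply]
    ring

theorem sum_mult_mul_logPlaceLin (p : ℝ × logSpace K) :
    ∑ w, (mult w : ℝ) * logPlaceLin K p w = Module.finrank ℚ K * p.1 := by
  have h : ∀ w : InfinitePlace K, (mult w : ℝ) * logPlaceLin K p w =
      mult w * p.1 + mult w * logScale p.2 w := fun w => mul_add _ _ _
  simp_rw [h]
  rw [Finset.sum_add_distrib, sum_mult_mul_logScale, ← Finset.sum_mul, add_zero, ← sum_mult_eq]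
  push_cast
  rfl

/-- The weighted sum of the coordinates is n·τ, which recovers τ; then `logScale` is injective. -/
theorem logPlaceLin_injective : Function.Injective (logPlaceLin K) := by
  rw [← LinearMap.ker_eq_bot, LinearMap.ker_eq_bot']
  intro p hp
  have h1 := sum_mult_mul_logPlaceLin p
  rw [hp] at h1
  have hn : (Module.finrank ℚ K : ℝ) ≠ 0 := by exact_mod_cast Module.finrank_pos.ne'
  have h2 : p.1 = 0 := by simpa [hn] using h1.symm
  have h3 : logScale p.2 = 0 := by
    funext w
    have : p.1 + logScale p.2 w = 0 := congrFun hp w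
    rwa [h2, zero_add] at this
  exact Prod.ext h2 (logScale_injective (h3.trans (map_zero _).symm))

variable (K) in
/-- `logPlaceLin` as an equivalence. -/
noncomputable def logPlaceEquiv : (ℝ × logSpace K) ≃L[ℝ] (InfinitePlace K → ℝ) :=
  (LinearEquiv.ofInjectiveOfFinrankEq (logPlaceLin K) logPlaceLin_injective (by
    rw [Module.finrank_prod, Module.finrank_self, Module.finrank_fintype_fun_eq_card,
      Module.finrank_fintype_fun_eq_card, Fintype.card_subtype_compl, Fintype.card_subtype_eq,
      add_comm]
    exact Nat.sub_add_cancel Fintype.card_pos)).toContinuousLinearEquiv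

theorem logPlaceEquiv_apply (p : ℝ × logSpace K) (w : InfinitePlace K) :
    logPlaceEquiv K p w = p.1 + logScale p.2 w := rfl

instance isAddHaarMeasure_volume_logSpace :
    (volume : Measure (logSpace K)).IsAddHaarMeasure :=
  inferInstanceAs (volume : Measure ({w : InfinitePlace K // w ≠ w₀} → ℝ)).IsAddHaarMeasure

instance isAddHaarMeasure_volume_prod_logSpace :
    (volume : Measure (ℝ × logSpace K)).IsAddHaarMeasure := by
  rw [Measure.volume_eq_prod]
  infer_instance

-- Uniqueness of Haar measure. The value of the Jacobian is immaterial, as the constant is divided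
-- out of the completed zeta function; only its non-vanishing counts.
variable (K) in
theorem exists_map_logPlaceEquiv : ∃ c : NNReal, c ≠ 0 ∧
    (volume : Measure (ℝ × logSpace K)).map (logPlaceEquiv K) = c • volume := by
  have : ((volume : Measure (ℝ × logSpace K)).map (logPlaceEquiv K)).IsAddHaarMeasure :=
    (logPlaceEquiv K).isAddHaarMeasure_map _
  refine ⟨_, ?_, Measure.isAddLeftInvariant_eq_smul _ _⟩
  exact (Measure.addHaarScalarFactor_pos_of_isAddHaarMeasure _ _).ne'

variable (K) in
/-- The Jacobian of `logPlaceEquiv`. -/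
noncomputable def logPlaceConst : ℝ := (exists_map_logPlaceEquiv K).choose

theorem logPlaceConst_ne_zero : logPlaceConst K ≠ 0 :=
  NNReal.coe_ne_zero.2 (exists_map_logPlaceEquiv K).choose_spec.1

theorem integral_comp_logPlaceEquiv {E : Type*} [NormedAddCommGroup E] [NormedSpace ℝ E]
    (g : (InfinitePlace K → ℝ) → E) :
    ∫ p, g (logPlaceEquiv K p) = logPlaceConst K • ∫ y, g y := by
  have h := (exists_map_logPlaceEquiv K).choose_spec.2
  have hm : MeasurableEmbedding (logPlaceEquiv K) :=
    (logPlaceEquiv K).toHomeomorph.measurableEmbedding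
  rw [← hm.integral_map, h, integral_smul_nnreal_measure]
  rfl

theorem integrable_comp_logPlaceEquiv {E : Type*} [NormedAddCommGroup E]
    {g : (InfinitePlace K → ℝ) → E} (hg : Integrable g) :
    Integrable fun p => g (logPlaceEquiv K p) := by
  have h := (exists_map_logPlaceEquiv K).choose_spec.2
  have hm : MeasurableEmbedding (logPlaceEquiv K) :=
    (logPlaceEquiv K).toHomeomorph.measurableEmbedding
  refine hm.integrable_map_iff.1 ?_
  rw [h]
  exact hg.smul_measure_nnreal

/-- The kernel in logarithmic coordinates attached to `α`. -/
noncomputable def placeKernel (s : ℂ) (α : K) (y : InfinitePlace K → ℝ) : ℂ :=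
  ∏ w, localKernel (mult w) s (w α) (y w)

variable (K) in
/-- The product of the archimedean Gamma factors. -/
noncomputable def archProd (s : ℂ) : ℂ := ∏ w : InfinitePlace K, archFactor (mult w) s

theorem integrable_placeKernel {s : ℂ} (hs : 0 < s.re) {α : K} (hα : α ≠ 0) :
    Integrable (placeKernel s α) :=
  Integrable.fintype_prod fun _ => integrable_localKernel mult_pos hs (pos_iff.2 hα)

/-- Fubini splits the integral into local Gamma integrals, and the powers of w(α) multiply to the
norm of α. -/
theorem integral_placeKernel {s : ℂ} (hs : 0 < s.re) {α : K} (hα : α ≠ 0) :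
    ∫ y, placeKernel s α y = archProd K s * ((|Algebra.norm ℚ α| : ℚ) : ℂ) ^ (-s) := by
  unfold placeKernel
  rw [integral_fintype_prod_volume_eq_prod, archProd]
  simp_rw [fun w : InfinitePlace K => integral_localKernel (m := mult w) mult_pos hs
    (pos_iff.2 hα : 0 < w α)]
  rw [Finset.prod_mul_distrib]
  congr 1
  have h : ((|Algebra.norm ℚ α| : ℚ) : ℂ) = ((∏ w : InfinitePlace K, w α ^ mult w : ℝ) : ℂ) := by
    rw [prod_eq_abs_norm, Complex.ofReal_ratCast]
  rw [h, Complex.ofReal_prod]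
  have h2 : ∀ w : InfinitePlace K, ((w α : ℝ) : ℂ) ^ (-(mult w * s)) =
      Complex.exp (-s * Real.log (w α ^ mult w)) := fun w => by
    rw [Complex.cpow_def_of_ne_zero (by exact_mod_cast (pos_iff.2 hα : 0 < w α).ne'),
      ← Complex.ofReal_log (pos_iff.2 hα : 0 < w α).le, Real.log_pow]
    congr 1
    push_cast
    ring
  have hprod : 0 < ∏ w : InfinitePlace K, w α ^ mult w :=
    Finset.prod_pos fun w _ => pow_pos (pos_iff.2 hα : 0 < w α) _
  simp_rw [h2]
  rw [← Complex.exp_sum, ← Finset.mul_sum, ← Complex.ofReal_prod,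
    Complex.cpow_def_of_ne_zero (by
      rw [Complex.ofReal_ne_zero]
      exact hprod.ne'),
    ← Complex.ofReal_log hprod.le,
    Real.log_prod (f := fun w : InfinitePlace K => w α ^ mult w) fun w _ =>
      (pow_pos (pos_iff.2 hα : 0 < w α) _).ne']
  push_cast
  rw [mul_comm]

theorem placeKernel_logPlaceEquiv (s : ℂ) (α : K) (p : ℝ × logSpace K) :
    placeKernel s α (logPlaceEquiv K p) = Complex.exp (Module.finrank ℚ K * s / 2 * p.1) *
      (Real.exp (-(Real.pi * placeForm (fun w => Real.exp p.1 * Real.exp (logScale p.2 w)) α)) : ℝ)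
      := by
  unfold placeKernel localKernel
  rw [Finset.prod_mul_distrib, ← Complex.exp_sum, ← Complex.ofReal_prod, ← Real.exp_sum]
  congr 2
  · have h := sum_mult_mul_logPlaceLin p
    have h2 : ∑ w : InfinitePlace K, (mult w : ℂ) * s / 2 * (logPlaceEquiv K p w : ℝ) =
        s / 2 * ((∑ w, (mult w : ℝ) * logPlaceLin K p w : ℝ) : ℂ) := by
      push_cast
      rw [Finset.mul_sum]
      refine Finset.sum_congr rfl fun w _ => ?_
      have : logPlaceEquiv K p w = logPlaceLin K p w := rfl
      rw [this]
      ring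
    rw [h2, h]
    push_cast
    ring
  · rw [Finset.sum_neg_distrib, ← Finset.mul_sum, placeForm]
    simp_rw [logPlaceEquiv_apply, Real.exp_add]

/-- Since exp of `logScale` at the logarithm of u is w(u)², a unit can be traded for a translation;
this permits unfolding. The exponential factor involves τ only and is unaffected. -/
theorem placeKernel_unit_mul (s : ℂ) (u : (𝓞 K)ˣ) (α : K) (p : ℝ × logSpace K) :
    placeKernel s ((u : K) * α) (logPlaceEquiv K p) =
      placeKernel s α (logPlaceEquiv K (p + (0, logEmbedding K (Additive.ofMul u)))) := by
  rw [placeKernel_logPlaceEquiv, placeKernel_logPlaceEquiv]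
  simp only [Prod.fst_add, add_zero, Prod.snd_add]
  congr 4
  unfold placeForm
  congr 1
  refine Finset.sum_congr rfl fun w _ => ?_
  have hw : 0 < w (u : K) := pos_iff.2 (by exact_mod_cast coe_ne_zero u)
  beta_reduce
  rw [map_mul, map_add, Pi.add_apply, Real.exp_add, logScale_logEmbedding, mul_comm 2,
    Real.exp_mul, Real.exp_log hw]
  norm_cast
  ring

/-- The modulus of the kernel is the kernel at the real part of s, so the L¹ norms come from the
same integral formula. -/
theorem norm_placeKernel (s : ℂ) (α : K) (y : InfinitePlace K → ℝ) :
    ((‖placeKernel s α y‖ : ℝ) : ℂ) = placeKernel (s.re : ℂ) α y := by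
  unfold placeKernel
  rw [norm_prod, Complex.ofReal_prod]
  refine Finset.prod_congr rfl fun w _ => ?_
  unfold localKernel
  rw [norm_mul, Complex.norm_real, Real.norm_of_nonneg (Real.exp_pos _).le, Complex.norm_exp,
    Complex.ofReal_mul, Complex.ofReal_exp]
  congr 2
  simp

theorem integral_norm_placeKernel {s : ℂ} (hs : 0 < s.re) {α : K} (hα : α ≠ 0) :
    ∫ y, ‖placeKernel s α y‖ =
      ‖archProd K s.re‖ * ((|Algebra.norm ℚ α| : ℚ) : ℝ) ^ (-s.re) := by
  have h : ((∫ y, ‖placeKernel s α y‖ : ℝ) : ℂ) =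
      archProd K s.re * ((|Algebra.norm ℚ α| : ℚ) : ℂ) ^ (-(s.re : ℂ)) := by
    rw [← integral_complex_ofReal, ← integral_placeKernel (by simpa using hs) hα]
    simp_rw [norm_placeKernel]
  have h2 := congrArg norm h
  have h3 : 0 ≤ ∫ y, ‖placeKernel s α y‖ := integral_nonneg fun _ => norm_nonneg _
  rw [Complex.norm_real, Real.norm_of_nonneg h3, norm_mul] at h2
  rw [h2]
  congr 1
  have h4 : (0 : ℝ) < ((|Algebra.norm ℚ α| : ℚ) : ℝ) := by
    have : 0 < |Algebra.norm ℚ α| := abs_pos.2 (Algebra.norm_ne_zero_iff.2 hα)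
    exact_mod_cast this
  rw [← Complex.ofReal_ratCast, Complex.norm_cpow_eq_rpow_re_of_pos h4]
  simp

instance countable_unitLattice : Countable (unitLattice K) :=
  (basisUnitLattice K).equivFun.toEquiv.countable_iff.2 inferInstance

/-- Unfolding an integral over the translates of a fundamental domain. -/
theorem IsUnitDomain.hasSum_setIntegral {E : Type*} [NormedAddCommGroup E] [NormedSpace ℝ E]
    {F : Set (logSpace K)} (hF : IsUnitDomain F) {g : ℝ × logSpace K → E} (hg : Integrable g) :
    HasSum (fun l : unitLattice K => ∫ p in Set.univ ×ˢ F, g (p + (0, (l : logSpace K))))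
      (∫ p, g p) := by
  let S : unitLattice K → Set (ℝ × logSpace K) := fun l =>
    (fun p : ℝ × logSpace K => p + (0, -(l : logSpace K))) ⁻¹' (Set.univ ×ˢ F)
  have hS : ∀ l, MeasurableSet (S l) := fun l =>
    (measurable_add_const _) (MeasurableSet.univ.prod hF.measurableSet)
  have hmem : ∀ l p, p ∈ S l ↔ ((-l : unitLattice K) : logSpace K) + p.2 ∈ F := fun l p => by
    simp [S, add_comm]
  have hd : Pairwise (Function.onFun Disjoint S) := by
    intro l m hlm
    refine Set.disjoint_left.2 fun p hl hm => hlm ?_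
    rw [hmem] at hl hm
    exact neg_injective ((hF.existsUnique p.2).unique hl hm)
  have hU : ⋃ l, S l = Set.univ := by
    refine Set.eq_univ_of_forall fun p => ?_
    obtain ⟨l, hl, -⟩ := hF.existsUnique p.2
    refine Set.mem_iUnion.2 ⟨-l, ?_⟩
    rw [hmem, neg_neg]
    exact hl
  have h := hasSum_integral_iUnion hS hd (f := g) (μ := volume) (by rw [hU]; exact hg.integrableOn)
  rw [hU, Measure.restrict_univ] at h
  refine h.congr_fun fun l => ?_
  have hm := (measurePreserving_add_right (volume : Measure (ℝ × logSpace K))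
    ((0 : ℝ), (l : logSpace K))).setIntegral_preimage_emb
    (measurableEmbedding_addRight _) g (S l)
  rw [← hm]
  congr 2
  ext p
  simp [S, add_assoc]

end LogPlace


/-! ### Unfolding the theta mean into a partial zeta function. -/

section Unfold

open scoped Classical
open NumberField NumberField.InfinitePlace NumberField.Units NumberField.Units.dirichletUnitTheorem
  MeasureTheory nonZeroDivisors

variable {K : Type*} [Field K] [NumberField K]

noncomputable instance fintypeTorsion : Fintype (torsion K) := Fintype.ofFinite _

/-- The non-zero integral ideals `a` for which `a * I` is principal. -/
def principalTwists (I : (FractionalIdeal (𝓞 K)⁰ K)ˣ) : Set (Ideal (𝓞 K))⁰ :=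
  {a | ∃ α : K, α ≠ 0 ∧ FractionalIdeal.spanSingleton (𝓞 K)⁰ α =
    ((a : Ideal (𝓞 K)) : FractionalIdeal (𝓞 K)⁰ K) * I}

/-- A generator of `a * I`. -/
noncomputable def twistGen {I : (FractionalIdeal (𝓞 K)⁰ K)ˣ} (a : principalTwists I) : K :=
  a.2.choose

theorem twistGen_ne_zero {I : (FractionalIdeal (𝓞 K)⁰ K)ˣ} (a : principalTwists I) :
    twistGen a ≠ 0 := a.2.choose_spec.1

theorem spanSingleton_twistGen {I : (FractionalIdeal (𝓞 K)⁰ K)ˣ} (a : principalTwists I) :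
    FractionalIdeal.spanSingleton (𝓞 K)⁰ (twistGen a) =
      (((a : (Ideal (𝓞 K))⁰) : Ideal (𝓞 K)) : FractionalIdeal (𝓞 K)⁰ K) * I := a.2.choose_spec.2

theorem abs_norm_twistGen {I : (FractionalIdeal (𝓞 K)⁰ K)ˣ} (a : principalTwists I) :
    |Algebra.norm ℚ (twistGen a)| = (Ideal.absNorm ((a : (Ideal (𝓞 K))⁰) : Ideal (𝓞 K)) : ℚ) *
      FractionalIdeal.absNorm (I : FractionalIdeal (𝓞 K)⁰ K) := by
  have h := congrArg FractionalIdeal.absNorm (spanSingleton_twistGen a)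
  rw [map_mul, FractionalIdeal.coeIdeal_absNorm] at h
  rw [← h, FractionalIdeal.absNorm_span_singleton]

/-- A unit with prescribed logarithms. -/
noncomputable def unitSection (l : unitLattice K) : (𝓞 K)ˣ :=
  Additive.toMul (Submodule.mem_map.1 l.2).choose

theorem logEmbedding_unitSection (l : unitLattice K) :
    logEmbedding K (Additive.ofMul (unitSection l)) = l :=
  (Submodule.mem_map.1 l.2).choose_spec.2

theorem logEmbedding_mem_unitLattice (u : (𝓞 K)ˣ) :
    logEmbedding K (Additive.ofMul u) ∈ unitLattice K :=
  Submodule.mem_map.2 ⟨_, Submodule.mem_top, rfl⟩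

theorem logEmbedding_torsion_mul (ζ : torsion K) (u : (𝓞 K)ˣ) :
    logEmbedding K (Additive.ofMul ((ζ : (𝓞 K)ˣ) * u)) = logEmbedding K (Additive.ofMul u) := by
  rw [ofMul_mul, map_add, logEmbedding_eq_zero_iff.2 ζ.2, zero_add]

/-- The parametrization of the non-zero elements of `I` by roots of unity, ideals and the lattice of
units. -/
noncomputable def twistElement (I : (FractionalIdeal (𝓞 K)⁰ K)ˣ)
    (q : torsion K × (principalTwists I × unitLattice K)) : K :=
  (((q.1 : (𝓞 K)ˣ) * unitSection q.2.2 : (𝓞 K)ˣ) : K) * twistGen q.2.1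

theorem spanSingleton_unit_mul (u : (𝓞 K)ˣ) (α : K) :
    FractionalIdeal.spanSingleton (𝓞 K)⁰ ((u : K) * α) = FractionalIdeal.spanSingleton (𝓞 K)⁰ α := by
  symm
  rw [FractionalIdeal.spanSingleton_eq_spanSingleton]
  exact ⟨u, by rw [Units.smul_def, Algebra.smul_def]⟩

theorem twistElement_mem (I : (FractionalIdeal (𝓞 K)⁰ K)ˣ)
    (q : torsion K × (principalTwists I × unitLattice K)) :
    twistElement I q ∈ (I : FractionalIdeal (𝓞 K)⁰ K) ∧ twistElement I q ≠ 0 := by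
  refine ⟨?_, mul_ne_zero (coe_ne_zero _) (twistGen_ne_zero _)⟩
  rw [← FractionalIdeal.spanSingleton_le_iff_mem, twistElement, spanSingleton_unit_mul,
    spanSingleton_twistGen]
  calc _ ≤ 1 * (I : FractionalIdeal (𝓞 K)⁰ K) := by
        gcongr
        exact FractionalIdeal.coeIdeal_le_one
    _ = _ := one_mul _

/-- A non-zero α in I determines the integral ideal a = αI⁻¹. Generators of aI differ by units, and
a unit is a root of unity times the chosen unit with the same logarithms. -/
theorem twistElement_bijective (I : (FractionalIdeal (𝓞 K)⁰ K)ˣ) :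
    Function.Bijective fun q : torsion K × (principalTwists I × unitLattice K) =>
      (⟨twistElement I q, twistElement_mem I q⟩ :
        {α : K // α ∈ (I : FractionalIdeal (𝓞 K)⁰ K) ∧ α ≠ 0}) := by
  constructor
  · rintro ⟨ζ, a, l⟩ ⟨ζ', a', l'⟩ h
    have h0 : twistElement I (ζ, a, l) = twistElement I (ζ', a', l') := congrArg Subtype.val h
    have h1 := congrArg (FractionalIdeal.spanSingleton (𝓞 K)⁰) h0
    rw [twistElement, twistElement, spanSingleton_unit_mul, spanSingleton_unit_mul,
      spanSingleton_twistGen, spanSingleton_twistGen, Units.mul_left_inj,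
      FractionalIdeal.coeIdeal_inj] at h1
    obtain rfl : a = a' := Subtype.ext (Subtype.ext h1)
    rw [twistElement, twistElement, mul_left_inj' (twistGen_ne_zero _)] at h0
    have h2 : (ζ : (𝓞 K)ˣ) * unitSection l = ζ' * unitSection l' := Units.ext (RingOfIntegers.ext h0)
    have h3 := congrArg (fun u : (𝓞 K)ˣ => logEmbedding K (Additive.ofMul u)) h2
    simp only [logEmbedding_torsion_mul, logEmbedding_unitSection] at h3
    obtain rfl : l = l' := Subtype.ext h3
    rw [mul_left_inj] at h2
    obtain rfl : ζ = ζ' := Subtype.ext h2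
    rfl
  · rintro ⟨α, hα, h0⟩
    have h1 : FractionalIdeal.spanSingleton (𝓞 K)⁰ α * (I⁻¹ : (FractionalIdeal (𝓞 K)⁰ K)ˣ) ≤ 1 := by
      calc _ ≤ (I : FractionalIdeal (𝓞 K)⁰ K) * (I⁻¹ : (FractionalIdeal (𝓞 K)⁰ K)ˣ) := by
            gcongr
            exact FractionalIdeal.spanSingleton_le_iff_mem.2 hα
        _ = 1 := Units.mul_inv I
    obtain ⟨a, ha⟩ := FractionalIdeal.le_one_iff_exists_coeIdeal.1 h1
    have h2 : FractionalIdeal.spanSingleton (𝓞 K)⁰ α = (a : FractionalIdeal (𝓞 K)⁰ K) * I := by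
      rw [ha, mul_assoc, Units.inv_mul, mul_one]
    have ha0 : a ∈ (Ideal (𝓞 K))⁰ := by
      rw [mem_nonZeroDivisors_iff_ne_zero]
      rintro rfl
      rw [Submodule.zero_eq_bot, FractionalIdeal.coeIdeal_bot, zero_mul,
        FractionalIdeal.spanSingleton_eq_zero_iff] at h2
      exact h0 h2
    let a' : principalTwists I := ⟨⟨a, ha0⟩, α, h0, h2⟩
    have h3 : FractionalIdeal.spanSingleton (𝓞 K)⁰ (twistGen a') =
        FractionalIdeal.spanSingleton (𝓞 K)⁰ α := by
      rw [spanSingleton_twistGen, h2]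
    obtain ⟨u, hu⟩ := FractionalIdeal.spanSingleton_eq_spanSingleton.1 h3
    let l : unitLattice K := ⟨_, logEmbedding_mem_unitLattice u⟩
    have hζ : u * (unitSection l)⁻¹ ∈ torsion K := by
      rw [← logEmbedding_eq_zero_iff, ofMul_mul, map_add, ofMul_inv, map_neg,
        logEmbedding_unitSection]
      exact add_neg_cancel _
    refine ⟨(⟨_, hζ⟩, a', l), Subtype.ext ?_⟩
    rw [Units.smul_def, Algebra.smul_def] at hu
    simp only [twistElement]
    rw [inv_mul_cancel_right]
    exact hu

theorem countable_nonzero_elements (I : (FractionalIdeal (𝓞 K)⁰ K)ˣ) :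
    Countable {α : K // α ∈ (I : FractionalIdeal (𝓞 K)⁰ K) ∧ α ≠ 0} := by
  obtain ⟨f, -⟩ := exists_equiv_of_span (I : FractionalIdeal (𝓞 K)⁰ K) (basisOfFractionalIdeal K I)
    fun x => (mem_span_basisOfFractionalIdeal K).symm
  have : Countable {α : K // α ∈ (I : FractionalIdeal (𝓞 K)⁰ K)} := f.symm.countable_iff.2 inferInstance
  let g : {α : K // α ∈ (I : FractionalIdeal (𝓞 K)⁰ K) ∧ α ≠ 0} →
    {α : K // α ∈ (I : FractionalIdeal (𝓞 K)⁰ K)} := fun α => ⟨α.1, α.2.1⟩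
  have hg : Function.Injective g := fun a b h =>
    Subtype.ext (congrArg (fun x : {α : K // α ∈ (I : FractionalIdeal (𝓞 K)⁰ K)} => x.1) h)
  exact hg.countable

theorem hasSum_prod_snd {T X : Type*} [Fintype T] {f : X → ℂ} {S : ℂ} (hf : HasSum f S) :
    HasSum (fun p : T × X => f p.2) (Fintype.card T * S) := by
  have h1 : HasSum (fun _ : T => (1 : ℂ)) (Fintype.card T) := by
    have := hasSum_fintype fun _ : T => (1 : ℂ)
    rw [Finset.sum_const, Finset.card_univ, nsmul_eq_mul, mul_one] at this
    exact this
  have hT : Summable fun _ : T => ‖(1 : ℂ)‖ := summable_norm_iff.2 h1.summable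
  have hX : Summable fun x : X => ‖f x‖ := summable_norm_iff.2 hf.summable
  have hs : Summable fun x : T × X => (1 : ℂ) * f x.2 := by
    have := summable_mul_of_summable_norm hT hX
    exact this
  have h2 := h1.mul hf hs
  simp only [one_mul] at h2
  exact h2

/-- The partial zeta function of the ideals `a` with `a * I` principal. -/
noncomputable def partialZeta (I : (FractionalIdeal (𝓞 K)⁰ K)ˣ) (s : ℂ) : ℂ :=
  ∑' a : principalTwists I,
    (Ideal.absNorm ((a : (Ideal (𝓞 K))⁰) : Ideal (𝓞 K)) : ℂ) ^ (-s)

theorem summable_partialZeta (I : (FractionalIdeal (𝓞 K)⁰ K)ˣ) {s : ℂ} (hs : 1 < s.re) :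
    Summable fun a : principalTwists I =>
      (Ideal.absNorm ((a : (Ideal (𝓞 K))⁰) : Ideal (𝓞 K)) : ℂ) ^ (-s) :=
  (hasSum_dedekindZeta K hs).summable.subtype _

theorem cpow_abs_norm_twistGen {I : (FractionalIdeal (𝓞 K)⁰ K)ˣ} (a : principalTwists I) (s : ℂ) :
    ((|Algebra.norm ℚ (twistGen a)| : ℚ) : ℂ) ^ (-s) =
      (FractionalIdeal.absNorm (I : FractionalIdeal (𝓞 K)⁰ K) : ℂ) ^ (-s) *
        (Ideal.absNorm ((a : (Ideal (𝓞 K))⁰) : Ideal (𝓞 K)) : ℂ) ^ (-s) := by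
  rw [abs_norm_twistGen]
  have h := Complex.mul_cpow_ofReal_nonneg
    (a := ((FractionalIdeal.absNorm (I : FractionalIdeal (𝓞 K)⁰ K) : ℚ) : ℝ))
    (b := (Ideal.absNorm ((a : (Ideal (𝓞 K))⁰) : Ideal (𝓞 K)) : ℝ))
    (by exact_mod_cast FractionalIdeal.absNorm_nonneg _) (Nat.cast_nonneg _) (-s)
  push_cast at h ⊢
  rw [← h, mul_comm]

theorem setIntegral_placeKernel_twistElement {E : Type*} [NormedAddCommGroup E] [NormedSpace ℝ E]
    (φ : ℂ → E) (I : (FractionalIdeal (𝓞 K)⁰ K)ˣ) (F : Set (logSpace K)) (s : ℂ)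
    (q : torsion K × (principalTwists I × unitLattice K)) :
    ∫ p in Set.univ ×ˢ F, φ (placeKernel s (twistElement I q) (logPlaceEquiv K p)) =
      ∫ p in Set.univ ×ˢ F, φ (placeKernel s (twistGen q.2.1)
        (logPlaceEquiv K (p + (0, (q.2.2 : logSpace K))))) := by
  simp_rw [twistElement, placeKernel_unit_mul, logEmbedding_torsion_mul, logEmbedding_unitSection]

/-- For a fixed ideal, the sum over the unit lattice fills the whole space and gives a constant
times the norm to the power -Re s; the remaining sum over ideals converges. This justifies the later
interchange of sum and integral. -/
theorem summable_integral_norm_twist (I : (FractionalIdeal (𝓞 K)⁰ K)ˣ) {F : Set (logSpace K)}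
    (hF : IsUnitDomain F) {s : ℂ} (hs : 1 < s.re) :
    Summable fun q : principalTwists I × unitLattice K => ∫ p in Set.univ ×ˢ F,
      ‖placeKernel s (twistGen q.1) (logPlaceEquiv K (p + (0, (q.2 : logSpace K))))‖ := by
  have hs0 : 0 < s.re := by linarith
  have key : ∀ a : principalTwists I, HasSum (fun l : unitLattice K => ∫ p in Set.univ ×ˢ F,
      ‖placeKernel s (twistGen a) (logPlaceEquiv K (p + (0, (l : logSpace K))))‖)
      (logPlaceConst K • (‖archProd K s.re‖ *
        ((|Algebra.norm ℚ (twistGen a)| : ℚ) : ℝ) ^ (-s.re))) := fun a => by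
    rw [← integral_norm_placeKernel hs0 (twistGen_ne_zero a), ← integral_comp_logPlaceEquiv]
    exact hF.hasSum_setIntegral (g := fun p => ‖placeKernel s (twistGen a) (logPlaceEquiv K p)‖)
      (integrable_comp_logPlaceEquiv (integrable_placeKernel hs0 (twistGen_ne_zero a)).norm)
  refine (summable_prod_of_nonneg fun q => ?_).2 ⟨fun a => (key a).summable, ?_⟩
  · exact integral_nonneg fun _ => norm_nonneg _
  · simp_rw [fun a => (key a).tsum_eq]
    refine Summable.const_smul _ (Summable.mul_left _ ?_)
    have h := ((summable_partialZeta I (s := (s.re : ℂ)) (by simpa using hs)).mul_left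
      ((FractionalIdeal.absNorm (I : FractionalIdeal (𝓞 K)⁰ K) : ℂ) ^ (-(s.re : ℂ)))).norm
    refine h.congr fun a => ?_
    rw [← cpow_abs_norm_twistGen]
    have h4 : (0 : ℝ) < ((|Algebra.norm ℚ (twistGen a)| : ℚ) : ℝ) := by
      have : 0 < |Algebra.norm ℚ (twistGen a)| :=
        abs_pos.2 (Algebra.norm_ne_zero_iff.2 (twistGen_ne_zero a))
      exact_mod_cast this
    rw [← Complex.ofReal_ratCast, Complex.norm_cpow_eq_rpow_re_of_pos h4]
    simp

theorem hasSum_integral_twist (I : (FractionalIdeal (𝓞 K)⁰ K)ˣ) {F : Set (logSpace K)}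
    (hF : IsUnitDomain F) {s : ℂ} (hs : 1 < s.re) :
    HasSum (fun q : principalTwists I × unitLattice K => ∫ p in Set.univ ×ˢ F,
      placeKernel s (twistGen q.1) (logPlaceEquiv K (p + (0, (q.2 : logSpace K)))))
      (logPlaceConst K * archProd K s *
        (FractionalIdeal.absNorm (I : FractionalIdeal (𝓞 K)⁰ K) : ℂ) ^ (-s) * partialZeta I s) := by
  have hs0 : 0 < s.re := by linarith
  have key : ∀ a : principalTwists I, HasSum (fun l : unitLattice K => ∫ p in Set.univ ×ˢ F,
      placeKernel s (twistGen a) (logPlaceEquiv K (p + (0, (l : logSpace K)))))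
      (logPlaceConst K • (archProd K s *
        ((|Algebra.norm ℚ (twistGen a)| : ℚ) : ℂ) ^ (-s))) := fun a => by
    rw [← integral_placeKernel hs0 (twistGen_ne_zero a), ← integral_comp_logPlaceEquiv]
    exact hF.hasSum_setIntegral (g := fun p => placeKernel s (twistGen a) (logPlaceEquiv K p))
      (integrable_comp_logPlaceEquiv (integrable_placeKernel hs0 (twistGen_ne_zero a)))
  have hsum : Summable fun q : principalTwists I × unitLattice K => ∫ p in Set.univ ×ˢ F,
      placeKernel s (twistGen q.1) (logPlaceEquiv K (p + (0, (q.2 : logSpace K)))) :=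
    Summable.of_norm_bounded (summable_integral_norm_twist I hF hs) fun q =>
      norm_integral_le_integral_norm _
  have h1 := hsum.hasSum.prod_fiberwise key
  have h2 := (summable_partialZeta I hs).hasSum.mul_left (logPlaceConst K * archProd K s *
    (FractionalIdeal.absNorm (I : FractionalIdeal (𝓞 K)⁰ K) : ℂ) ^ (-s))
  have h3 := h1.unique (h2.congr_fun fun a => by
    rw [cpow_abs_norm_twistGen, Complex.real_smul]; ring)
  rw [← partialZeta] at h3
  rw [← h3]
  exact hsum.hasSum

theorem summable_integral_norm_placeKernel (I : (FractionalIdeal (𝓞 K)⁰ K)ˣ) {F : Set (logSpace K)}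
    (hF : IsUnitDomain F) {s : ℂ} (hs : 1 < s.re) :
    Summable fun α : {α : K // α ∈ (I : FractionalIdeal (𝓞 K)⁰ K) ∧ α ≠ 0} =>
      ∫ p in Set.univ ×ˢ F, ‖placeKernel s (α : K) (logPlaceEquiv K p)‖ := by
  have h := summable_integral_norm_twist I hF hs
  have h2 : Summable fun q : torsion K × (principalTwists I × unitLattice K) =>
      ∫ p in Set.univ ×ˢ F, ‖placeKernel s (twistElement I q) (logPlaceEquiv K p)‖ := by
    simp_rw [setIntegral_placeKernel_twistElement fun z => ‖z‖]
    have := (hasSum_prod_snd (T := torsion K) (Complex.hasSum_ofReal.2 h.hasSum)).summable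
    exact Complex.summable_ofReal.1 this
  exact ((Equiv.ofBijective _ (twistElement_bijective I)).summable_iff).1 h2

theorem hasSum_integral_placeKernel (I : (FractionalIdeal (𝓞 K)⁰ K)ˣ) {F : Set (logSpace K)}
    (hF : IsUnitDomain F) {s : ℂ} (hs : 1 < s.re) :
    HasSum (fun α : {α : K // α ∈ (I : FractionalIdeal (𝓞 K)⁰ K) ∧ α ≠ 0} =>
      ∫ p in Set.univ ×ˢ F, placeKernel s (α : K) (logPlaceEquiv K p))
      (torsionOrder K * (logPlaceConst K * archProd K s *
        (FractionalIdeal.absNorm (I : FractionalIdeal (𝓞 K)⁰ K) : ℂ) ^ (-s) * partialZeta I s)) := by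
  have h2 : HasSum (fun q : torsion K × (principalTwists I × unitLattice K) =>
      ∫ p in Set.univ ×ˢ F, placeKernel s (twistElement I q) (logPlaceEquiv K p))
      (torsionOrder K * (logPlaceConst K * archProd K s *
        (FractionalIdeal.absNorm (I : FractionalIdeal (𝓞 K)⁰ K) : ℂ) ^ (-s) * partialZeta I s)) := by
    simp_rw [setIntegral_placeKernel_twistElement fun z => z]
    rw [torsionOrder, Nat.card_eq_fintype_card]
    exact hasSum_prod_snd (hasSum_integral_twist I hF hs)
  exact ((Equiv.ofBijective _ (twistElement_bijective I)).hasSum_iff).1 h2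

/-- The Mellin transform of the theta mean. -/
theorem mellin_thetaMean_sub (I : (FractionalIdeal (𝓞 K)⁰ K)ˣ) {F : Set (logSpace K)}
    (hF : IsUnitDomain F) {s : ℂ} (hs : 1 < s.re) :
    mellin (fun t => (thetaMean (I : FractionalIdeal (𝓞 K)⁰ K) F t : ℂ) - volume.real F)
      (Module.finrank ℚ K * s / 2) = torsionOrder K * (logPlaceConst K * archProd K s *
        (FractionalIdeal.absNorm (I : FractionalIdeal (𝓞 K)⁰ K) : ℂ) ^ (-s) * partialZeta I s) := by
  have hs0 : 0 < s.re := by linarith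
  have := countable_nonzero_elements I
  have hint : ∀ α : {α : K // α ∈ (I : FractionalIdeal (𝓞 K)⁰ K) ∧ α ≠ 0},
      IntegrableOn (fun p => placeKernel s (α : K) (logPlaceEquiv K p)) (Set.univ ×ˢ F) := fun α =>
    (integrable_comp_logPlaceEquiv (integrable_placeKernel hs0 α.2.2)).integrableOn
  have hsum := summable_integral_norm_placeKernel I hF hs
  have h1 := integrable_tsum_of_summable_integral_norm hint hsum
  have h2 := hasSum_integral_of_summable_integral_norm hint hsum
  rw [(hasSum_integral_placeKernel I hF hs).unique h2, mellin_eq_integral_exp]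
  -- Fubini: the τ-integral is the Mellin transform in logarithmic form, and the x-integral over F
  -- is the theta mean without its constant term.
  have h3 := setIntegral_prod (μ := (volume : Measure ℝ)) (ν := (volume : Measure (logSpace K)))
    (fun p => ∑' α : {α : K // α ∈ (I : FractionalIdeal (𝓞 K)⁰ K) ∧ α ≠ 0},
      placeKernel s (α : K) (logPlaceEquiv K p)) h1
  rw [Measure.volume_eq_prod, h3, Measure.restrict_univ]
  refine integral_congr_ae (Filter.Eventually.of_forall fun τ => ?_)
  simp only
  rw [← Complex.ofReal_sub, thetaMean_sub I hF (Real.exp_pos τ), ← integral_complex_ofReal,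
    ← integral_const_mul]
  refine integral_congr_ae (Filter.Eventually.of_forall fun x => ?_)
  simp only [placeKernel_logPlaceEquiv]
  rw [tsum_mul_left, idealTheta₀, Complex.ofReal_tsum]

end Unfold


/-! ### Ideal classes and the trace dual. -/

section Classes

open scoped Classical
open NumberField NumberField.InfinitePlace NumberField.Units NumberField.Units.dirichletUnitTheorem
  MeasureTheory nonZeroDivisors

variable {K : Type*} [Field K] [NumberField K]

theorem mem_principalTwists_iff (I : (FractionalIdeal (𝓞 K)⁰ K)ˣ) (a : (Ideal (𝓞 K))⁰) :
    a ∈ principalTwists I ↔ ClassGroup.mk K I = (ClassGroup.mk0 a)⁻¹ := by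
  rw [eq_inv_iff_mul_eq_one, mul_comm, ← ClassGroup.mk_mk0 K, ← map_mul, ClassGroup.mk_eq_one_iff,
    FractionalIdeal.isPrincipal_iff]
  simp only [Units.val_mul, FractionalIdeal.coe_mk0]
  constructor
  · rintro ⟨α, -, h⟩
    exact ⟨α, h.symm⟩
  · rintro ⟨α, h⟩
    refine ⟨α, ?_, h.symm⟩
    rintro rfl
    rw [FractionalIdeal.spanSingleton_zero] at h
    exact (FractionalIdeal.mk0 K a * I).ne_zero h

/-- The Dedekind zeta function as the sum of the partial zeta functions. -/
theorem sum_partialZeta {r : ClassGroup (𝓞 K) → (FractionalIdeal (𝓞 K)⁰ K)ˣ}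
    (hr : Function.Bijective fun C => ClassGroup.mk K (r C)) {s : ℂ} (hs : 1 < s.re) :
    ∑ C, partialZeta (r C) s = dedekindZeta K s := by
  have h := hasSum_dedekindZeta K hs
  rw [← h.tsum_eq]
  simp_rw [partialZeta]
  have h1 : ∀ C, ∑' a : principalTwists (r C),
      (Ideal.absNorm ((a : (Ideal (𝓞 K))⁰) : Ideal (𝓞 K)) : ℂ) ^ (-s) = ∑' a : (Ideal (𝓞 K))⁰,
        (principalTwists (r C)).indicator (fun a : (Ideal (𝓞 K))⁰ =>
          (Ideal.absNorm (a : Ideal (𝓞 K)) : ℂ) ^ (-s)) a := fun C =>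
    tsum_subtype _ fun a : (Ideal (𝓞 K))⁰ => (Ideal.absNorm (a : Ideal (𝓞 K)) : ℂ) ^ (-s)
  simp_rw [h1]
  rw [← Summable.tsum_finsetSum fun C _ => h.summable.indicator _]
  refine tsum_congr fun a => ?_
  -- Each ideal a is counted once, by the only representative whose class is inverse to that of a.
  obtain ⟨C, hC, hu⟩ := hr.existsUnique (ClassGroup.mk0 a)⁻¹
  rw [Finset.sum_eq_single C]
  · exact Set.indicator_of_mem ((mem_principalTwists_iff _ _).2 hC) _
  · intro D _ hD
    exact Set.indicator_of_notMem (fun h => hD (hu D ((mem_principalTwists_iff _ _).1 h))) _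
  · simp

variable (K) in
theorem exists_classRep (C : ClassGroup (𝓞 K)) :
    ∃ I : (FractionalIdeal (𝓞 K)⁰ K)ˣ, ClassGroup.mk K I = C :=
  ClassGroup.induction K (P := fun C => ∃ I : (FractionalIdeal (𝓞 K)⁰ K)ˣ, ClassGroup.mk K I = C)
    (fun I => ⟨I, rfl⟩) C

/-- A fractional ideal in a given class. -/
noncomputable def classRep (C : ClassGroup (𝓞 K)) : (FractionalIdeal (𝓞 K)⁰ K)ˣ :=
  (exists_classRep K C).choose

theorem mk_classRep (C : ClassGroup (𝓞 K)) : ClassGroup.mk K (classRep C) = C :=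
  (exists_classRep K C).choose_spec

theorem bijective_mk_classRep :
    Function.Bijective fun C : ClassGroup (𝓞 K) => ClassGroup.mk K (classRep C) := by
  simp_rw [mk_classRep]
  exact Function.bijective_id

theorem traceDual_eq (I : (FractionalIdeal (𝓞 K)⁰ K)ˣ) : traceDual I = traceDual 1 * I⁻¹ := by
  refine Units.ext ?_
  rw [Units.val_mul, Units.val_inv_eq_inv_val]
  exact FractionalIdeal.dual_eq_mul_inv ℤ ℚ _

/-- The dual of I is the inverse different times I⁻¹, so duality acts on classes as inversion
followed by a translation. Hence the dual representatives also sum to the full ζ_K. -/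
theorem bijective_mk_traceDual_classRep :
    Function.Bijective fun C : ClassGroup (𝓞 K) => ClassGroup.mk K (traceDual (classRep C)) := by
  have : (fun C : ClassGroup (𝓞 K) => ClassGroup.mk K (traceDual (classRep C))) =
      fun C => ClassGroup.mk K (traceDual 1) * C⁻¹ := by
    funext C
    rw [traceDual_eq, map_mul, map_inv, mk_classRep]
  rw [this]
  simp_rw [← div_eq_mul_inv]
  exact (Equiv.divLeft (ClassGroup.mk K (traceDual 1))).bijective

theorem absNorm_traceDual (I : (FractionalIdeal (𝓞 K)⁰ K)ˣ) :
    (FractionalIdeal.absNorm (traceDual I : FractionalIdeal (𝓞 K)⁰ K) : ℝ) =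
      ((FractionalIdeal.absNorm (I : FractionalIdeal (𝓞 K)⁰ K) : ℝ) * |(discr K : ℝ)|)⁻¹ := by
  have h1 := congrArg FractionalIdeal.absNorm (coeIdeal_differentIdeal ℤ ℚ K (𝓞 K))
  rw [FractionalIdeal.coeIdeal_absNorm, absNorm_differentIdeal K, map_inv₀] at h1
  rw [traceDual_eq, Units.val_mul, Units.val_inv_eq_inv_val, map_mul, map_inv₀]
  have h2 : FractionalIdeal.absNorm (traceDual (1 : (FractionalIdeal (𝓞 K)⁰ K)ˣ) :
      FractionalIdeal (𝓞 K)⁰ K) =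
      ((discr K).natAbs : ℚ)⁻¹ := by
    rw [h1, inv_inv]
    rfl
  rw [h2]
  push_cast
  rw [Nat.cast_natAbs, Int.cast_abs, mul_inv, mul_comm]

end Classes

/-! ### Entire completion, functional equation and the pole at 1. -/

section Completed

open scoped Classical
open NumberField NumberField.InfinitePlace NumberField.Units NumberField.Units.dirichletUnitTheorem
  MeasureTheory nonZeroDivisors

variable {K : Type*} [Field K] [NumberField K]

theorem finrank_cast_ne_zero : (Module.finrank ℚ K : ℂ) ≠ 0 := by
  exact_mod_cast Module.finrank_pos.ne'

theorem finrank_div_two_lt {s : ℂ} (hs : 1 < s.re) :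
    (Module.finrank ℚ K : ℝ) / 2 < ((Module.finrank ℚ K : ℂ) * s / 2).re := by
  have h0 : (0 : ℝ) < Module.finrank ℚ K := by exact_mod_cast Module.finrank_pos
  have : ((Module.finrank ℚ K : ℂ) * s / 2).re = Module.finrank ℚ K * s.re / 2 := by simp
  rw [this]
  nlinarith

theorem heckePair_Λ (I : (FractionalIdeal (𝓞 K)⁰ K)ˣ) {F : Set (logSpace K)}
    (hF : IsUnitDomain F) {s : ℂ} (hs : 1 < s.re) :
    (heckePair I F hF).Λ (Module.finrank ℚ K * s / 2) =
      torsionOrder K * (logPlaceConst K * archProd K s *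
        (FractionalIdeal.absNorm (I : FractionalIdeal (𝓞 K)⁰ K) : ℂ) ^ (-s) * partialZeta I s) := by
  rw [← mellin_thetaMean_sub I hF hs]
  exact ((heckePair I F hF).hasMellin (finrank_div_two_lt hs)).2.symm

theorem heckePair_symm_Λ (I : (FractionalIdeal (𝓞 K)⁰ K)ˣ) {F : Set (logSpace K)}
    (hF : IsUnitDomain F) {s : ℂ} (hs : 1 < s.re) :
    (heckePair I F hF).symm.Λ (Module.finrank ℚ K * s / 2) =
      torsionOrder K * (logPlaceConst K * archProd K s *
        (FractionalIdeal.absNorm (traceDual I : FractionalIdeal (𝓞 K)⁰ K) : ℂ) ^ (-s) *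
          partialZeta (traceDual I) s) := by
  rw [← mellin_thetaMean_sub (traceDual I) hF.neg hs]
  exact ((heckePair I F hF).symm.hasMellin (finrank_div_two_lt hs)).2.symm

theorem absNorm_pos (I : (FractionalIdeal (𝓞 K)⁰ K)ˣ) :
    (0 : ℝ) < (FractionalIdeal.absNorm (I : FractionalIdeal (𝓞 K)⁰ K) : ℝ) := by
  have h1 := FractionalIdeal.absNorm_nonneg (I : FractionalIdeal (𝓞 K)⁰ K)
  have h2 : FractionalIdeal.absNorm (I : FractionalIdeal (𝓞 K)⁰ K) ≠ 0 := fun h =>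
    I.ne_zero (FractionalIdeal.absNorm_eq_zero_iff.1 h)
  exact_mod_cast lt_of_le_of_ne h1 h2.symm

variable (K) in
theorem abs_discr_pos : (0 : ℝ) < |(discr K : ℝ)| :=
  abs_pos.2 (by exact_mod_cast discr_ne_zero K)

theorem absNorm_traceDual_cpow (I : (FractionalIdeal (𝓞 K)⁰ K)ˣ) (s : ℂ) :
    (FractionalIdeal.absNorm (traceDual I : FractionalIdeal (𝓞 K)⁰ K) : ℂ) ^ (-s) =
      (FractionalIdeal.absNorm (I : FractionalIdeal (𝓞 K)⁰ K) : ℂ) ^ s *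
        ((|(discr K : ℝ)| : ℝ) : ℂ) ^ s := by
  have h := absNorm_traceDual I
  have h1 : (FractionalIdeal.absNorm (traceDual I : FractionalIdeal (𝓞 K)⁰ K) : ℂ) =
      (((FractionalIdeal.absNorm (I : FractionalIdeal (𝓞 K)⁰ K) : ℝ) * |(discr K : ℝ)| : ℝ) : ℂ)⁻¹ := by
    rw [← Complex.ofReal_inv, ← h, Complex.ofReal_ratCast]
  have hN := absNorm_pos I
  have hd := abs_discr_pos K
  rw [h1, Complex.inv_cpow _ _ (by
    rw [Complex.arg_ofReal_of_nonneg (by positivity)]; exact Real.pi_pos.ne), Complex.cpow_neg,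
    inv_inv, Complex.ofReal_mul, Complex.mul_cpow_ofReal_nonneg hN.le hd.le, Complex.ofReal_ratCast]

/-- The norm of I cancels between the prefactor, ε and the norm of the dual, leaving
|d|^s·|d|^(-1/2). The common factor no longer depends on I, so the classes can be summed. -/
theorem heckePair_Λ_one_sub (I : (FractionalIdeal (𝓞 K)⁰ K)ˣ) {F : Set (logSpace K)}
    (hF : IsUnitDomain F) {s : ℂ} (hs : 1 < s.re) :
    (FractionalIdeal.absNorm (I : FractionalIdeal (𝓞 K)⁰ K) : ℂ) ^ (1 - s) *
      (heckePair I F hF).Λ (Module.finrank ℚ K * (1 - s) / 2) =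
      torsionOrder K * logPlaceConst K * archProd K s *
        ((|(discr K : ℝ)| : ℝ) : ℂ) ^ (s - 1 / 2) * partialZeta (traceDual I) s := by
  have hk : (((heckePair I F hF).k : ℝ) : ℂ) = Module.finrank ℚ K / 2 := by
    simp [heckePair]
  have hε : (heckePair I F hF).ε = ((FractionalIdeal.absNorm (I : FractionalIdeal (𝓞 K)⁰ K) : ℂ) *
      ((|(discr K : ℝ)| : ℝ) : ℂ) ^ (1 / 2 : ℂ))⁻¹ := by
    have : (((√|(discr K : ℝ)| : ℝ)) : ℂ) = ((|(discr K : ℝ)| : ℝ) : ℂ) ^ (1 / 2 : ℂ) := by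
      rw [Real.sqrt_eq_rpow, Complex.ofReal_cpow (abs_nonneg _)]
      norm_num
    rw [← this]
    simp [heckePair]
  have h1 : (Module.finrank ℚ K * (1 - s) / 2 : ℂ) =
      ((heckePair I F hF).k : ℂ) - Module.finrank ℚ K * s / 2 := by
    rw [hk]; ring
  have hN : (FractionalIdeal.absNorm (I : FractionalIdeal (𝓞 K)⁰ K) : ℂ) ≠ 0 := by
    rw [← Complex.ofReal_ratCast]
    exact Complex.ofReal_ne_zero.2 (absNorm_pos I).ne'
  have hd : ((|(discr K : ℝ)| : ℝ) : ℂ) ≠ 0 := Complex.ofReal_ne_zero.2 (abs_discr_pos K).ne'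
  rw [h1, WeakFEPair.functional_equation, heckePair_symm_Λ I hF hs, hε, smul_eq_mul,
    absNorm_traceDual_cpow, Complex.cpow_sub _ _ hN, Complex.cpow_sub _ _ hd, Complex.cpow_one]
  have h2 : (FractionalIdeal.absNorm (I : FractionalIdeal (𝓞 K)⁰ K) : ℂ) ^ s ≠ 0 := by
    simp [Complex.cpow_eq_zero_iff, hN]
  have h3 : ((|(discr K : ℝ)| : ℝ) : ℂ) ^ (1 / 2 : ℂ) ≠ 0 := fun h =>
    hd ((Complex.cpow_eq_zero_iff _ _).1 h).1
  field_simp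

/-- `s (s - 1)` times the completed zeta function, without constants. -/
noncomputable def heckeEntire (F : Set (logSpace K)) (hF : IsUnitDomain F) (s : ℂ) : ℂ :=
  ∑ C : ClassGroup (𝓞 K),
    (FractionalIdeal.absNorm (classRep C : FractionalIdeal (𝓞 K)⁰ K) : ℂ) ^ s *
      (s * (s - 1) * (heckePair (classRep C) F hF).Λ₀ (Module.finrank ℚ K * s / 2) -
        (s - 1) * (2 / Module.finrank ℚ K) * (heckePair (classRep C) F hF).f₀ +
        s * (2 / Module.finrank ℚ K) * (heckePair (classRep C) F hF).ε *
          (heckePair (classRep C) F hF).g₀)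

theorem absNorm_cast_ne_zero (I : (FractionalIdeal (𝓞 K)⁰ K)ˣ) :
    (FractionalIdeal.absNorm (I : FractionalIdeal (𝓞 K)⁰ K) : ℂ) ≠ 0 := by
  rw [← Complex.ofReal_ratCast]
  exact Complex.ofReal_ne_zero.2 (absNorm_pos I).ne'

theorem differentiable_heckeEntire {F : Set (logSpace K)} (hF : IsUnitDomain F) :
    Differentiable ℂ (heckeEntire F hF) := by
  unfold heckeEntire
  refine Differentiable.fun_sum fun C _ => Differentiable.mul ?_ ?_
  · exact fun s => (differentiableAt_id).const_cpow (Or.inl (absNorm_cast_ne_zero _))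
  · have h : Differentiable ℂ fun s : ℂ =>
        (heckePair (classRep C) F hF).Λ₀ (Module.finrank ℚ K * s / 2) :=
      (heckePair (classRep C) F hF).differentiable_Λ₀.comp (by fun_prop)
    fun_prop

/-- Λ differs from the entire Λ₀ by polar terms which, in the variable ns/2, sit at s = 0 and s = 1;
the factor s(s-1) clears both. -/
theorem heckeEntire_eq {F : Set (logSpace K)} (hF : IsUnitDomain F) {s : ℂ} (h0 : s ≠ 0)
    (h1 : s ≠ 1) : heckeEntire F hF s = s * (s - 1) * ∑ C : ClassGroup (𝓞 K),
    (FractionalIdeal.absNorm (classRep C : FractionalIdeal (𝓞 K)⁰ K) : ℂ) ^ s *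
      (heckePair (classRep C) F hF).Λ (Module.finrank ℚ K * s / 2) := by
  rw [heckeEntire, Finset.mul_sum]
  refine Finset.sum_congr rfl fun C _ => ?_
  have hk : (((heckePair (classRep C) F hF).k : ℝ) : ℂ) = Module.finrank ℚ K / 2 := by
    simp [heckePair]
  rw [WeakFEPair.Λ₀_eq, hk, smul_eq_mul, smul_eq_mul]
  have hn := finrank_cast_ne_zero (K := K)
  have h1' : (1 : ℂ) - s ≠ 0 := sub_ne_zero.2 h1.symm
  have hns : (Module.finrank ℚ K : ℂ) / 2 - Module.finrank ℚ K * s / 2 =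
      Module.finrank ℚ K * (1 - s) / 2 := by ring
  rw [hns]
  have e1 : 1 / ((Module.finrank ℚ K : ℂ) * s / 2) = (2 / Module.finrank ℚ K) * s⁻¹ := by
    field_simp
  have e2 : ∀ ε : ℂ, ε / ((Module.finrank ℚ K : ℂ) * (1 - s) / 2) =
      (2 / Module.finrank ℚ K) * ε * (1 - s)⁻¹ := fun ε => by
    field_simp
  rw [e1, e2]
  have i1 : s * s⁻¹ = 1 := mul_inv_cancel₀ h0
  have i2 : (1 - s) * (1 - s)⁻¹ = 1 := mul_inv_cancel₀ h1'
  linear_combination (FractionalIdeal.absNorm (classRep C : FractionalIdeal (𝓞 K)⁰ K) : ℂ) ^ s *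
    ((s - 1) * (2 / Module.finrank ℚ K) * (heckePair (classRep C) F hF).f₀ * i1 -
      s * (2 / Module.finrank ℚ K) * (heckePair (classRep C) F hF).ε *
        (heckePair (classRep C) F hF).g₀ * i2)

theorem differentiable_archFactor_inv {m : ℕ} (hm : 0 < m) :
    Differentiable ℂ fun s => (archFactor m s)⁻¹ := by
  unfold archFactor
  simp_rw [mul_inv, ← Complex.cpow_neg, neg_neg]
  refine Differentiable.mul (fun s => DifferentiableAt.const_cpow (by fun_prop) (Or.inl ?_)) ?_
  · exact Complex.ofReal_ne_zero.2 (by positivity)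
  · exact Complex.differentiable_one_div_Gamma.comp (by fun_prop)

/-- The entire function `1 / (s * archFactor m s)`. -/
noncomputable def archFactorInv (m : ℕ) (s : ℂ) : ℂ :=
  ((Real.pi * m : ℝ) : ℂ) ^ (m * s / 2) * (m / 2) * (Complex.Gamma (m * s / 2 + 1))⁻¹

theorem differentiable_archFactorInv {m : ℕ} (hm : 0 < m) : Differentiable ℂ (archFactorInv m) := by
  unfold archFactorInv
  refine Differentiable.mul (Differentiable.mul
    (fun s => DifferentiableAt.const_cpow (by fun_prop) (Or.inl ?_)) (by fun_prop)) ?_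
  · exact Complex.ofReal_ne_zero.2 (by positivity)
  · exact Complex.differentiable_one_div_Gamma.comp (by fun_prop)

/-- From Γ(z+1) = zΓ(z) with z = ms/2: the factor s⁻¹ is absorbed by the zero of 1/Γ at 0. One place
is enough to remove the factor s from `heckeEntire`. -/
theorem archFactorInv_eq {m : ℕ} (hm : 0 < m) {s : ℂ} (hs : s ≠ 0) :
    archFactorInv m s = s⁻¹ * (archFactor m s)⁻¹ := by
  have hm' : (m : ℂ) ≠ 0 := by exact_mod_cast hm.ne'
  rw [archFactorInv, archFactor, Complex.Gamma_add_one _ (by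
    exact div_ne_zero (mul_ne_zero hm' hs) two_ne_zero), mul_inv, mul_inv, ← Complex.cpow_neg,
    neg_neg]
  field_simp

theorem archFactor_ne_zero {m : ℕ} (hm : 0 < m) {s : ℂ} (hs : 0 < s.re) : archFactor m s ≠ 0 := by
  refine mul_ne_zero (fun h => ?_) (Complex.Gamma_ne_zero_of_re_pos ?_)
  · exact (Complex.ofReal_ne_zero.2 (by positivity : Real.pi * m ≠ 0))
      ((Complex.cpow_eq_zero_iff _ _).1 h).1
  · have : ((m : ℂ) * s / 2).re = m * s.re / 2 := by simp
    rw [this]; positivity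

theorem archProd_ne_zero {s : ℂ} (hs : 0 < s.re) : archProd K s ≠ 0 :=
  Finset.prod_ne_zero_iff.2 fun _ _ => archFactor_ne_zero mult_pos hs

variable (K) in
/-- The entire function `1 / (s * archProd K s)`. -/
noncomputable def archProdInv (s : ℂ) : ℂ :=
  archFactorInv (mult (w₀ : InfinitePlace K)) s *
    ∏ w ∈ Finset.univ.erase (w₀ : InfinitePlace K), (archFactor (mult w) s)⁻¹

theorem differentiable_archProdInv : Differentiable ℂ (archProdInv K) := by
  unfold archProdInv
  exact (differentiable_archFactorInv mult_pos).mul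
    (Differentiable.fun_finsetProd fun w _ => differentiable_archFactor_inv mult_pos)

theorem archProdInv_eq {s : ℂ} (hs : s ≠ 0) : archProdInv K s = s⁻¹ * (archProd K s)⁻¹ := by
  rw [archProdInv, archFactorInv_eq mult_pos hs, mul_assoc, archProd, ← Finset.prod_inv_distrib,
    Finset.mul_prod_erase _ (fun w : InfinitePlace K => (archFactor (mult w) s)⁻¹)
      (Finset.mem_univ _)]

variable (K) in
/-- A chosen fundamental domain. -/
noncomputable def unitDomain : Set (logSpace K) := exists_isUnitDomain.choose

theorem isUnitDomain_unitDomain : IsUnitDomain (unitDomain K) := exists_isUnitDomain.choose_spec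

variable (K) in
/-- The entire function `(s - 1) ζ_K(s)`. -/
noncomputable def dedekindEntire (s : ℂ) : ℂ :=
  (torsionOrder K * logPlaceConst K : ℂ)⁻¹ * archProdInv K s *
    heckeEntire (unitDomain K) isUnitDomain_unitDomain s

theorem differentiable_dedekindEntire : Differentiable ℂ (dedekindEntire K) :=
  ((differentiable_const _).mul differentiable_archProdInv).mul
    (differentiable_heckeEntire isUnitDomain_unitDomain)

variable (K) in
theorem torsionOrder_mul_logPlaceConst_ne_zero :
    (torsionOrder K * logPlaceConst K : ℂ) ≠ 0 :=
  mul_ne_zero (Nat.cast_ne_zero.2 (torsionOrder_ne_zero K))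
    (Complex.ofReal_ne_zero.2 logPlaceConst_ne_zero)

theorem dedekindEntire_eq_of_one_lt {s : ℂ} (hs : 1 < s.re) :
    dedekindEntire K s = (s - 1) * dedekindZeta K s := by
  have h0 : s ≠ 0 := by rintro rfl; simp at hs; linarith
  have h1 : s ≠ 1 := by rintro rfl; simp at hs
  have hc := torsionOrder_mul_logPlaceConst_ne_zero K
  have ha := archProd_ne_zero (K := K) (s := s) (by linarith)
  rw [dedekindEntire, archProdInv_eq h0, heckeEntire_eq _ h0 h1, ← sum_partialZeta bijective_mk_classRep hs]
  have : ∀ C : ClassGroup (𝓞 K),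
      (FractionalIdeal.absNorm (classRep C : FractionalIdeal (𝓞 K)⁰ K) : ℂ) ^ s *
      (heckePair (classRep C) (unitDomain K) isUnitDomain_unitDomain).Λ (Module.finrank ℚ K * s / 2) =
      torsionOrder K * logPlaceConst K * archProd K s * partialZeta (classRep C) s := fun C => by
    rw [heckePair_Λ _ _ hs, Complex.cpow_neg]
    have hN : (FractionalIdeal.absNorm (classRep C : FractionalIdeal (𝓞 K)⁰ K) : ℂ) ^ s ≠ 0 :=
      fun h => absNorm_cast_ne_zero (classRep C) ((Complex.cpow_eq_zero_iff _ _).1 h).1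
    field_simp
  simp_rw [this]
  rw [← Finset.mul_sum]
  generalize ∑ C : ClassGroup (𝓞 K), partialZeta (classRep C) s = S
  generalize (torsionOrder K * logPlaceConst K : ℂ) = c at *
  field_simp

/-- The functional equation applied class by class and summed over dual classes, with 1 - s in the
region of convergence. Poles of `archProd K s` cause no exception: there the totalized Gamma
function and its inverse are both 0. -/
theorem dedekindEntire_eq_of_re_neg {s : ℂ} (hs : s.re < 0) :
    dedekindEntire K s = (s - 1) * (((|(discr K : ℝ)| : ℝ) : ℂ) ^ (1 / 2 - s) *
      (archProd K (1 - s) * (archProd K s)⁻¹) * dedekindZeta K (1 - s)) := by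
  have h0 : s ≠ 0 := by rintro rfl; simp at hs
  have h1 : s ≠ 1 := by rintro rfl; simp at hs; linarith
  have hc := torsionOrder_mul_logPlaceConst_ne_zero K
  have hs1 : 1 < (1 - s).re := by rw [Complex.sub_re, Complex.one_re]; linarith
  rw [dedekindEntire, archProdInv_eq h0, heckeEntire_eq _ h0 h1,
    ← sum_partialZeta bijective_mk_traceDual_classRep hs1]
  have : ∀ C : ClassGroup (𝓞 K),
      (FractionalIdeal.absNorm (classRep C : FractionalIdeal (𝓞 K)⁰ K) : ℂ) ^ s *
      (heckePair (classRep C) (unitDomain K) isUnitDomain_unitDomain).Λ (Module.finrank ℚ K * s / 2) =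
      torsionOrder K * logPlaceConst K * archProd K (1 - s) *
        ((|(discr K : ℝ)| : ℝ) : ℂ) ^ (1 / 2 - s) * partialZeta (traceDual (classRep C)) (1 - s) :=
    fun C => by
      have := heckePair_Λ_one_sub (classRep C) (isUnitDomain_unitDomain (K := K)) hs1
      rw [sub_sub_cancel] at this
      rw [this]
      congr 3
      ring
  simp_rw [this]
  rw [← Finset.mul_sum]
  generalize ∑ C : ClassGroup (𝓞 K), partialZeta (traceDual (classRep C)) (1 - s) = S
  generalize (torsionOrder K * logPlaceConst K : ℂ) = c at *
  field_simp

/-- By continuity the value is the limit of (s-1)ζ_K(s) from the right, i.e. the residue, which is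
non-zero by the class number formula. -/
theorem dedekindEntire_one_ne_zero : dedekindEntire K 1 ≠ 0 := by
  have h1 : Filter.Tendsto (fun s : ℝ => dedekindEntire K s) (nhdsWithin 1 (Set.Ioi 1))
      (nhds (dedekindEntire K 1)) := by
    have : Continuous fun s : ℝ => dedekindEntire K s :=
      differentiable_dedekindEntire.continuous.comp Complex.continuous_ofReal
    have h := this.tendsto 1
    rw [Complex.ofReal_one] at h
    exact h.mono_left nhdsWithin_le_nhds
  have h2 := tendsto_sub_one_mul_dedekindZeta_nhdsGT K
  have h3 : Filter.Tendsto (fun s : ℝ => dedekindEntire K s) (nhdsWithin 1 (Set.Ioi 1))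
      (nhds (dedekindZeta_residue K : ℂ)) := by
    refine h2.congr' ?_
    filter_upwards [self_mem_nhdsWithin] with s hs
    rw [dedekindEntire_eq_of_one_lt (by simpa using hs)]
  rw [tendsto_nhds_unique h1 h3]
  exact Complex.ofReal_ne_zero.2 (dedekindZeta_residue_ne_zero K)

variable (K) in
theorem isDedekindZeta_dedekindEntire :
    IsDedekindZeta K fun s => dedekindEntire K s / (s - 1) where
  eq_series s hs := by
    have h1 : s - 1 ≠ 0 := sub_ne_zero.2 (by rintro rfl; simp at hs)
    rw [dedekindEntire_eq_of_one_lt hs, mul_div_cancel_left₀ _ h1]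
  holomorphic := differentiable_dedekindEntire.differentiableOn.div (by fun_prop)
    fun s hs => sub_ne_zero.2 hs
  simple_pole := by
    have hA : AnalyticAt ℂ (dedekindEntire K) 1 := differentiable_dedekindEntire.analyticAt 1
    have hM : MeromorphicAt (fun s => dedekindEntire K s / (s - 1)) 1 :=
      hA.meromorphicAt.div (by fun_prop)
    have := (meromorphicOrderAt_eq_int_iff (n := -1) hM).2
      ⟨dedekindEntire K, hA, dedekindEntire_one_ne_zero, Filter.Eventually.of_forall fun s => by
        rw [zpow_neg_one, smul_eq_mul, div_eq_inv_mul]⟩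
    exact_mod_cast this

end Completed


/-! ### The final estimate. -/

section Bound

open NumberField NumberField.InfinitePlace nonZeroDivisors

variable {K : Type*} [Field K] [NumberField K]

theorem norm_dedekindZeta_le {s : ℂ} (hs : 1 < s.re) :
    ‖dedekindZeta K s‖ ≤ (riemannZeta s.re).re ^ Module.finrank ℚ K := by
  rw [riemannZeta_re_eq_tsum hs]
  refine le_of_tendsto' (hasSum_dedekindZeta K hs).norm fun S => ?_
  refine (norm_sum_le _ _).trans ((Finset.sum_congr rfl fun a _ => ?_).trans_le
    (sum_absNorm_rpow_le K hs S))
  have : (0 : ℝ) < (Ideal.absNorm (a : Ideal (𝓞 K)) : ℝ) := by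
    have h : Ideal.absNorm (a : Ideal (𝓞 K)) ≠ 0 := fun h =>
      nonZeroDivisors.coe_ne_zero a (Ideal.absNorm_eq_zero_iff.1 h)
    exact_mod_cast Nat.pos_of_ne_zero h
  rw [← Complex.ofReal_natCast, Complex.norm_cpow_eq_rpow_re_of_pos this, Complex.neg_re]

/-- A real place contributes one even quotient, a complex place one even and one odd, the factors
1/2 cancelling; in total there are ∑ mult w = n factors. -/
theorem norm_archProd_div_le {s : ℂ} (hs : s.re < 0) {R : ℝ}
    (hR : ‖evenGammaQuot s‖ ≤ R ∧ ‖oddGammaQuot s‖ ≤ R) :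
    ‖archProd K (1 - s) * (archProd K s)⁻¹‖ ≤ R ^ Module.finrank ℚ K := by
  have hR0 : 0 ≤ R := (norm_nonneg _).trans hR.1
  have h1 : s.re < 1 := by linarith
  rw [archProd, archProd, ← Finset.prod_inv_distrib, ← Finset.prod_mul_distrib, norm_prod,
    ← sum_mult_eq (K := K), ← Finset.prod_pow_eq_pow_sum]
  refine Finset.prod_le_prod (fun _ _ => norm_nonneg _) fun w _ => ?_
  rcases isReal_or_isComplex w with hw | hw
  · rw [mult, if_pos hw, archFactor_one, archFactor_one, ← evenGammaQuot_eq h1, pow_one]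
    exact hR.1
  · have : archFactor 2 (1 - s) * (archFactor 2 s)⁻¹ = evenGammaQuot s * oddGammaQuot s := by
      rw [evenGammaQuot_mul_oddGammaQuot h1, archFactor_two, archFactor_two, inv_div]
      ring
    rw [mult, if_neg (not_isReal_iff_isComplex.2 hw), this, norm_mul, sq]
    exact mul_le_mul hR.1 hR.2 (norm_nonneg _) hR0

end Bound

/-- The bound for `ζ_K` on `Re s < 0`. Since the meromorphic continuation of `ζ_K` is not available
in Mathlib, its existence is part of the conclusion. -/
theorem mainTheorem3 (K : Type*) [Field K] [NumberField K] :
    (∃ Z : ℂ → ℂ, IsDedekindZeta K Z) ∧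
    ∀ Z : ℂ → ℂ, IsDedekindZeta K Z → ∀ s : ℂ, s.re < 0 →
      ‖Z s‖ ≤
        (|(NumberField.discr K : ℝ)| / (2 * Real.pi) ^ Module.finrank ℚ K) ^ ((1 : ℝ) / 2 - s.re)
        * ‖1 + s - (nearestInt s.re : ℂ)‖ ^
            ((Module.finrank ℚ K : ℝ) * ((1 : ℝ) / 2 + (nearestInt s.re : ℝ) - s.re))
        * (∏ j ∈ Finset.Icc 1 (-nearestInt s.re), ‖s + (j : ℂ) - 1‖ ^ Module.finrank ℚ K)
        * (riemannZeta (1 - (s.re : ℂ))).re ^ Module.finrank ℚ K := by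
  refine ⟨⟨_, isDedekindZeta_dedekindEntire K⟩, fun Z hZ s hs => ?_⟩
  have h1 : s ≠ 1 := by rintro rfl; simp at hs; linarith
  have hs1 : 1 < (1 - s).re := by rw [Complex.sub_re, Complex.one_re]; linarith
  -- Away from 1 any continuation equals the constructed one, to which the functional equation
  -- applies.
  rw [hZ.unique (isDedekindZeta_dedekindEntire K) (by simpa using h1)]
  beta_reduce
  rw [dedekindEntire_eq_of_re_neg hs, mul_div_cancel_left₀ _ (sub_ne_zero.2 h1), norm_mul, norm_mul]
  have hd := abs_discr_pos K
  have hbound := norm_archProd_div_le (K := K) hs (norm_gammaQuot_le hs rfl)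
  have hzeta := norm_dedekindZeta_le (K := K) hs1
  have e1 : ‖((|(NumberField.discr K : ℝ)| : ℝ) : ℂ) ^ (1 / 2 - s)‖ =
      |(NumberField.discr K : ℝ)| ^ ((1 : ℝ) / 2 - s.re) := by
    rw [Complex.norm_cpow_eq_rpow_re_of_pos hd]
    congr 1
    rw [Complex.sub_re]
    norm_num
  have e2 : (((1 - s).re : ℝ) : ℂ) = 1 - (s.re : ℂ) := by simp
  rw [e2] at hzeta
  have e3 : (|(NumberField.discr K : ℝ)| / (2 * Real.pi) ^ Module.finrank ℚ K) ^
      ((1 : ℝ) / 2 - s.re) = |(NumberField.discr K : ℝ)| ^ ((1 : ℝ) / 2 - s.re) *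
        ((2 * Real.pi)⁻¹ ^ ((1 : ℝ) / 2 - s.re)) ^ Module.finrank ℚ K := by
    rw [div_eq_mul_inv, Real.mul_rpow hd.le (by positivity), ← inv_pow,
      Real.rpow_pow_comm (by positivity)]
  have e4 : ‖1 + s - (nearestInt s.re : ℂ)‖ ^
      ((Module.finrank ℚ K : ℝ) * ((1 : ℝ) / 2 + (nearestInt s.re : ℝ) - s.re)) =
      (‖1 + s - (nearestInt s.re : ℂ)‖ ^ ((1 : ℝ) / 2 + (nearestInt s.re : ℝ) - s.re)) ^
        Module.finrank ℚ K := by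
    rw [mul_comm, Real.rpow_mul_natCast (norm_nonneg _)]
  rw [e1, e3, e4, Finset.prod_pow]
  have hR := mul_le_mul_of_nonneg_left
    (mul_le_mul hbound hzeta (norm_nonneg _) ((norm_nonneg _).trans hbound))
    (Real.rpow_nonneg hd.le ((1 : ℝ) / 2 - s.re))
  rw [mul_pow, mul_pow] at hR
  calc _ = _ := mul_assoc _ _ _
    _ ≤ _ := hR
    _ = _ := by ring
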